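/- Let $E_-$ and $E_+$ be finite or countable index sets, $E$ their disjoint union, and let $(\alpha_e)_{e\in E}$, $(\beta_e)_{e\in E}$ be bounded families of real numbers with $\alpha_e>0$ for all $e$ and $(1/\alpha_e)_{e\in E}$ bounded. Consider the star graph $G$ whose edges are half-lines, $(-\infty,0)$ for $e\in E_-$ and $(0,\infty)$ for $e\in E_+$, and the (complex) Hilbert space direct sums $$L^2(G)=\bigoplus_{e\in E_-}L^2(-\infty,0)\oplus\bigoplus_{e\in E_+}L^2(0,\infty),\qquad H^3(G)=\bigoplus_{e\in E_-}H^3(-\infty,0)\oplus\bigoplus_{e\in E_+}H^3(0,\infty).$$ For $u\in H^3(G)$ and $k\in\{0,1,2\}$ put $u^{(k)}(0-)=(u_e^{(k)}(0-))_{e\in E_-}$ and $u^{(k)}(0+)=(u_e^{(k)}(0+))_{e\in E_+}$. Write $\ell^2(E_\pm,\alpha_\pm)$ for the weighted space with inner product $\sum_{e\in E_\pm}\alpha_e x_e\overline{y_e}$, and $\alpha_\pm,\beta_\pm$ also for multiplication by $(\alpha_e)_{e\in E_\pm}$, $(\beta_e)_{e\in E_\pm}$. Let $Y\subseteq \ell^2(E_-)\oplus\ell^2(E_+)$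 be a closed subspace and let $U$ be a densely defined linear operator from $\ell^2(E_-,\alpha_-)$ to $\ell^2(E_+,\alpha_+)$, with domain $D(U)$ and Hilbert space adjoint $U^*$ (with respect to the weighted inner products). Define an operator $A_{Y,U}$ in $L^2(G)$ by $$A_{Y,U}u=(\alpha_e u_e'''+\beta_e u_e')_{e\in E},$$ its domain $D(A_{Y,U})$ being the set of all $u\in H^3(G)$ such that $(u(0-),u(0+))\in Y$, $$\Bigl(-\alpha_-u''(0-)-\tfrac{\beta_-}{2}u(0-),\ \alpha_+u''(0+)+\tfrac{\beta_+}{2}u(0+)\Bigr)\in Y^\perp,$$ $u'(0-)\in D(U)$ and $u'(0+)=Uu'(0-)$. Call a linear operator $L$ between Hilbert spaces, with domain $D(L)$, a contraction if $\|Lx\|\le\|x\|$ for all $x\in D(L)$. Then $A_{Y,U}$ generates a $C_0$-semigroup of contractions on $L^2(G)$ if and only if $U$ is closed and both $U$ and $U^*$ are contractions. Moreover, $U$ and $U^*$ are both contractions if and only if $U$ is a contraction. (In particular, for closed $U$, e.g. whenever $E_-$ is finite, $A_{Y,U}$ generates a $C_0$-semigroup of contractions if and only if $U$ is a contraction.)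 -/

import Mathlib

open MeasureTheory Filter Topology
open scoped ContDiff NNReal ENNReal InnerProductSpace LinearPMap

noncomputable section

namespace StarGraph

/-! ### Contraction semigroups and their generators -/

section Semigroup

variable {X : Type*} [NormedAddCommGroup X] [NormedSpace ℂ X]

/-- A `C₀`-semigroup of bounded linear operators `(T(t))_{t ≥ 0}` on `X`. -/
structure IsC0Semigroup (T : ℝ≥0 → X →L[ℂ] X) : Prop where
  map_zero : T 0 = ContinuousLinearMap.id ℂ X
  map_add : ∀ s t, T (s + t) = (T s).comp (T t)
  continuous_orbit : ∀ x, Continuous fun t => T t x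

/-- `A` is the (infinitesimal) generator of `T`: its domain consists of those `x` for which
`lim_{t ↓ 0} (T(t) x - x) / t` exists, and `A x` is that limit. -/
def IsGenerator (A : X →ₗ.[ℂ] X) (T : ℝ≥0 → X →L[ℂ] X) : Prop :=
  ∀ x y : X, (x, y) ∈ A.graph ↔
    Tendsto (fun t : ℝ≥0 => (((t : ℝ)⁻¹ : ℝ) : ℂ) • (T t x - x)) (𝓝[>] 0) (𝓝 y)

/-- `A` generates a `C₀`-semigroup of contractions. -/
def GeneratesContractionSemigroup (A : X →ₗ.[ℂ] X) : Prop :=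
  ∃ T : ℝ≥0 → X →L[ℂ] X, IsC0Semigroup T ∧ (∀ t, ‖T t‖ ≤ 1) ∧ IsGenerator A T

end Semigroup

/-- A linear operator (defined on a subspace) is a contraction if `‖L x‖ ≤ ‖x‖` on its domain. -/
def IsContraction {X Y : Type*} [NormedAddCommGroup X] [NormedSpace ℂ X]
    [NormedAddCommGroup Y] [NormedSpace ℂ Y] (L : X →ₗ.[ℂ] Y) : Prop :=
  ∀ x : L.domain, ‖L x‖ ≤ ‖(x : X)‖

/-! ### Weak derivatives and boundary values on an open half-line -/

/-- `g` is the weak derivative of `f` on the open set `I ⊆ ℝ`. -/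
def HasWeakDeriv (I : Set ℝ) (f g : ℝ → ℂ) : Prop :=
  ∀ φ : ℝ → ℝ, ContDiff ℝ ∞ φ → HasCompactSupport φ → tsupport φ ⊆ I →
    ∫ x in I, deriv φ x • f x = -∫ x in I, φ x • g x

/-- The (class of the) function `f` on the half-line `I` ending at `0` has a continuous
representative with one-sided limit `c` at `0`. -/
def HasTrace (I : Set ℝ) (f : ℝ → ℂ) (c : ℂ) : Prop :=
  ∃ g : ℝ → ℂ, ContinuousOn g I ∧ f =ᵐ[volume.restrict I] g ∧ Tendsto g (𝓝[I] 0) (𝓝 c)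

/-! ### The star graph -/

/-- `ℓ²(E)`. -/
abbrev Ell2 (E : Type*) : Type _ := lp (fun _ : E => ℂ) 2

/-- Counting measure on the discrete set `E` with weights `w`. -/
def weightMeasure {E : Type*} (w : E → ℝ) : @Measure E ⊤ :=
  (@Measure.count E ⊤).withDensity fun e => ENNReal.ofReal (w e)

/-- The weighted space `ℓ²(E, w)`, the `L²` space of the weighted counting measure, with inner
product `∑ e, x e * conj (y e) * w e`. -/
abbrev WEll2 {E : Type*} (w : E → ℝ) : Type _ := Lp ℂ 2 (weightMeasure w)

variable {Em Ep : Type*}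

/-- The half-line carried by an edge: `(-∞, 0)` for edges in `E₋` (the left summand) and
`(0, ∞)` for edges in `E₊` (the right summand). -/
def halfLine : Em ⊕ Ep → Set ℝ := Sum.elim (fun _ => Set.Iio 0) (fun _ => Set.Ioi 0)

variable (Em Ep) in
/-- `L²(G)`, the Hilbert space direct sum of the `L²` spaces of the edges. -/
abbrev L2G : Type _ :=
  lp (fun e : Em ⊕ Ep => Lp ℂ 2 ((volume : Measure ℝ).restrict (halfLine e))) 2

variable (Em Ep) in
/-- The Hilbert space `ℓ²(E₋) ⊕ ℓ²(E₊)`. -/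
abbrev VertexSpace : Type _ := WithLp 2 (Ell2 Em × Ell2 Ep)

/-- `u'` is the edgewise weak derivative of `u`. -/
def HasDerivG (u u' : L2G Em Ep) : Prop := ∀ e, HasWeakDeriv (halfLine e) (u e) (u' e)

/-- `b e` is the boundary value of `u` at the vertex along the edge `e`: `u_e(0-)` for `e ∈ E₋`
and `u_e(0+)` for `e ∈ E₊`. -/
def HasBoundaryValues (u : L2G Em Ep) (b : Em ⊕ Ep → ℂ) : Prop :=
  ∀ e, HasTrace (halfLine e) (u e) (b e)

/-! ### Linearity and uniqueness -/

lemma isOpen_halfLine (e : Em ⊕ Ep) : IsOpen (halfLine e) := by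
  cases e
  · exact isOpen_Iio
  · exact isOpen_Ioi

lemma locInt {I : Set ℝ} (f : Lp ℂ 2 ((volume : Measure ℝ).restrict I)) :
    LocallyIntegrable f ((volume : Measure ℝ).restrict I) :=
  (Lp.memLp f).locallyIntegrable (by norm_num)

lemma integrable_test {I : Set ℝ} (f : Lp ℂ 2 ((volume : Measure ℝ).restrict I)) {φ : ℝ → ℝ}
    (hφ : Continuous φ) (hc : HasCompactSupport φ) :
    Integrable (fun x => φ x • f x) (volume.restrict I) :=
  (locInt f).integrable_smul_left_of_hasCompactSupport hφ hc

lemma HasWeakDeriv.congr {I : Set ℝ} {f f' g g' : ℝ → ℂ} (h : HasWeakDeriv I f g)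
    (hf : f' =ᵐ[volume.restrict I] f) (hg : g' =ᵐ[volume.restrict I] g) :
    HasWeakDeriv I f' g' := by
  intro φ h1 h2 h3
  have e1 : ∫ x in I, deriv φ x • f' x = ∫ x in I, deriv φ x • f x :=
    integral_congr_ae (by filter_upwards [hf] with x hx; rw [hx])
  have e2 : ∫ x in I, φ x • g' x = ∫ x in I, φ x • g x :=
    integral_congr_ae (by filter_upwards [hg] with x hx; rw [hx])
  rw [e1, e2, h φ h1 h2 h3]

lemma hasDerivG_zero : HasDerivG (0 : L2G Em Ep) 0 := by
  intro e
  have h0 : HasWeakDeriv (halfLine e) (fun _ => 0) (fun _ => 0) := by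
    intro φ _ _ _
    simp
  exact h0.congr (Lp.coeFn_zero _ _ _) (Lp.coeFn_zero _ _ _)

lemma HasDerivG.add {u v u' v' : L2G Em Ep} (hu : HasDerivG u u') (hv : HasDerivG v v') :
    HasDerivG (u + v) (u' + v') := by
  intro e
  have h : HasWeakDeriv (halfLine e) (fun x => u e x + v e x) (fun x => u' e x + v' e x) := by
    intro φ h1 h2 h3
    have hd : Continuous (deriv φ) := h1.continuous_deriv (by simp)
    simp only [smul_add]
    rw [integral_add (integrable_test _ hd h2.deriv) (integrable_test _ hd h2.deriv),
      integral_add (integrable_test _ h1.continuous h2) (integrable_test _ h1.continuous h2),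
      hu e φ h1 h2 h3, hv e φ h1 h2 h3, neg_add]
  exact h.congr (Lp.coeFn_add _ _) (Lp.coeFn_add _ _)

lemma HasDerivG.smul {u u' : L2G Em Ep} (c : ℂ) (hu : HasDerivG u u') :
    HasDerivG (c • u) (c • u') := by
  intro e
  have h : HasWeakDeriv (halfLine e) (fun x => c • u e x) (fun x => c • u' e x) := by
    intro φ h1 h2 h3
    simp only [smul_comm _ c]
    rw [integral_smul, integral_smul, hu e φ h1 h2 h3, smul_neg]
  exact h.congr (Lp.coeFn_smul _ _) (Lp.coeFn_smul _ _)

/-- The weak derivative of `0` is `0`. -/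
lemma HasDerivG.eq_zero {u' : L2G Em Ep} (h : HasDerivG (0 : L2G Em Ep) u') : u' = 0 := by
  ext e : 2
  have h1 : HasWeakDeriv (halfLine e) (fun _ => 0) (u' e) :=
    HasWeakDeriv.congr (h e) (Lp.coeFn_zero _ _ _).symm Filter.EventuallyEq.rfl
  have h2 := (isOpen_halfLine e).ae_eq_zero_of_integral_contDiff_smul_eq_zero
    (μ := volume.restrict (halfLine e)) ((locInt (u' e)).locallyIntegrableOn _) (by
      intro φ h1' h2' h3'
      have := h1 φ h1' h2' h3'
      simpa using this.symm)
  have h3 : (u' e : ℝ → ℂ) =ᵐ[volume.restrict (halfLine e)] 0 := by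
    filter_upwards [h2, ae_restrict_mem (isOpen_halfLine e).measurableSet] with x hx hx'
    exact hx hx'
  exact Lp.ext (h3.trans (Lp.coeFn_zero _ _ _).symm)

lemma hasBoundaryValues_zero : HasBoundaryValues (0 : L2G Em Ep) 0 := fun _ =>
  ⟨fun _ => 0, continuousOn_const, Lp.coeFn_zero _ _ _, tendsto_const_nhds⟩

lemma HasBoundaryValues.add {u v : L2G Em Ep} {b c : Em ⊕ Ep → ℂ} (hu : HasBoundaryValues u b)
    (hv : HasBoundaryValues v c) : HasBoundaryValues (u + v) (b + c) := by
  intro e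
  obtain ⟨g, hg1, hg2, hg3⟩ := hu e
  obtain ⟨k, hk1, hk2, hk3⟩ := hv e
  exact ⟨g + k, hg1.add hk1, (Lp.coeFn_add _ _).trans (hg2.add hk2), hg3.add hk3⟩

lemma HasBoundaryValues.smul {u : L2G Em Ep} {b : Em ⊕ Ep → ℂ} (c : ℂ)
    (hu : HasBoundaryValues u b) : HasBoundaryValues (c • u) (c • b) := by
  intro e
  obtain ⟨g, hg1, hg2, hg3⟩ := hu e
  exact ⟨c • g, hg1.const_smul c, (Lp.coeFn_smul _ _).trans (hg2.const_smul c),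
    hg3.const_smul c⟩

/-! ### The Airy operators -/

/-- The graph of the maximal Airy operator `-A₀*`: the domain is the Hilbert space direct sum of
the Sobolev spaces `H³` of the edges, and `u` is mapped to `(α_e u_e''' + β_e u_e')_e`. -/
def maximalGraph (α β : Em ⊕ Ep → ℝ) : Submodule ℂ (L2G Em Ep × L2G Em Ep) where
  carrier := {p | ∃ u₁ u₂ u₃ : L2G Em Ep, HasDerivG p.1 u₁ ∧ HasDerivG u₁ u₂ ∧ HasDerivG u₂ u₃ ∧
    ∀ e, p.2 e = (α e : ℂ) • u₃ e + (β e : ℂ) • u₁ e}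
  zero_mem' := ⟨0, 0, 0, hasDerivG_zero, hasDerivG_zero, hasDerivG_zero, fun e => by simp⟩
  add_mem' := by
    rintro p q ⟨u₁, u₂, u₃, h1, h2, h3, h⟩ ⟨v₁, v₂, v₃, k1, k2, k3, k⟩
    refine ⟨u₁ + v₁, u₂ + v₂, u₃ + v₃, h1.add k1, h2.add k2, h3.add k3, fun e => ?_⟩
    change p.2 e + q.2 e = (α e : ℂ) • (u₃ e + v₃ e) + (β e : ℂ) • (u₁ e + v₁ e)
    rw [h, k]
    module
  smul_mem' := by
    rintro c p ⟨u₁, u₂, u₃, h1, h2, h3, h⟩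
    refine ⟨c • u₁, c • u₂, c • u₃, h1.smul c, h2.smul c, h3.smul c, fun e => ?_⟩
    change c • p.2 e = (α e : ℂ) • (c • u₃ e) + (β e : ℂ) • (c • u₁ e)
    rw [h]
    module

/-- The maximal Airy operator `-A₀*` on `L²(G)`. -/
def maximalAiry (α β : Em ⊕ Ep → ℝ) : L2G Em Ep →ₗ.[ℂ] L2G Em Ep :=
  (maximalGraph α β).toLinearPMap

/-- The graph defining `maximalAiry` is single-valued, so it is the graph of `maximalAiry`. -/
lemma maximalAiry_graph (α β : Em ⊕ Ep → ℝ) : (maximalAiry α β).graph = maximalGraph α β := by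
  refine Submodule.toLinearPMap_graph_eq _ ?_
  rintro ⟨u, v⟩ ⟨u₁, u₂, u₃, h1, h2, h3, h⟩ (rfl : u = 0)
  obtain rfl := h1.eq_zero
  obtain rfl := h2.eq_zero
  obtain rfl := h3.eq_zero
  ext e : 2
  simpa using h e

/-- The boundary conditions of `A_{Y,U}`. Here `b₀`, `b₁`, `b₂` are the boundary values of `u`, `u'`
and `u''`. The conditions say that `(u(0-), u(0+)) ∈ Y`, that
`(-α₋ u''(0-) - β₋/2 u(0-), α₊ u''(0+) + β₊/2 u(0+)) ∈ Y^⊥`, and that `u'(0-) ∈ D(U)` with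
`u'(0+) = U u'(0-)`. (Points have positive mass when `α > 0`, so that the almost everywhere
equalities hold everywhere.) -/
def separatedConditions (α β : Em ⊕ Ep → ℝ) (Y : Submodule ℂ (VertexSpace Em Ep))
    (U : WEll2 (fun e : Em => α (.inl e)) →ₗ.[ℂ] WEll2 (fun e : Ep => α (.inr e))) :
    Submodule ℂ (L2G Em Ep) where
  carrier := {u | ∃ u₁ u₂ : L2G Em Ep, HasDerivG u u₁ ∧ HasDerivG u₁ u₂ ∧
    ∃ b₀ b₁ b₂ : Em ⊕ Ep → ℂ,
      HasBoundaryValues u b₀ ∧ HasBoundaryValues u₁ b₁ ∧ HasBoundaryValues u₂ b₂ ∧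
      (∃ y ∈ Y, (∀ e, y.fst e = b₀ (.inl e)) ∧ ∀ e, y.snd e = b₀ (.inr e)) ∧
      (∃ z ∈ Yᗮ,
        (∀ e, z.fst e = -(α (.inl e) : ℂ) * b₂ (.inl e) - (β (.inl e) : ℂ) / 2 * b₀ (.inl e)) ∧
        ∀ e, z.snd e = (α (.inr e) : ℂ) * b₂ (.inr e) + (β (.inr e) : ℂ) / 2 * b₀ (.inr e)) ∧
      ∃ x : U.domain,
        ((x : WEll2 fun e : Em => α (.inl e)) : Em → ℂ) =ᵐ[weightMeasure fun e => α (.inl e)]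
          (fun e => b₁ (.inl e)) ∧
        (U x : Ep → ℂ) =ᵐ[weightMeasure fun e => α (.inr e)] fun e => b₁ (.inr e)}
  zero_mem' :=
    ⟨0, 0, hasDerivG_zero, hasDerivG_zero, 0, 0, 0, hasBoundaryValues_zero,
      hasBoundaryValues_zero, hasBoundaryValues_zero, ⟨0, Y.zero_mem, by simp, by simp⟩,
      ⟨0, Submodule.zero_mem _, by simp, by simp⟩, 0,
      Lp.coeFn_zero _ _ _, by rw [U.map_zero]; exact Lp.coeFn_zero _ _ _⟩
  add_mem' := by
    rintro u v ⟨u₁, u₂, h1, h2, b₀, b₁, b₂, t0, t1, t2, ⟨y, hy, ya, yb⟩, ⟨z, hz, za, zb⟩, x, xa, xb⟩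
      ⟨v₁, v₂, k1, k2, c₀, c₁, c₂, s0, s1, s2, ⟨y', hy', ya', yb'⟩, ⟨z', hz', za', zb'⟩, x', xa', xb'⟩
    refine ⟨u₁ + v₁, u₂ + v₂, h1.add k1, h2.add k2, b₀ + c₀, b₁ + c₁, b₂ + c₂, t0.add s0,
      t1.add s1, t2.add s2, ⟨y + y', Y.add_mem hy hy', fun e => ?_, fun e => ?_⟩,
      ⟨z + z', Submodule.add_mem _ hz hz', fun e => ?_, fun e => ?_⟩, x + x', ?_, ?_⟩
    · simp [ya, ya']
    · simp [yb, yb']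
    · simp [za, za']; ring
    · simp [zb, zb']; ring
    · exact (Lp.coeFn_add _ _).trans (xa.add xa')
    · rw [U.map_add]
      exact (Lp.coeFn_add _ _).trans (xb.add xb')
  smul_mem' := by
    rintro c u ⟨u₁, u₂, h1, h2, b₀, b₁, b₂, t0, t1, t2, ⟨y, hy, ya, yb⟩, ⟨z, hz, za, zb⟩, x, xa, xb⟩
    refine ⟨c • u₁, c • u₂, h1.smul c, h2.smul c, c • b₀, c • b₁, c • b₂, t0.smul c,
      t1.smul c, t2.smul c, ⟨c • y, Y.smul_mem c hy, fun e => ?_, fun e => ?_⟩,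
      ⟨c • z, Submodule.smul_mem _ c hz, fun e => ?_, fun e => ?_⟩, c • x, ?_, ?_⟩
    · simp [ya]
    · simp [yb]
    · simp [za]; ring
    · simp [zb]; ring
    · exact (Lp.coeFn_smul _ _).trans (xa.const_smul c)
    · rw [U.map_smul]
      exact (Lp.coeFn_smul _ _).trans (xb.const_smul c)

/-- The Airy operator `A_{Y,U}` with separated boundary conditions, the restriction of `-A₀*`
to those `u` that satisfy the boundary conditions. -/
def separatedAiry (α β : Em ⊕ Ep → ℝ) (Y : Submodule ℂ (VertexSpace Em Ep))
    (U : WEll2 (fun e : Em => α (.inl e)) →ₗ.[ℂ] WEll2 (fun e : Ep => α (.inr e))) :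
    L2G Em Ep →ₗ.[ℂ] L2G Em Ep :=
  (maximalAiry α β).domRestrict (separatedConditions α β Y U)

end StarGraph

end

/-! Everything rests on one identity. Two integrations by parts on each half-line turn `Re ⟪u, A u⟫`
into boundary terms at the vertex. Those containing `u` and `u''` add up to the inner product of an
element of `Y` with an element of `Yᗮ` and disappear; the summand `β/2` in the boundary condition is
there to absorb the boundary term of `β u'`. What remains is `Re ⟪u, A u⟫ = (‖U u'(0-)‖² -
‖u'(0-)‖²) / 2` in the weighted norms (`re_inner_separatedAiry`, resting on Green's formula
`HasWeakDeriv.inner_add_inner`). Hence `A` is dissipative as soon as `U` is a contraction.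

Necessity. A generator of a contraction semigroup is closed and dissipative. Exponential sums with
value 0, slope 1 and second derivative 0 at the vertex give a bounded linear map under which the
graph of `U` is the preimage of the graph of `A` (`exists_lift`). Closedness is pulled back along
this map, and the identity turns dissipativity into `‖U x‖ ≤ ‖x‖`.

Sufficiency. By Lumer–Phillips (`generatesContractionSemigroup_of_dissipative`, proved with Yosida
approximations) it is enough that `l - A` is onto for all large real `l`. For such `l` the cubic `α
k³ + β k = l` has a positive root `p` and a pair `-p/2 ± iθ`, with bounds uniform in the edge
(`exists_characteristicRoots`). Factoring the cubic gives a particular solution on each edge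
(`exists_edge_resolvent`). The decaying homogeneous solutions are parametrised by the boundary value
and, on outgoing edges only, by the slope (`exists_edge_kernel`). A closed densely defined
contraction is everywhere defined, so the boundary conditions become a bounded linear system for
these parameters. That system is coercive precisely because `U` is a contraction
(`boundary_coercive`), and Lax–Milgram solves it (`exists_boundary_solution`).

The adjoint of a densely defined contraction is a contraction by duality (`IsContraction.adjoint`),
which settles the statements about `U†`. -/

noncomputable section

namespace StarGraph

/-! ### Generators of contraction semigroups on a Hilbert space -/

section Generators

variable {X : Type*} [NormedAddCommGroup X] [InnerProductSpace ℂ X]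

/-- A difference quotient of a contraction at a point has nonpositive real inner product with that
point. -/
lemma re_inner_diffQuot_nonpos {S : X →L[ℂ] X} (hS : ‖S‖ ≤ 1) (r : ℝ) (hr : 0 ≤ r) (x : X) :
    (⟪x, (r : ℂ) • (S x - x)⟫_ℂ).re ≤ 0 := by
  rw [inner_smul_right, Complex.re_ofReal_mul, inner_sub_right, Complex.sub_re]
  have h1 : (⟪x, S x⟫_ℂ).re ≤ ‖x‖ * ‖x‖ := by
    refine (Complex.re_le_norm _).trans ((norm_inner_le_norm _ _).trans ?_)
    gcongr
    simpa using S.le_of_opNorm_le hS x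
  have h2 : (⟪x, x⟫_ℂ).re = ‖x‖ * ‖x‖ := inner_self_eq_norm_mul_norm (𝕜 := ℂ) x
  exact mul_nonpos_of_nonneg_of_nonpos hr (by linarith)

lemma re_inner_nonpos_of_tendsto {T : ℝ≥0 → X →L[ℂ] X} (hT : ∀ t, ‖T t‖ ≤ 1) {x y : X}
    (h : Tendsto (fun t : ℝ≥0 => (((t : ℝ)⁻¹ : ℝ) : ℂ) • (T t x - x)) (𝓝[>] 0) (𝓝 y)) :
    (⟪x, y⟫_ℂ).re ≤ 0 := by
  have h1 : Tendsto (fun t : ℝ≥0 => (⟪x, (((t : ℝ)⁻¹ : ℝ) : ℂ) • (T t x - x)⟫_ℂ).re) (𝓝[>] 0)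
      (𝓝 (⟪x, y⟫_ℂ).re) :=
    (Complex.continuous_re.tendsto _).comp (tendsto_const_nhds.inner h)
  exact le_of_tendsto h1 (Eventually.of_forall fun t =>
    re_inner_diffQuot_nonpos (hT t) _ (by positivity) x)

/-- The semigroup law gives `T(t) x - T(s) x = T(s) (T(t - s) x - x)` for `t > s`. A right
derivative is all that the mean value inequality needs. -/
lemma hasDerivWithinAt_orbit {T : ℝ≥0 → X →L[ℂ] X} (hT : IsC0Semigroup T) {x y : X}
    (h : Tendsto (fun t : ℝ≥0 => (((t : ℝ)⁻¹ : ℝ) : ℂ) • (T t x - x)) (𝓝[>] 0) (𝓝 y))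
    {s : ℝ} (hs : 0 ≤ s) :
    HasDerivWithinAt (fun t : ℝ => T t.toNNReal x) (T s.toNNReal y) (Set.Ici s) s := by
  rw [← hasDerivWithinAt_Ioi_iff_Ici, hasDerivWithinAt_iff_tendsto_slope' (by simp)]
  have h1 : Tendsto (fun t : ℝ => (t - s).toNNReal) (𝓝[>] s) (𝓝[>] 0) := by
    refine tendsto_nhdsWithin_iff.2 ⟨?_, ?_⟩
    · have : Tendsto (fun t : ℝ => (t - s).toNNReal) (𝓝 s) (𝓝 ((s - s).toNNReal)) :=
        (continuous_real_toNNReal.comp (continuous_id.sub continuous_const)).tendsto s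
      simpa using this.mono_left nhdsWithin_le_nhds
    · filter_upwards [self_mem_nhdsWithin] with t ht
      simpa using ht
  have h2 := ((T s.toNNReal).continuous.tendsto y).comp (h.comp h1)
  refine h2.congr' ?_
  filter_upwards [self_mem_nhdsWithin] with t ht
  have ht' : s < t := ht
  have e : t.toNNReal = s.toNNReal + (t - s).toNNReal := by
    rw [← Real.toNNReal_add hs (by linarith)]; congr 1; ring
  simp only [Function.comp_apply, slope, vsub_eq_sub, Complex.coe_smul]
  rw [e, hT.map_add, Real.coe_toNNReal _ (by linarith : 0 ≤ t - s)]
  simp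

/-- If the orbit of `y` stays within `C` of `z`, then the orbit of a primitive point moves with
velocity within `C` of `z`. -/
lemma norm_orbit_sub_le {T : ℝ≥0 → X →L[ℂ] X} (hT : IsC0Semigroup T) {x y z : X}
    (h : Tendsto (fun t : ℝ≥0 => (((t : ℝ)⁻¹ : ℝ) : ℂ) • (T t x - x)) (𝓝[>] 0) (𝓝 y))
    {t : ℝ≥0} {C : ℝ} (hC : ∀ s < t, ‖T s y - z‖ ≤ C) :
    ‖T t x - x - ((t : ℝ) : ℂ) • z‖ ≤ C * t := by
  have key := norm_image_sub_le_of_norm_deriv_right_le_segment (a := 0) (b := (t : ℝ)) (C := C)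
    (f := fun s : ℝ => T s.toNNReal x - (s : ℂ) • z)
    (f' := fun s : ℝ => T s.toNNReal y - z) ?_ ?_ ?_ t ⟨t.2, le_rfl⟩
  · have e : T t x - x - ((t : ℝ) : ℂ) • z
        = T (t : ℝ).toNNReal x - ((t : ℝ) : ℂ) • z
          - (T (0 : ℝ).toNNReal x - ((0 : ℝ) : ℂ) • z) := by
      simp [hT.map_zero]; abel
    rw [e]
    simpa using key
  · refine Continuous.continuousOn ?_
    exact ((hT.continuous_orbit x).comp continuous_real_toNNReal).sub
      (Complex.continuous_ofReal.smul continuous_const)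
  · intro s hs
    refine (hasDerivWithinAt_orbit hT h hs.1).sub ?_
    have := ((Complex.ofRealCLM.hasDerivAt (x := s)).smul_const z).hasDerivWithinAt (s := Set.Ici s)
    simpa using this
  · intro s hs
    refine hC _ ?_
    rw [← NNReal.coe_lt_coe, Real.coe_toNNReal _ hs.1]
    exact hs.2

/-- A criterion for convergence of the difference quotients of a semigroup. -/
lemma tendsto_diffQuot {T : ℝ≥0 → X →L[ℂ] X} (hT : IsC0Semigroup T) {x y : X}
    (h : ∀ (t : ℝ≥0) (C : ℝ), t ≤ 1 → (∀ s < t, ‖T s y - y‖ ≤ C) →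
      ‖T t x - x - ((t : ℝ) : ℂ) • y‖ ≤ C * t) :
    Tendsto (fun t : ℝ≥0 => (((t : ℝ)⁻¹ : ℝ) : ℂ) • (T t x - x)) (𝓝[>] 0) (𝓝 y) := by
  rw [Metric.tendsto_nhds]
  intro ε hε
  have h0 : Tendsto (fun s => T s y) (𝓝 0) (𝓝 y) := by
    simpa [hT.map_zero] using (hT.continuous_orbit y).tendsto 0
  obtain ⟨δ, hδ, hb⟩ := Metric.tendsto_nhds_nhds.1 h0 (ε / 2) (by positivity)
  have hmem : Set.Ioo (0 : ℝ≥0) (min ⟨δ, hδ.le⟩ 1) ∈ 𝓝[>] (0 : ℝ≥0) :=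
    Ioo_mem_nhdsGT (lt_min hδ one_pos)
  filter_upwards [hmem] with t ht
  have htpos : (0 : ℝ) < t := ht.1
  have hb' := h t (ε / 2) ((ht.2.le.trans (min_le_right _ _))) (fun s hs => by
    rw [← dist_eq_norm]
    refine (hb ?_).le
    have : s < (⟨δ, hδ.le⟩ : ℝ≥0) := hs.trans (ht.2.trans_le (min_le_left _ _))
    have h2 : (s : ℝ) < δ := NNReal.coe_lt_coe.2 this
    simpa [NNReal.dist_eq] using h2)
  have e : (((t : ℝ)⁻¹ : ℝ) : ℂ) • (T t x - x) - y
      = (((t : ℝ)⁻¹ : ℝ) : ℂ) • (T t x - x - ((t : ℝ) : ℂ) • y) := by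
    rw [smul_sub _ _ (((t : ℝ) : ℂ) • y), smul_smul, ← Complex.ofReal_mul,
      inv_mul_cancel₀ htpos.ne', Complex.ofReal_one, one_smul]
  rw [dist_eq_norm, e, norm_smul, Complex.norm_real, Real.norm_of_nonneg (by positivity)]
  calc (t : ℝ)⁻¹ * ‖T t x - x - ((t : ℝ) : ℂ) • y‖ ≤ (t : ℝ)⁻¹ * (ε / 2 * t) := by gcongr
    _ = ε / 2 := by field_simp
    _ < ε := by linarith

/-- The generator of a contraction semigroup is dissipative. -/
lemma GeneratesContractionSemigroup.dissipative {A : X →ₗ.[ℂ] X}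
    (hA : GeneratesContractionSemigroup A) {p : X × X} (hp : p ∈ A.graph) :
    (⟪p.1, p.2⟫_ℂ).re ≤ 0 := by
  obtain ⟨T, -, hb, hg⟩ := hA
  exact re_inner_nonpos_of_tendsto hb ((hg p.1 p.2).1 hp)

/-- The generator of a contraction semigroup is closed. -/
lemma GeneratesContractionSemigroup.isClosed {A : X →ₗ.[ℂ] X}
    (hA : GeneratesContractionSemigroup A) : A.IsClosed := by
  obtain ⟨T, hT, hb, hg⟩ := hA
  refine isClosed_of_closure_subset fun p hp => ?_
  obtain ⟨q, hq, hlim⟩ := mem_closure_iff_seq_limit.1 hp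
  have l1 : Tendsto (fun n => (q n).1) atTop (𝓝 p.1) := (continuous_fst.tendsto p).comp hlim
  have l2 : Tendsto (fun n => (q n).2) atTop (𝓝 p.2) := (continuous_snd.tendsto p).comp hlim
  -- The mean value estimate is a closed condition on the pair: it holds along the approximating
  -- sequence up to an error `‖(q n).2 - p.2‖ * t` and survives the limit.
  refine (hg p.1 p.2).2 (tendsto_diffQuot hT fun t C _ hC => ?_)
  have step : ∀ n, ‖T t (q n).1 - (q n).1 - ((t : ℝ) : ℂ) • p.2‖ ≤ (‖(q n).2 - p.2‖ + C) * t := by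
    intro n
    refine norm_orbit_sub_le hT ((hg _ _).1 (hq n)) fun s hs => ?_
    have e : T s (q n).2 - p.2 = T s ((q n).2 - p.2) + (T s p.2 - p.2) := by
      rw [map_sub]; abel
    rw [e]
    refine (norm_add_le _ _).trans (add_le_add ?_ (hC s hs))
    simpa using (T s).le_of_opNorm_le (hb s) ((q n).2 - p.2)
  have lim1 : Tendsto (fun n => ‖T t (q n).1 - (q n).1 - ((t : ℝ) : ℂ) • p.2‖) atTop
      (𝓝 ‖T t p.1 - p.1 - ((t : ℝ) : ℂ) • p.2‖) :=
    (((((T t).continuous.tendsto _).comp l1).sub l1).sub tendsto_const_nhds).norm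
  have lim2 : Tendsto (fun n => (‖(q n).2 - p.2‖ + C) * t) atTop (𝓝 ((‖p.2 - p.2‖ + C) * t)) :=
    ((l2.sub tendsto_const_nhds).norm.add tendsto_const_nhds).mul tendsto_const_nhds
  simpa using le_of_tendsto_of_tendsto' lim1 lim2 step

end Generators


/-! ### The theorem of Lumer and Phillips on a Hilbert space -/

section BoundedDissipative

variable {X : Type*} [NormedAddCommGroup X] [InnerProductSpace ℂ X] [CompleteSpace X]

lemma hasDerivAt_exp_smul_apply (B : X →L[ℂ] X) (v : X) (t : ℝ) :
    HasDerivAt (fun t : ℝ => NormedSpace.exp (t • B) v) (B (NormedSpace.exp (t • B) v)) t :=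
  ((ContinuousLinearMap.apply ℂ X v).restrictScalars ℝ).hasFDerivAt.comp_hasDerivAt t
    (hasDerivAt_exp_smul_const' (𝕂 := ℝ) B t)

lemma hasDerivAt_exp_smul_apply' (B : X →L[ℂ] X) (v : X) (t : ℝ) :
    HasDerivAt (fun t : ℝ => NormedSpace.exp (t • B) v) (NormedSpace.exp (t • B) (B v)) t :=
  ((ContinuousLinearMap.apply ℂ X v).restrictScalars ℝ).hasFDerivAt.comp_hasDerivAt t
    (hasDerivAt_exp_smul_const (𝕂 := ℝ) B t)

/-- A bounded dissipative operator generates a contraction semigroup. -/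
lemma norm_exp_smul_apply_le {B : X →L[ℂ] X} (hB : ∀ v, (⟪v, B v⟫_ℂ).re ≤ 0) {t : ℝ} (ht : 0 ≤ t)
    (v : X) : ‖NormedSpace.exp (t • B) v‖ ≤ ‖v‖ := by
  have hd : ∀ s : ℝ, HasDerivAt (fun s : ℝ => ‖NormedSpace.exp (s • B) v‖ ^ 2)
      (2 * (⟪NormedSpace.exp (s • B) v, B (NormedSpace.exp (s • B) v)⟫_ℂ).re) s := by
    intro s
    have h1 := hasDerivAt_exp_smul_apply B v s
    have h2 := (h1.inner ℂ h1)
    have h3 := Complex.reCLM.hasFDerivAt.comp_hasDerivAt s h2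
    convert! h3 using 1
    · ext s
      exact (inner_self_eq_norm_sq (𝕜 := ℂ) _).symm
    · simp only [Complex.reCLM_apply, Complex.add_re]
      rw [← inner_conj_symm (B (NormedSpace.exp (s • B) v))]
      simp only [Complex.conj_re]
      ring
  have hanti : Antitone fun s : ℝ => ‖NormedSpace.exp (s • B) v‖ ^ 2 :=
    antitone_of_deriv_nonpos (fun s => (hd s).differentiableAt) fun s => by
      rw [(hd s).deriv]
      linarith [hB (NormedSpace.exp (s • B) v)]
  have := hanti ht
  simp only [zero_smul, NormedSpace.exp_zero, one_apply_eq_self] at this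
  exact (sq_le_sq₀ (norm_nonneg _) (norm_nonneg _)).1 this

/-- Mean value inequality for `exp(sB) v - s z`, the counterpart of `norm_orbit_sub_le` for the
approximating semigroups. The vector `z` need not be `B v`, because it will be the limit of such
vectors. -/
lemma norm_exp_smul_sub_id_le {B : X →L[ℂ] X} {t : ℝ} (ht : 0 ≤ t)
    (v z : X) {C : ℝ} (hC : ∀ s, 0 ≤ s → s < t → ‖NormedSpace.exp (s • B) (B v) - z‖ ≤ C) :
    ‖NormedSpace.exp (t • B) v - v - (t : ℂ) • z‖ ≤ C * t := by
  have key := norm_image_sub_le_of_norm_deriv_right_le_segment (a := 0) (b := t) (C := C)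
    (f := fun s : ℝ => NormedSpace.exp (s • B) v - (s : ℂ) • z)
    (f' := fun s : ℝ => NormedSpace.exp (s • B) (B v) - z) ?_ ?_ ?_ t ⟨ht, le_rfl⟩
  · have e : NormedSpace.exp (t • B) v - v - (t : ℂ) • z
        = NormedSpace.exp (t • B) v - (t : ℂ) • z
          - (NormedSpace.exp ((0 : ℝ) • B) v - ((0 : ℝ) : ℂ) • z) := by
      simp; abel
    rw [e]
    simpa using key
  · refine Continuous.continuousOn ?_
    exact (continuous_iff_continuousAt.2 fun s =>
      (hasDerivAt_exp_smul_apply B v s).continuousAt).sub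
        (Complex.continuous_ofReal.smul continuous_const)
  · intro s hs
    have h1 : HasDerivAt (fun t : ℝ => NormedSpace.exp (t • B) v)
        (NormedSpace.exp (s • B) (B v)) s :=
      hasDerivAt_exp_smul_apply' B v s
    have h2 := (Complex.ofRealCLM.hasDerivAt (x := s)).smul_const z
    simp only [Complex.ofRealCLM_apply, Complex.ofReal_one, one_smul] at h2
    exact (h1.sub h2).hasDerivWithinAt
  · intro s hs
    exact hC s hs.1 hs.2

/-- The path `s ↦ exp(tC) exp(s(B - C)) v = exp(sB) exp((t - s)C) v` joins the two vectors. By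
commutativity its velocity is a product of contractions applied to `(B - C) v`. -/
lemma norm_exp_smul_sub_exp_smul_le {B C : X →L[ℂ] X} (hBC : Commute B C)
    (hB : ∀ v, (⟪v, B v⟫_ℂ).re ≤ 0) (hC : ∀ v, (⟪v, C v⟫_ℂ).re ≤ 0) {t : ℝ} (ht : 0 ≤ t) (v : X) :
    ‖NormedSpace.exp (t • B) v - NormedSpace.exp (t • C) v‖ ≤ ‖B v - C v‖ * t := by
  have hcomm : ∀ a b : ℝ, Commute (a • B) (b • C) := fun a b =>
    (hBC.smul_left a).smul_right b
  let _ : NormedAlgebra ℚ (X →L[ℂ] X) := NormedAlgebra.restrictScalars ℚ ℂ _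
  have hexp : ∀ s : ℝ, NormedSpace.exp (t • C) * NormedSpace.exp (s • (B - C))
      = NormedSpace.exp (s • B) * NormedSpace.exp ((t - s) • C) := by
    intro s
    rw [← NormedSpace.exp_add_of_commute (hcomm _ _), ← NormedSpace.exp_add_of_commute]
    · congr 1; module
    · exact ((hBC.symm.sub_right (Commute.refl C)).smul_left t).smul_right s
  have key := norm_image_sub_le_of_norm_deriv_right_le_segment (a := 0) (b := t)
    (C := ‖B v - C v‖)
    (f := fun s : ℝ => NormedSpace.exp (t • C) (NormedSpace.exp (s • (B - C)) v))
    (f' := fun s : ℝ => NormedSpace.exp (t • C) (NormedSpace.exp (s • (B - C)) ((B - C) v)))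
    ?_ ?_ ?_ t ⟨ht, le_rfl⟩
  · have e := congrArg (fun L : X →L[ℂ] X => L v) (hexp t)
    simp only [mul_apply_eq_comp, sub_self, zero_smul, NormedSpace.exp_zero,
      one_apply_eq_self] at e
    rw [e] at key
    simpa using key
  · exact (continuous_iff_continuousAt.2 fun s =>
      ((NormedSpace.exp (t • C)).continuous.continuousAt.comp
        (hasDerivAt_exp_smul_apply (B - C) v s).continuousAt)).continuousOn
  · intro s hs
    have h1 : HasDerivAt (fun t : ℝ => NormedSpace.exp (t • (B - C)) v)
        (NormedSpace.exp (s • (B - C)) ((B - C) v)) s :=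
      hasDerivAt_exp_smul_apply' (B - C) v s
    exact (((NormedSpace.exp (t • C)).restrictScalars ℝ).hasFDerivAt.comp_hasDerivAt s
      h1).hasDerivWithinAt
  · intro s hs
    have e := congrArg (fun L : X →L[ℂ] X => L ((B - C) v)) (hexp s)
    simp only [mul_apply_eq_comp] at e
    rw [e]
    refine (norm_exp_smul_apply_le hB hs.1 _).trans ?_
    refine (norm_exp_smul_apply_le hC (by linarith [hs.2]) _).trans ?_
    simp

end BoundedDissipative

/-! ### Resolvents of dissipative operators and Yosida approximation -/

section LumerPhillips

variable {X : Type*} [NormedAddCommGroup X] [InnerProductSpace ℂ X]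

/-- Take the inner product of `r x - y` with `x` and apply Cauchy–Schwarz. -/
lemma le_norm_smul_sub_of_dissipative {x y : X} (h : (⟪x, y⟫_ℂ).re ≤ 0) {r : ℝ} :
    r * ‖x‖ ≤ ‖(r : ℂ) • x - y‖ := by
  rcases eq_or_ne x 0 with rfl | hx
  · simp
  have hx' : 0 < ‖x‖ := norm_pos_iff.2 hx
  have h1 : (⟪x, (r : ℂ) • x - y⟫_ℂ).re = r * (‖x‖ * ‖x‖) - (⟪x, y⟫_ℂ).re := by
    rw [inner_sub_right, inner_smul_right, Complex.sub_re, Complex.re_ofReal_mul]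
    congr 2
    exact inner_self_eq_norm_mul_norm (𝕜 := ℂ) x
  have h2 : (⟪x, (r : ℂ) • x - y⟫_ℂ).re ≤ ‖x‖ * ‖(r : ℂ) • x - y‖ :=
    (Complex.re_le_norm _).trans (norm_inner_le_norm _ _)
  nlinarith

/-- Dissipativity bounds `r - A` from below, so a solution of `r x - A x = f` is unique. Uniqueness
makes any choice of solutions linear. -/
lemma exists_resolvent {A : X →ₗ.[ℂ] X} (hd : ∀ p ∈ A.graph, (⟪p.1, p.2⟫_ℂ).re ≤ 0) {r : ℝ}
    (hr : 0 < r) (hs : ∀ f, ∃ p ∈ A.graph, (r : ℂ) • p.1 - p.2 = f) :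
    ∃ R : X →L[ℂ] X, (∀ f, (R f, (r : ℂ) • R f - f) ∈ A.graph) ∧
      (∀ p ∈ A.graph, R ((r : ℂ) • p.1 - p.2) = p.1) ∧ ∀ f, r * ‖R f‖ ≤ ‖f‖ := by
  choose p hp hpf using hs
  have hinj : ∀ q ∈ A.graph, ∀ q' ∈ A.graph, (r : ℂ) • q.1 - q.2 = (r : ℂ) • q'.1 - q'.2 →
      q.1 = q'.1 := by
    intro q hq q' hq' h
    have h1 := le_norm_smul_sub_of_dissipative (hd _ (A.graph.sub_mem hq hq')) (r := r)
    have h2 : (r : ℂ) • (q - q').1 - (q - q').2 = 0 := by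
      rw [Prod.fst_sub, Prod.snd_sub, smul_sub, sub_sub_sub_comm, h, sub_self]
    rw [h2, norm_zero] at h1
    have h3 : ‖(q - q').1‖ = 0 := by nlinarith [norm_nonneg (q - q').1]
    exact sub_eq_zero.1 (norm_eq_zero.1 h3)
  let R : X →ₗ[ℂ] X :=
    { toFun := fun f => (p f).1
      map_add' := fun f g => by
        refine hinj _ (hp _) (p f + p g) (A.graph.add_mem (hp f) (hp g)) ?_
        rw [hpf, Prod.fst_add, Prod.snd_add, smul_add, add_sub_add_comm, hpf, hpf]
      map_smul' := fun c f => by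
        refine hinj _ (hp _) (c • p f) (A.graph.smul_mem c (hp f)) ?_
        rw [hpf, Prod.smul_fst, Prod.smul_snd, smul_comm, ← smul_sub, hpf] }
  have hR : ∀ f, r * ‖R f‖ ≤ ‖f‖ := fun f => by
    have := le_norm_smul_sub_of_dissipative (hd _ (hp f)) (r := r)
    rwa [hpf] at this
  refine ⟨R.mkContinuous r⁻¹ fun f => ?_, fun f => ?_, fun q hq => ?_, hR⟩
  · rw [← div_eq_inv_mul, le_div_iff₀' hr]
    exact hR f
  · have e : (p f).2 = (r : ℂ) • (p f).1 - f :=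
      eq_sub_of_add_eq' (sub_eq_iff_eq_add.1 (hpf f)).symm
    change ((p f).1, (r : ℂ) • (p f).1 - f) ∈ A.graph
    rw [← e]
    exact hp f
  · exact hinj _ (hp _) _ hq (hpf _)

variable [CompleteSpace X]

/-- If `f = r x - A x` is orthogonal to the domain, then in particular to `x`, so `⟪x, A x⟫ = r
‖x‖²`. Dissipativity then forces `x = 0`, hence `f = 0`. -/
lemma dense_domain_of_dissipative {A : X →ₗ.[ℂ] X} (hd : ∀ p ∈ A.graph, (⟪p.1, p.2⟫_ℂ).re ≤ 0)
    {r : ℝ} (hr : 0 < r) (hs : ∀ f, ∃ p ∈ A.graph, (r : ℂ) • p.1 - p.2 = f) :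
    Dense (A.domain : Set X) := by
  rw [Submodule.dense_iff_topologicalClosure_eq_top, Submodule.topologicalClosure_eq_top_iff,
    Submodule.eq_bot_iff]
  intro f hf
  obtain ⟨p, hp, hpf⟩ := hs f
  have h1 : ⟪p.1, f⟫_ℂ = 0 := hf _ (LinearPMap.mem_domain_iff.2 ⟨p.2, hp⟩)
  have h2 : r * (‖p.1‖ * ‖p.1‖) ≤ 0 := by
    rw [← hpf, inner_sub_right, inner_smul_right, sub_eq_zero] at h1
    have h3 := hd p hp
    rw [← h1, Complex.re_ofReal_mul] at h3
    rwa [← inner_self_eq_norm_mul_norm (𝕜 := ℂ)]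
  have h4 : p.1 = 0 := by
    rw [← norm_eq_zero]
    have : ‖p.1‖ * ‖p.1‖ ≤ 0 := nonpos_of_mul_nonpos_right h2 hr
    nlinarith [norm_nonneg p.1]
  have h5 : p.2 = 0 := LinearPMap.graph_fst_eq_zero_snd _ hp h4
  rw [← hpf, h4, h5]; simp

/-- **Lumer–Phillips.** A dissipative operator `A` on a Hilbert space such that `n - A` is onto for
all large `n` generates a contraction semigroup. -/
theorem generatesContractionSemigroup_of_dissipative {A : X →ₗ.[ℂ] X}
    (hd : ∀ p ∈ A.graph, (⟪p.1, p.2⟫_ℂ).re ≤ 0) {N : ℝ}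
    (hs : ∀ r : ℝ, N ≤ r → ∀ f, ∃ p ∈ A.graph, (r : ℂ) • p.1 - p.2 = f) :
    GeneratesContractionSemigroup A := by
  -- The shift makes every `r n` both positive and at least `N`.
  let r : ℕ → ℝ := fun n => n + (|N| + 1)
  have hrpos : ∀ n, 0 < r n := fun n => by positivity
  have hrN : ∀ n, N ≤ r n := fun n => by
    have := le_abs_self N
    have : (0 : ℝ) ≤ n := by positivity
    simp only [r]; linarith
  have hrlim : Tendsto r atTop atTop :=
    tendsto_atTop_add_const_right _ _ tendsto_natCast_atTop_atTop
  have hdense := dense_domain_of_dissipative hd (hrpos 0) (hs _ (hrN 0))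
  choose R hRg hRl hRn using fun n => exists_resolvent hd (hrpos n) (hs _ (hrN n))
  -- Yosida approximation: `A R = r R - 1`, so this is `r A R`, a bounded operator.
  let B : ℕ → X →L[ℂ] X := fun n => ((r n : ℂ) ^ 2) • R n - (r n : ℂ) • ContinuousLinearMap.id ℂ X
  have hBapp : ∀ n v, B n v = ((r n : ℂ) ^ 2) • R n v - (r n : ℂ) • v := fun n v => rfl
  have hRcomm : ∀ n m, Commute (R n) (R m) := by
    -- The resolvent identity. Comparing it with its mirror image and dividing by `r n - r m` shows
    -- that the resolvents commute.
    have key : ∀ n m f, R n f + ((r n : ℂ) - r m) • R n (R m f) = R m f := by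
      intro n m f
      have := hRl n _ (hRg m f)
      simp only at this
      rw [← map_smul, ← map_add, ← this]
      congr 1
      rw [this]; module
    intro n m
    ext f
    change R n (R m f) = R m (R n f)
    by_cases h : n = m
    · rw [h]
    have hne : (r n : ℂ) - r m ≠ 0 := by
      rw [sub_ne_zero]
      simpa [r] using h
    have h1 := key n m f
    have h2 := key m n f
    have h3 : ((r n : ℂ) - r m) • (R n (R m f) - R m (R n f)) = 0 := by
      have e : ((r n : ℂ) - r m) • (R n (R m f) - R m (R n f))
          = (R n f + ((r n : ℂ) - r m) • R n (R m f))
            + (R m f + ((r m : ℂ) - r n) • R m (R n f)) - (R m f + R n f) := by module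
      rw [e, h1, h2, sub_self]
    exact sub_eq_zero.1 ((smul_eq_zero.1 h3).resolve_left hne)
  have hBcomm : ∀ n m, Commute (B n) (B m) := by
    intro n m
    refine ((Commute.smul_left ?_ _).sub_left (Commute.smul_left ?_ _))
    · exact ((hRcomm n m).smul_right _).sub_right (((Commute.one_right (R n))).smul_right _)
    · exact Commute.one_left (B m)
  have hBd : ∀ n v, (⟪v, B n v⟫_ℂ).re ≤ 0 := by
    intro n v
    rw [hBapp, inner_sub_right, inner_smul_right, inner_smul_right, Complex.sub_re,
      ← Complex.ofReal_pow, Complex.re_ofReal_mul, Complex.re_ofReal_mul]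
    have h1 : (⟪v, v⟫_ℂ).re = ‖v‖ * ‖v‖ := inner_self_eq_norm_mul_norm (𝕜 := ℂ) v
    have h2 : (⟪v, R n v⟫_ℂ).re ≤ ‖v‖ * ‖R n v‖ :=
      (Complex.re_le_norm _).trans (norm_inner_le_norm _ _)
    have h3 := hRn n v
    have h4 := hrpos n
    have h5 : r n * (⟪v, R n v⟫_ℂ).re ≤ ‖v‖ * ‖v‖ := by
      calc r n * (⟪v, R n v⟫_ℂ).re ≤ r n * (‖v‖ * ‖R n v‖) := by gcongr
        _ = ‖v‖ * (r n * ‖R n v‖) := by ring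
        _ ≤ ‖v‖ * ‖v‖ := by gcongr
    rw [h1]
    nlinarith
  have hBA : ∀ p ∈ A.graph, ∀ n, B n p.1 = (r n : ℂ) • R n p.2 := by
    intro p hp n
    have h := hRl n p hp
    rw [map_sub, map_smul] at h
    have h' : (r n : ℂ) • R n p.1 = p.1 + R n p.2 := by rw [← sub_eq_iff_eq_add]; exact h
    rw [hBapp, pow_two, mul_smul, h']
    module
  -- On the domain `r R z - z = R (A z)`, which is of order `1 / r`. The operators `r R` are
  -- contractions, so density extends the convergence to all `y`.
  have hRid : ∀ y, Tendsto (fun n => (r n : ℂ) • R n y) atTop (𝓝 y) := by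
    intro y
    rw [Metric.tendsto_atTop]
    intro ε hε
    obtain ⟨z, hz, hyz⟩ := Metric.mem_closure_iff.1 (hdense y) (ε / 3) (by positivity)
    obtain ⟨w, hw⟩ := LinearPMap.mem_domain_iff.1 hz
    obtain ⟨M, hM⟩ := (hrlim.eventually_gt_atTop (‖w‖ / (ε / 3))).exists_forall_of_atTop
    refine ⟨M, fun n hn => ?_⟩
    have h1 : ∀ v, ‖(r n : ℂ) • R n v‖ ≤ ‖v‖ := fun v => by
      rw [norm_smul, Complex.norm_real, Real.norm_of_nonneg (hrpos n).le]; exact hRn n v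
    have h2 : (r n : ℂ) • R n z - z = R n w := by
      have h := hRl n _ hw
      simp only [map_sub, map_smul] at h
      exact sub_eq_iff_eq_add.2 (sub_eq_iff_eq_add'.1 h)
    have h3 : ‖R n w‖ < ε / 3 := by
      have := hM n hn
      rw [div_lt_iff₀ (by positivity)] at this
      have h4 := hRn n w
      nlinarith [hrpos n]
    have e : (r n : ℂ) • R n y - y
        = (r n : ℂ) • R n (y - z) + ((r n : ℂ) • R n z - z) + (z - y) := by
      rw [map_sub, smul_sub]; abel
    rw [dist_eq_norm, e, h2]
    rw [dist_eq_norm] at hyz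
    have h5 := h1 (y - z)
    have h6 := norm_sub_rev z y
    calc _ ≤ ‖(r n : ℂ) • R n (y - z)‖ + ‖R n w‖ + ‖z - y‖ := norm_add₃_le
      _ < ε := by linarith
  let E : ℕ → ℝ≥0 → X →L[ℂ] X := fun n t => NormedSpace.exp ((t : ℝ) • B n)
  have hE1 : ∀ n t v, ‖E n t v‖ ≤ ‖v‖ := fun n t v => norm_exp_smul_apply_le (hBd n) t.2 v
  -- uniform convergence on bounded intervals
  have hcau : ∀ (x : X) (M : ℝ≥0) (ε : ℝ), 0 < ε → ∃ K, ∀ n ≥ K, ∀ m ≥ K, ∀ t ≤ M,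
      ‖E n t x - E m t x‖ ≤ ε := by
    intro x M ε hε
    obtain ⟨z, hz, hxz⟩ := Metric.mem_closure_iff.1 (hdense x) (ε / 3) (by positivity)
    obtain ⟨w, hw⟩ := LinearPMap.mem_domain_iff.1 hz
    have hc : CauchySeq fun n => B n z := by
      have : (fun n => B n z) = fun n => (r n : ℂ) • R n w := funext fun n => hBA _ hw n
      rw [this]
      exact (hRid w).cauchySeq
    obtain ⟨K, hK⟩ := Metric.cauchySeq_iff.1 hc (ε / (3 * (M + 1))) (by positivity)
    refine ⟨K, fun n hn m hm t ht => ?_⟩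
    have h1 : ‖E n t z - E m t z‖ ≤ ε / 3 := by
      refine (norm_exp_smul_sub_exp_smul_le (hBcomm n m) (hBd n) (hBd m) t.2 z).trans ?_
      have h2 := (hK n hn m hm).le
      rw [dist_eq_norm] at h2
      have h3 : (t : ℝ) ≤ M + 1 := by
        have : (t : ℝ) ≤ M := ht
        linarith
      calc ‖B n z - B m z‖ * (t : ℝ) ≤ ε / (3 * (M + 1)) * (M + 1) := by gcongr
        _ = ε / 3 := by field_simp
    rw [dist_eq_norm] at hxz
    have e : E n t x - E m t x = E n t (x - z) + (E n t z - E m t z) + E m t (z - x) := by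
      simp only [map_sub]; abel
    rw [e]
    have h4 := hE1 n t (x - z)
    have h5 := hE1 m t (z - x)
    rw [norm_sub_rev] at h5
    exact norm_add₃_le.trans (by linarith)
  have hlim : ∀ x t, ∃ y, Tendsto (fun n => E n t x) atTop (𝓝 y) := fun x t => by
    refine cauchySeq_tendsto_of_complete (Metric.cauchySeq_iff.2 fun ε hε => ?_)
    obtain ⟨K, hK⟩ := hcau x t (ε / 2) (by positivity)
    exact ⟨K, fun n hn m hm => by
      rw [dist_eq_norm]; exact (hK n hn m hm t le_rfl).trans_lt (by linarith)⟩
  choose S hS using hlim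
  have hSunif : ∀ (x : X) (M : ℝ≥0) (ε : ℝ), 0 < ε → ∃ K, ∀ n ≥ K, ∀ t ≤ M,
      ‖E n t x - S x t‖ ≤ ε := by
    intro x M ε hε
    obtain ⟨K, hK⟩ := hcau x M ε hε
    exact ⟨K, fun n hn t ht => le_of_tendsto (tendsto_const_nhds.sub (hS x t)).norm
      (eventually_atTop.2 ⟨K, fun m hm => hK n hn m hm t ht⟩)⟩
  let T : ℝ≥0 → X →L[ℂ] X := fun t => LinearMap.mkContinuous
    { toFun := fun x => S x t
      map_add' := fun x y => tendsto_nhds_unique (hS _ t) (by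
        simpa using (hS x t).add (hS y t))
      map_smul' := fun c x => tendsto_nhds_unique (hS _ t) (by
        simpa using (hS x t).const_smul c) } 1 fun x => by
    simpa using le_of_tendsto (hS x t).norm (Eventually.of_forall fun n => hE1 n t x)
  have hTS : ∀ t x, T t x = S x t := fun t x => rfl
  have hT1 : ∀ t, ‖T t‖ ≤ 1 := fun t => LinearMap.mkContinuous_norm_le _ zero_le_one _
  have hT : IsC0Semigroup T := by
    refine ⟨?_, fun s t => ?_, fun x => ?_⟩
    · ext x
      refine tendsto_nhds_unique (hS x 0) ?_
      simp [E]
    · ext x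
      refine tendsto_nhds_unique (hS x (s + t)) ?_
      have h1 : ∀ n, E n (s + t) x = E n s (E n t x) := fun n => by
        let _ : NormedAlgebra ℚ (X →L[ℂ] X) := NormedAlgebra.restrictScalars ℚ ℂ _
        have : E n (s + t) = E n s * E n t := by
          simp only [E, NNReal.coe_add, add_smul]
          exact NormedSpace.exp_add_of_commute
            (((Commute.refl (B n)).smul_left _).smul_right _)
        rw [this]; rfl
      simp only [h1]
      have h2 : Tendsto (fun n => E n s (E n t x - S x t)) atTop (𝓝 0) := by
        refine squeeze_zero_norm (fun n => hE1 n s _) ?_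
        simpa using ((hS x t).sub_const (S x t)).norm
      have h3 := h2.add (hS (S x t) s)
      change Tendsto _ _ (𝓝 (S (S x t) s))
      simpa using h3
    · refine continuous_iff_continuousAt.2 fun t => ?_
      have h1 : TendstoUniformlyOn (fun n t => E n t x) (fun t => S x t) atTop
          (Set.Iic (t + 1)) := by
        rw [Metric.tendstoUniformlyOn_iff]
        intro ε hε
        obtain ⟨K, hK⟩ := hSunif x (t + 1) (ε / 2) (by positivity)
        filter_upwards [eventually_ge_atTop K] with n hn s hs
        rw [dist_comm, dist_eq_norm]
        exact (hK n hn s hs).trans_lt (by linarith)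
      refine (h1.continuousOn (Frequently.of_forall fun n => ?_)).continuousAt
        (Iic_mem_nhds (lt_add_one t))
      exact ((continuous_iff_continuousAt.2 fun s =>
        (hasDerivAt_exp_smul_apply (B n) x s).continuousAt).comp
          NNReal.continuous_coe).continuousOn
  -- The initial velocities `B n p.1` converge to `p.2`, so the mean value estimate for `exp(t B n)`
  -- passes to the limit `T`. This shows that the generator of `T` extends `A`.
  have hgen : ∀ p ∈ A.graph, Tendsto
      (fun t : ℝ≥0 => (((t : ℝ)⁻¹ : ℝ) : ℂ) • (T t p.1 - p.1)) (𝓝[>] 0) (𝓝 p.2) := by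
    intro p hp
    refine tendsto_diffQuot hT fun t C ht hC => ?_
    have hBp : Tendsto (fun n => B n p.1) atTop (𝓝 p.2) := by
      simp only [hBA p hp]; exact hRid p.2
    have step : ∀ ε > 0, ‖T t p.1 - p.1 - ((t : ℝ) : ℂ) • p.2‖ ≤ (ε + C) * t := by
      intro ε hε
      obtain ⟨K, hK⟩ := hSunif p.2 1 (ε / 2) (by positivity)
      obtain ⟨K', hK'⟩ := Metric.tendsto_atTop.1 hBp (ε / 2) (by positivity)
      refine le_of_tendsto (((hS p.1 t).sub_const p.1).sub_const _).norm
        (eventually_atTop.2 ⟨max K K', fun n hn => ?_⟩)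
      refine norm_exp_smul_sub_id_le t.2 p.1 p.2 fun s hs0 hst => ?_
      obtain ⟨s, rfl⟩ : ∃ s' : ℝ≥0, (s' : ℝ) = s := ⟨⟨s, hs0⟩, rfl⟩
      have e : NormedSpace.exp ((s : ℝ) • B n) (B n p.1) - p.2
          = E n s (B n p.1 - p.2) + (E n s p.2 - S p.2 s) + (T s p.2 - p.2) := by
        rw [map_sub, hTS]; simp only [E]; abel
      rw [e]
      have hst' : s < t := NNReal.coe_lt_coe.1 hst
      have h1 := hE1 n s (B n p.1 - p.2)
      have h2 := hK n ((le_max_left _ _).trans hn) s (hst'.le.trans ht)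
      have h3 := hC _ hst'
      have h4 := (hK' n ((le_max_right _ _).trans hn)).le
      rw [dist_eq_norm] at h4
      exact norm_add₃_le.trans (by linarith)
    have hlim0 : Tendsto (fun ε : ℝ => (ε + C) * t) (𝓝[>] 0) (𝓝 ((0 + C) * t)) :=
      (Continuous.tendsto (by fun_prop) 0).mono_left nhdsWithin_le_nhds
    rw [zero_add] at hlim0
    exact ge_of_tendsto hlim0 (by filter_upwards [self_mem_nhdsWithin] with ε hε using step ε hε)
  refine ⟨T, hT, hT1, fun x y => ⟨hgen (x, y), fun h => ?_⟩⟩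
  -- The extension is not proper: the generator of `T` is dissipative as well, so `r 0` minus the
  -- generator is injective, while `r 0 - A` is already onto.
  obtain ⟨p, hp, hpf⟩ := hs _ (hrN 0) ((r 0 : ℂ) • x - y)
  have h1 := h.sub (hgen p hp)
  have h2 : Tendsto (fun t : ℝ≥0 => (((t : ℝ)⁻¹ : ℝ) : ℂ) • (T t (x - p.1) - (x - p.1))) (𝓝[>] 0)
      (𝓝 (y - p.2)) := by
    refine h1.congr fun t => ?_
    rw [map_sub, ← smul_sub]; congr 1; abel
  have h3 := le_norm_smul_sub_of_dissipative (re_inner_nonpos_of_tendsto hT1 h2) (r := r 0)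
  have h4 : (r 0 : ℂ) • (x - p.1) - (y - p.2) = 0 := by
    rw [smul_sub, sub_sub_sub_comm, hpf, sub_self]
  rw [h4, norm_zero] at h3
  have h5 : ‖x - p.1‖ = 0 := by nlinarith [norm_nonneg (x - p.1), hrpos 0]
  have h6 : x = p.1 := sub_eq_zero.1 (norm_eq_zero.1 h5)
  rw [h6, sub_self, smul_zero, zero_sub, neg_eq_zero, sub_eq_zero] at h4
  rw [h6, h4]
  exact hp

end LumerPhillips

/-! ### Primitives of locally integrable functions -/

section Primitive

/-- `A` is a primitive of the locally integrable function `f`. -/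
structure IsPrimitive (A f : ℝ → ℂ) : Prop where
  locallyIntegrable : LocallyIntegrable f volume
  integral_eq : ∀ s t, ∫ x in s..t, f x = A t - A s

namespace IsPrimitive

variable {A B f g : ℝ → ℂ}

lemma eq_add (h : IsPrimitive A f) (s t : ℝ) : A t = A s + ∫ x in s..t, f x := by
  rw [h.integral_eq]; ring

lemma intervalIntegrable (h : IsPrimitive A f) (s t : ℝ) : IntervalIntegrable f volume s t :=
  (h.locallyIntegrable.integrableOn_isCompact isCompact_uIcc).intervalIntegrable

lemma of_integral (hf : LocallyIntegrable f volume) (a : ℝ) (c : ℂ) :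
    IsPrimitive (fun t => c + ∫ x in a..t, f x) f := by
  have hi : ∀ s t, IntervalIntegrable f volume s t := fun s t =>
    (hf.integrableOn_isCompact isCompact_uIcc).intervalIntegrable
  refine ⟨hf, fun s t => ?_⟩
  rw [← intervalIntegral.integral_add_adjacent_intervals (hi a s) (hi s t)]
  ring

lemma continuous (h : IsPrimitive A f) : Continuous A := by
  have e : A = fun t => A 0 + ∫ x in (0 : ℝ)..t, f x := funext fun t => h.eq_add 0 t
  rw [e]
  exact continuous_const.add (intervalIntegral.continuous_primitive h.intervalIntegrable 0)

lemma ae_hasDerivAt (h : IsPrimitive A f) : ∀ᵐ x, HasDerivAt A (f x) x := by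
  filter_upwards [_root_.LocallyIntegrable.ae_hasDerivAt_integral h.locallyIntegrable] with x hx
  have e : A = fun t => A 0 + ∫ x in (0 : ℝ)..t, f x := funext fun t => h.eq_add 0 t
  rw [e]
  exact (hx 0).const_add _

/-- Absolute continuity of an indefinite integral is applied to the real and imaginary parts
separately, and the two are recombined. -/
lemma absolutelyContinuousOnInterval (h : IsPrimitive A f) (s t : ℝ) :
    AbsolutelyContinuousOnInterval A s t := by
  have h1 := (Complex.reCLM.integrable_comp (h.intervalIntegrable s t).1)
  have h2 := (Complex.reCLM.integrable_comp (h.intervalIntegrable s t).2)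
  have h3 := (Complex.imCLM.integrable_comp (h.intervalIntegrable s t).1)
  have h4 := (Complex.imCLM.integrable_comp (h.intervalIntegrable s t).2)
  have hre : IntervalIntegrable (fun x => (f x).re) volume s t := ⟨h1, h2⟩
  have him : IntervalIntegrable (fun x => (f x).im) volume s t := ⟨h3, h4⟩
  have hc : ∀ c : ℂ, AbsolutelyContinuousOnInterval (fun _ : ℝ => c) s t := fun c =>
    (contDiffOn_const (n := 1)).absolutelyContinuousOnInterval
  have a1 := hre.absolutelyContinuousOnInterval_intervalIntegral (c := s) (by simp)
  have a2 := him.absolutelyContinuousOnInterval_intervalIntegral (c := s) (by simp)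
  have key := ((hc (A s)).add (a1.smul (hc 1))).add (a2.smul (hc Complex.I))
  have e : A = ((fun _ => A s) + (fun x => ∫ (v : ℝ) in s..x, (f v).re) • fun _ => (1 : ℂ)) +
      (fun x => ∫ (v : ℝ) in s..x, (f v).im) • fun _ => Complex.I := by
    funext x
    have hx : IntervalIntegrable f volume s x := h.intervalIntegrable s x
    have e1 : ∫ y in s..x, (f y).re = (∫ y in s..x, f y).re :=
      Complex.reCLM.intervalIntegral_comp_comm hx
    have e2 : ∫ y in s..x, (f y).im = (∫ y in s..x, f y).im :=
      Complex.imCLM.intervalIntegral_comp_comm hx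
    simp only [Pi.add_apply, Pi.smul_apply', e1, e2]
    rw [h.eq_add s x]
    conv_lhs => rw [← Complex.re_add_im (∫ y in s..x, f y)]
    simp [add_assoc]
  rw [e]
  exact key

/-- Product rule for absolutely continuous functions: `A B` minus the integral of the expected
derivative is absolutely continuous with derivative zero almost everywhere, hence constant. -/
lemma mul (hA : IsPrimitive A f) (hB : IsPrimitive B g) :
    IsPrimitive (fun t => A t * B t) fun t => f t * B t + A t * g t := by
  have hloc : LocallyIntegrable (fun t => f t * B t + A t * g t) volume := by
    refine LocallyIntegrable.add ?_ ?_
    · have := hA.locallyIntegrable.continuous_mul hB.continuous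
      simpa only [mul_comm] using this
    · exact hB.locallyIntegrable.continuous_mul hA.continuous
  refine ⟨hloc, fun s t => ?_⟩
  have hP := of_integral hloc s 0
  have h1 := ((hA.absolutelyContinuousOnInterval s t).smul
    (hB.absolutelyContinuousOnInterval s t)).sub (hP.absolutelyContinuousOnInterval s t)
  obtain ⟨C, hC⟩ := h1.const_of_ae_hasDerivAt_zero (by
    filter_upwards [hA.ae_hasDerivAt, hB.ae_hasDerivAt, hP.ae_hasDerivAt] with x h2 h3 h4 _
    have := (h2.mul h3).sub h4
    rw [sub_self] at this
    exact this)
  have h5 := hC s Set.left_mem_uIcc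
  have h6 := hC t Set.right_mem_uIcc
  simp only [Pi.sub_apply, smul_eq_mul, Pi.mul_apply, intervalIntegral.integral_same] at h5 h6
  linear_combination h5 - h6

lemma conj (hA : IsPrimitive A f) :
    IsPrimitive (fun t => (starRingEnd ℂ) (A t)) fun t => (starRingEnd ℂ) (f t) := by
  refine ⟨?_, fun s t => ?_⟩
  · intro x
    obtain ⟨U, hU, hi⟩ := hA.locallyIntegrable x
    exact ⟨U, hU, Complex.conjCLE.toContinuousLinearMap.integrable_comp hi⟩
  · have := Complex.conjCLE.toContinuousLinearMap.intervalIntegral_comp_comm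
      (hA.intervalIntegrable s t)
    simp only [ContinuousLinearEquiv.coe_coe, Complex.conjCLE_apply] at this
    rw [this, hA.integral_eq, map_sub]

lemma of_contDiff {φ : ℝ → ℂ} (hφ : ContDiff ℝ 1 φ) : IsPrimitive φ (deriv φ) := by
  have hc : Continuous (deriv φ) := hφ.continuous_deriv le_rfl
  refine ⟨hc.locallyIntegrable, fun s t => ?_⟩
  exact intervalIntegral.integral_deriv_eq_sub (fun x _ => (hφ.differentiable one_ne_zero x))
    (hc.intervalIntegrable s t)

/-- A primitive is a weak antiderivative. -/
lemma hasWeakDeriv (hA : IsPrimitive A f) {I : Set ℝ} :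
    HasWeakDeriv I A f := by
  intro φ h1 h2 h3
  have hφ : ContDiff ℝ 1 fun x => (φ x : ℂ) :=
    Complex.ofRealCLM.contDiff.comp (h1.of_le (by norm_cast))
  have hd : ∀ x, deriv (fun x => (φ x : ℂ)) x = ((deriv φ x : ℝ) : ℂ) := fun x =>
    (((h1.differentiable (by simp)) x).hasDerivAt.ofReal_comp).deriv
  have hP := (of_contDiff hφ).mul hA
  have hzero : ∀ x, x ∉ tsupport φ → φ x = 0 ∧ deriv φ x = 0 := fun x hx =>
    ⟨image_eq_zero_of_notMem_tsupport hx,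
      image_eq_zero_of_notMem_tsupport fun h => hx (tsupport_deriv_subset h)⟩
  -- An interval whose interior contains the support of `φ`, so that integrating the derivative of
  -- `φ A` over it leaves no boundary terms.
  obtain ⟨M, hM⟩ := h2.isCompact.isBounded.subset_closedBall 0
  have hM' : ∀ x, x ∈ tsupport φ → -|M| - 1 < x ∧ x < |M| + 1 := fun x hx => by
    have h4 := hM hx
    rw [mem_closedBall_zero_iff, Real.norm_eq_abs] at h4
    have := abs_le.1 (h4.trans (le_abs_self M))
    constructor <;> linarith
  have hI := hP.integral_eq (-|M| - 1) (|M| + 1)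
  have hout : ∀ x, (x = -|M| - 1 ∨ x = |M| + 1) → φ x = 0 := by
    rintro x hx
    refine (hzero x fun h => ?_).1
    have := hM' x h
    rcases hx with rfl | rfl <;> linarith
  rw [hout _ (Or.inl rfl), hout _ (Or.inr rfl),
    intervalIntegral.integral_eq_integral_of_support_subset] at hI
  swap
  · intro x hx
    by_contra hxn
    refine hx ?_
    have : x ∉ tsupport φ := fun h => hxn ⟨(hM' x h).1, (hM' x h).2.le⟩
    simp [hd, hzero x this]
  have i1 : Integrable (fun x => deriv φ x • A x) volume :=
    ((h1.continuous_deriv (by simp)).smul hA.continuous).integrable_of_hasCompactSupport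
      (h2.deriv.smul_right)
  have i2 : Integrable (fun x => φ x • f x) volume :=
    hA.locallyIntegrable.integrable_smul_left_of_hasCompactSupport h1.continuous h2
  rw [setIntegral_eq_integral_of_forall_compl_eq_zero fun x hx => by
      rw [(hzero x fun h => hx (h3 h)).2, zero_smul],
    setIntegral_eq_integral_of_forall_compl_eq_zero fun x hx => by
      rw [(hzero x fun h => hx (h3 h)).1, zero_smul]]
  rw [eq_neg_iff_add_eq_zero, ← integral_add i1 i2]
  simpa [hd] using hI

end IsPrimitive

end Primitive

/-! ### Weak derivatives on intervals -/

section DuBoisReymond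

/-- **Du Bois-Reymond.** A function with weak derivative zero on an open interval is constant. -/
lemma ae_eq_const_of_hasWeakDeriv_zero {I : Set ℝ} (hI : IsOpen I) (hne : I.Nonempty)
    (hc : I.OrdConnected) {h : ℝ → ℂ} (hloc : LocallyIntegrable h (volume.restrict I))
    (hw : HasWeakDeriv I h 0) : ∃ c, h =ᵐ[volume.restrict I] fun _ => c := by
  obtain ⟨x₀, hx₀⟩ := hne
  obtain ⟨ε, hε, hball⟩ := Metric.nhds_basis_closedBall.mem_iff.1 (hI.mem_nhds hx₀)
  let b : ContDiffBump x₀ := ⟨ε / 2, ε, by positivity, by linarith⟩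
  let ψ := b.normed volume
  have ψs : ContDiff ℝ ∞ ψ := b.contDiff_normed
  have ψc : HasCompactSupport ψ := b.hasCompactSupport_normed
  have ψI : tsupport ψ ⊆ I := by
    rw [b.tsupport_normed_eq]; exact hball
  have ψ1 : ∫ x, ψ x = 1 := b.integral_normed
  have hint : ∀ φ : ℝ → ℝ, Continuous φ → HasCompactSupport φ →
      Integrable (fun x => φ x • h x) (volume.restrict I) := fun φ h1 h2 =>
    hloc.integrable_smul_left_of_hasCompactSupport h1 h2
  refine ⟨∫ x in I, ψ x • h x, ?_⟩
  set c := ∫ x in I, ψ x • h x with hcdef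
  have hloc' : LocallyIntegrable (fun x => h x - c) (volume.restrict I) :=
    hloc.sub (continuous_const.locallyIntegrable)
  have key := hI.ae_eq_zero_of_integral_contDiff_smul_eq_zero (μ := volume.restrict I)
    (hloc'.locallyIntegrableOn I) (by
    intro φ h1 h2 h3
    -- Subtracting `m ψ` makes the integral zero, so the primitive `Φ` has compact support. The
    -- support lies between the extreme points of `K`, hence in `I` because `I` is order connected,
    -- and `Φ` is a legitimate test function.
    let m := ∫ x, φ x
    let θ : ℝ → ℝ := fun x => φ x - m * ψ x
    have θs : ContDiff ℝ ∞ θ := h1.sub (contDiff_const.mul ψs)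
    let K := tsupport φ ∪ tsupport ψ
    have hK : IsCompact K := h2.isCompact.union ψc.isCompact
    have hKI : K ⊆ I := Set.union_subset h3 ψI
    have hKne : K.Nonempty := by
      refine ⟨x₀, Or.inr ?_⟩
      rw [b.tsupport_normed_eq]; exact Metric.mem_closedBall_self hε.le
    have hθK : ∀ x, x ∉ K → θ x = 0 := fun x hx => by
      have h4 : φ x = 0 := image_eq_zero_of_notMem_tsupport fun h => hx (Or.inl h)
      have h5 : ψ x = 0 := image_eq_zero_of_notMem_tsupport fun h => hx (Or.inr h)
      simp [θ, h4, h5]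
    have hlo : ∀ x, x < sInf K → x ∉ K := fun x hx h => not_le.2 hx (csInf_le hK.bddBelow h)
    have hhi : ∀ x, sSup K < x → x ∉ K := fun x hx h => not_le.2 hx (le_csSup hK.bddAbove h)
    have iφ : Integrable φ := h1.continuous.integrable_of_hasCompactSupport h2
    have iψ : Integrable ψ := ψs.continuous.integrable_of_hasCompactSupport ψc
    have hθ0 : ∫ x, θ x = 0 := by
      simp only [θ]
      rw [integral_sub iφ (iψ.const_mul m), integral_const_mul, ψ1]
      simp [m]
    let Φ : ℝ → ℝ := fun t => ∫ x in (sInf K - 1)..t, θ x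
    have hΦd : ∀ t, HasDerivAt Φ (θ t) t := fun t =>
      intervalIntegral.integral_hasDerivAt_right (θs.continuous.intervalIntegrable _ _)
        (θs.continuous.stronglyMeasurableAtFilter _ _) θs.continuous.continuousAt
    have hΦd' : deriv Φ = θ := funext fun t => (hΦd t).deriv
    have Φs : ContDiff ℝ ∞ Φ := by
      rw [contDiff_infty_iff_deriv]
      exact ⟨fun t => (hΦd t).differentiableAt, by rwa [hΦd']⟩
    have hΦlo : ∀ t, t < sInf K → Φ t = 0 := fun t ht => by
      refine (intervalIntegral.integral_congr (g := fun _ => 0) fun x hx => ?_).trans (by simp)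
      refine hθK x (hlo x ?_)
      have := hx.2
      rcases max_cases (sInf K - 1) t with h | h <;> linarith
    have hΦhi : ∀ t, sSup K < t → Φ t = 0 := fun t ht => by
      change ∫ x in (sInf K - 1)..t, θ x = 0
      rw [intervalIntegral.integral_eq_integral_of_support_subset, hθ0]
      intro x hx
      by_contra hxn
      refine hx (hθK x fun hxK => hxn ⟨?_, ?_⟩)
      · linarith [csInf_le hK.bddBelow hxK]
      · linarith [le_csSup hK.bddAbove hxK]
    have hts : tsupport Φ ⊆ Set.Icc (sInf K) (sSup K) := by
      refine closure_minimal (fun t ht => ?_) isClosed_Icc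
      by_contra hn
      rw [Set.mem_Icc, not_and_or, not_le, not_le] at hn
      exact ht (hn.elim (hΦlo t) (hΦhi t))
    have hIcc : Set.Icc (sInf K) (sSup K) ⊆ I :=
      hc.out (hKI (hK.sInf_mem hKne)) (hKI (hK.sSup_mem hKne))
    have hΦc : HasCompactSupport Φ := isCompact_Icc.of_isClosed_subset (isClosed_tsupport _) hts
    have hfin := hw Φ Φs hΦc (hts.trans hIcc)
    simp only [hΦd', Pi.zero_apply, smul_zero, integral_zero, neg_zero] at hfin
    have e1 : ∫ x in I, θ x • h x = (∫ x in I, φ x • h x) - m • c := by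
      simp only [θ, sub_smul, mul_smul]
      have i3 : Integrable (fun x => m • ψ x • h x) (volume.restrict I) :=
        (hint ψ ψs.continuous ψc).smul m
      rw [integral_sub (hint φ h1.continuous h2) i3, integral_smul]
    have e2 : ∫ x in I, φ x • (h x - c) = (∫ x in I, φ x • h x) - m • c := by
      simp only [smul_sub]
      rw [integral_sub (hint φ h1.continuous h2) ((iφ.smul_const c).restrict), integral_smul_const,
        setIntegral_eq_integral_of_forall_compl_eq_zero (f := φ) fun x hx =>
          image_eq_zero_of_notMem_tsupport fun h => hx (h3 h)]
    rw [e2, ← e1, hfin])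
  filter_upwards [key, ae_restrict_mem hI.measurableSet] with x hx hx'
  exact sub_eq_zero.1 (hx hx')

variable {I : Set ℝ}

lemma locallyIntegrable_indicator (hI : MeasurableSet I)
    (g : Lp ℂ 2 ((volume : Measure ℝ).restrict I)) :
    LocallyIntegrable (I.indicator g) volume :=
  ((memLp_indicator_iff_restrict hI).2 (Lp.memLp g)).locallyIntegrable (by norm_num)

/-- Functions in `H¹` of an open interval are absolutely continuous. -/
lemma exists_isPrimitive (hI : IsOpen I) (hne : I.Nonempty) (hc : I.OrdConnected)
    {f g : Lp ℂ 2 ((volume : Measure ℝ).restrict I)} (h : HasWeakDeriv I f g) :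
    ∃ A, IsPrimitive A (I.indicator g) ∧ f =ᵐ[volume.restrict I] A := by
  -- Extending `g` by zero gives a primitive on the whole line. It is continuous at an endpoint of
  -- `I`, and its value there is the boundary value of `f`.
  have hP := IsPrimitive.of_integral (locallyIntegrable_indicator hI.measurableSet g) 0 0
  set P : ℝ → ℂ := fun t => 0 + ∫ x in (0 : ℝ)..t, I.indicator g x
  have hPw : HasWeakDeriv I P g :=
    hP.hasWeakDeriv.congr EventuallyEq.rfl (indicator_ae_eq_restrict hI.measurableSet).symm
  obtain ⟨c, hcf⟩ := ae_eq_const_of_hasWeakDeriv_zero hI hne hc (h := fun x => f x - P x)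
    ((locInt f).sub hP.continuous.locallyIntegrable) (by
      intro φ h1 h2 h3
      have hd : Continuous (deriv φ) := h1.continuous_deriv (by simp)
      simp only [smul_sub, Pi.zero_apply, smul_zero, integral_zero, neg_zero]
      rw [integral_sub (integrable_test _ hd h2.deriv)
        (hP.continuous.locallyIntegrable.integrable_smul_left_of_hasCompactSupport hd h2.deriv),
        h φ h1 h2 h3, hPw φ h1 h2 h3, sub_self])
  refine ⟨_, IsPrimitive.of_integral (locallyIntegrable_indicator hI.measurableSet g) 0 c, ?_⟩
  filter_upwards [hcf] with x hx
  rw [← hx]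
  simp [P]

end DuBoisReymond

/-! ### Boundary values and Green's formula on a half-line -/

section HalfLine

variable {Em Ep : Type*}

/-- The orientation of an edge: `-1` for incoming edges and `1` for outgoing ones. -/
def orientation (e : Em ⊕ Ep) : ℝ := Sum.elim (fun _ => -1) (fun _ => 1) e

lemma nonempty_halfLine (e : Em ⊕ Ep) : (halfLine e).Nonempty := by
  cases e
  · exact Set.nonempty_Iio
  · exact Set.nonempty_Ioi

lemma ordConnected_halfLine (e : Em ⊕ Ep) : (halfLine e).OrdConnected := by
  cases e
  · exact Set.ordConnected_Iio
  · exact Set.ordConnected_Ioi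

lemma neBot_nhdsWithin_halfLine (e : Em ⊕ Ep) : (𝓝[halfLine e] (0 : ℝ)).NeBot := by
  cases e
  · exact nhdsLT_neBot 0
  · exact nhdsGT_neBot 0

/-- The `L²` space of an edge. -/
abbrev EdgeL2 (e : Em ⊕ Ep) : Type := Lp ℂ 2 ((volume : Measure ℝ).restrict (halfLine e))

variable {e : Em ⊕ Ep}

lemma HasTrace.unique {f : ℝ → ℂ} {a b : ℂ} (ha : HasTrace (halfLine e) f a)
    (hb : HasTrace (halfLine e) f b) : a = b := by
  obtain ⟨g, hg1, hg2, hg3⟩ := ha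
  obtain ⟨k, hk1, hk2, hk3⟩ := hb
  have := neBot_nhdsWithin_halfLine e
  have h := Measure.eqOn_open_of_ae_eq (hg2.symm.trans hk2) (isOpen_halfLine e) hg1 hk1
  refine tendsto_nhds_unique hg3 (hk3.congr' ?_)
  filter_upwards [self_mem_nhdsWithin] with x hx using (h hx).symm

lemma HasTrace.of_continuous {f A : ℝ → ℂ} (hA : Continuous A)
    (h : f =ᵐ[volume.restrict (halfLine e)] A) : HasTrace (halfLine e) f (A 0) :=
  ⟨A, hA.continuousOn, h, (hA.tendsto 0).mono_left nhdsWithin_le_nhds⟩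

lemma HasWeakDeriv.add {f g f' g' : EdgeL2 e} (hf : HasWeakDeriv (halfLine e) f f')
    (hg : HasWeakDeriv (halfLine e) g g') :
    HasWeakDeriv (halfLine e) (f + g : EdgeL2 e) (f' + g' : EdgeL2 e) := by
  have h : HasWeakDeriv (halfLine e) (fun x => f x + g x) (fun x => f' x + g' x) := by
    intro φ h1 h2 h3
    have hd : Continuous (deriv φ) := h1.continuous_deriv (by simp)
    simp only [smul_add]
    rw [integral_add (integrable_test _ hd h2.deriv) (integrable_test _ hd h2.deriv),
      integral_add (integrable_test _ h1.continuous h2) (integrable_test _ h1.continuous h2),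
      hf φ h1 h2 h3, hg φ h1 h2 h3, neg_add]
  exact h.congr (Lp.coeFn_add _ _) (Lp.coeFn_add _ _)

lemma HasWeakDeriv.smul {f f' : EdgeL2 e} (c : ℂ) (hf : HasWeakDeriv (halfLine e) f f') :
    HasWeakDeriv (halfLine e) (c • f : EdgeL2 e) (c • f' : EdgeL2 e) := by
  have h : HasWeakDeriv (halfLine e) (fun x => c • f x) (fun x => c • f' x) := by
    intro φ h1 h2 h3
    simp only [smul_comm _ c]
    rw [integral_smul, integral_smul, hf φ h1 h2 h3, smul_neg]
  exact h.congr (Lp.coeFn_smul _ _) (Lp.coeFn_smul _ _)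

lemma HasTrace.add {f g : EdgeL2 e} {a b : ℂ} (hf : HasTrace (halfLine e) f a)
    (hg : HasTrace (halfLine e) g b) : HasTrace (halfLine e) (f + g : EdgeL2 e) (a + b) := by
  obtain ⟨g, hg1, hg2, hg3⟩ := hf
  obtain ⟨k, hk1, hk2, hk3⟩ := hg
  exact ⟨g + k, hg1.add hk1, (Lp.coeFn_add _ _).trans (hg2.add hk2), hg3.add hk3⟩

lemma HasTrace.smul {f : EdgeL2 e} {a : ℂ} (c : ℂ) (hf : HasTrace (halfLine e) f a) :
    HasTrace (halfLine e) (c • f : EdgeL2 e) (c * a) := by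
  obtain ⟨g, hg1, hg2, hg3⟩ := hf
  exact ⟨c • g, hg1.const_smul c, (Lp.coeFn_smul _ _).trans (hg2.const_smul c),
    hg3.const_smul c⟩

lemma HasWeakDeriv.exists_hasTrace {f g : EdgeL2 e} (h : HasWeakDeriv (halfLine e) f g) :
    ∃ a, HasTrace (halfLine e) f a := by
  obtain ⟨A, hA, hf⟩ := exists_isPrimitive (isOpen_halfLine e) (nonempty_halfLine e)
    (ordConnected_halfLine e) h
  exact ⟨_, HasTrace.of_continuous hA.continuous hf⟩

/-- Integrability of `q` gives `D` a limit at infinity, and integrability of `D` forces that limit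
to be zero. Only the endpoint `0` contributes, with the sign of the edge. -/
lemma integral_halfLine_of_isPrimitive {D q : ℝ → ℂ} (hD : IsPrimitive D q)
    (iD : IntegrableOn D (halfLine e)) (iq : IntegrableOn q (halfLine e)) :
    ∫ x in halfLine e, q x = -(orientation e : ℂ) * D 0 := by
  cases e with
  | inl e =>
    change IntegrableOn D (Set.Iio 0) at iD
    change IntegrableOn q (Set.Iio 0) at iq
    change ∫ x in Set.Iio 0, q x = -((-1 : ℝ) : ℂ) * D 0
    rw [← integral_Iic_eq_integral_Iio]
    have h1 := intervalIntegral_tendsto_integral_Iic (0 : ℝ)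
      ((integrableOn_Iic_iff_integrableOn_Iio (by simp)).2 iq) tendsto_id
    have h2 : Tendsto D atBot (𝓝 (D 0 - ∫ x in Set.Iic 0, q x)) := by
      refine (h1.const_sub (D 0)).congr fun t => ?_
      rw [hD.integral_eq, id, sub_sub_cancel]
    have h3 := IntegrableAtFilter.eq_zero_of_tendsto ⟨_, Iio_mem_atBot 0, iD⟩ (fun s hs => by
      obtain ⟨b, hb⟩ := mem_atBot_sets.1 hs
      rw [← top_le_iff, ← Real.volume_Iic (a := b)]
      exact measure_mono hb) h2
    rw [sub_eq_zero] at h3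
    rw [← h3]; simp
  | inr e =>
    change IntegrableOn D (Set.Ioi 0) at iD
    change IntegrableOn q (Set.Ioi 0) at iq
    change ∫ x in Set.Ioi 0, q x = -((1 : ℝ) : ℂ) * D 0
    have h1 := intervalIntegral_tendsto_integral_Ioi (0 : ℝ) iq tendsto_id
    have h2 : Tendsto D atTop (𝓝 (D 0 + ∫ x in Set.Ioi 0, q x)) := by
      refine (h1.const_add (D 0)).congr fun t => ?_
      rw [hD.integral_eq, id, add_sub_cancel]
    have h3 := IntegrableAtFilter.eq_zero_of_tendsto ⟨_, Ioi_mem_atTop 0, iD⟩ (fun s hs => by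
      obtain ⟨b, hb⟩ := mem_atTop_sets.1 hs
      rw [← top_le_iff, ← Real.volume_Ici (a := b)]
      exact measure_mono hb) h2
    rw [eq_neg_of_add_eq_zero_right h3]; simp

/-- **Green's formula** on a half-line. -/
lemma HasWeakDeriv.inner_add_inner {f f' g g' : EdgeL2 e} {a b : ℂ}
    (hf : HasWeakDeriv (halfLine e) f f') (hg : HasWeakDeriv (halfLine e) g g')
    (ha : HasTrace (halfLine e) f a) (hb : HasTrace (halfLine e) g b) :
    ⟪f', g⟫_ℂ + ⟪f, g'⟫_ℂ = -(orientation e : ℂ) * ((starRingEnd ℂ) a * b) := by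
  obtain ⟨A, hA, hfA⟩ := exists_isPrimitive (isOpen_halfLine e) (nonempty_halfLine e)
    (ordConnected_halfLine e) hf
  obtain ⟨B, hB, hgB⟩ := exists_isPrimitive (isOpen_halfLine e) (nonempty_halfLine e)
    (ordConnected_halfLine e) hg
  obtain rfl := (HasTrace.of_continuous hA.continuous hfA).unique ha
  obtain rfl := (HasTrace.of_continuous hB.continuous hgB).unique hb
  have hm : MeasurableSet (halfLine e) := (isOpen_halfLine e).measurableSet
  have i1 := L2.integrable_inner (𝕜 := ℂ) f' g
  have i2 := L2.integrable_inner (𝕜 := ℂ) f g'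
  have i3 := L2.integrable_inner (𝕜 := ℂ) f g
  have e1 : (fun x => ⟪f' x, g x⟫_ℂ + ⟪f x, g' x⟫_ℂ) =ᵐ[volume.restrict (halfLine e)]
      fun t => (starRingEnd ℂ) ((halfLine e).indicator f' t) * B t
        + (starRingEnd ℂ) (A t) * (halfLine e).indicator g' t := by
    filter_upwards [hfA, hgB, ae_restrict_mem hm] with t h1 h2 h3
    rw [Set.indicator_of_mem h3, Set.indicator_of_mem h3, h1, h2, RCLike.inner_apply,
      RCLike.inner_apply]
    ring
  have e2 : (fun x => ⟪f x, g x⟫_ℂ) =ᵐ[volume.restrict (halfLine e)]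
      fun t => (starRingEnd ℂ) (A t) * B t := by
    filter_upwards [hfA, hgB] with t h1 h2
    rw [h1, h2, RCLike.inner_apply, mul_comm]
  rw [L2.inner_def, L2.inner_def, ← integral_add i1 i2, integral_congr_ae e1]
  exact integral_halfLine_of_isPrimitive (hA.conj.mul hB) (i3.congr e2) ((i1.add i2).congr e1)

/-- Green's formula with `g = f`. -/
lemma HasWeakDeriv.re_inner_self {f f' : EdgeL2 e} {a : ℂ}
    (hf : HasWeakDeriv (halfLine e) f f') (ha : HasTrace (halfLine e) f a) :
    (⟪f, f'⟫_ℂ).re = -orientation e * ‖a‖ ^ 2 / 2 := by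
  have h := congrArg Complex.re (hf.inner_add_inner hf ha ha)
  rw [Complex.add_re, ← inner_conj_symm f' f, Complex.conj_re, ← Complex.normSq_eq_conj_mul_self,
    ← Complex.ofReal_neg, ← Complex.ofReal_mul, Complex.ofReal_re, Complex.normSq_eq_norm_sq] at h
  linarith

lemma abs_orientation (e : Em ⊕ Ep) : |orientation e| = 1 := by
  cases e <;> simp [orientation]

/-- The constant is the same for all edges, which is what makes families of boundary values square
summable. -/
lemma HasWeakDeriv.norm_trace_sq_le {f f' : EdgeL2 e} {a : ℂ}
    (hf : HasWeakDeriv (halfLine e) f f') (ha : HasTrace (halfLine e) f a) :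
    ‖a‖ ^ 2 ≤ 2 * (‖f‖ * ‖f'‖) := by
  have h := (Complex.abs_re_le_norm _).trans (norm_inner_le_norm (𝕜 := ℂ) f f')
  rw [hf.re_inner_self ha, abs_div, abs_mul, abs_neg, abs_orientation, one_mul,
    abs_of_nonneg (by positivity), abs_two] at h
  linarith

/-! ### Exponentials -/

lemma memLp_exp (k : ℂ) (hk : orientation e * k.re < 0) :
    MemLp (fun t : ℝ => Complex.exp (k * t)) 2 (volume.restrict (halfLine e)) := by
  have hcont : Continuous fun t : ℝ => Complex.exp (k * t) := by fun_prop
  rw [memLp_two_iff_integrable_sq_norm hcont.aestronglyMeasurable]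
  have e1 : (fun t : ℝ => ‖Complex.exp (k * t)‖ ^ 2) = fun t => Real.exp ((2 * k.re) * t) := by
    funext t
    rw [Complex.norm_exp, ← Real.exp_nat_mul]
    congr 1
    simp; ring
  rw [e1]
  cases e with
  | inl e =>
    have hk' : 0 < 2 * k.re := by simp [orientation] at hk; linarith
    exact (integrableOn_exp_mul_Iic hk' 0).mono_set Set.Iio_subset_Iic_self
  | inr e =>
    have hk' : 2 * k.re < 0 := by simp [orientation] at hk; linarith
    exact integrableOn_exp_mul_Ioi hk' 0

variable (e) in
/-- The exponential `t ↦ exp (k t)` as an element of the `L²` space of an edge on which it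
decays. -/
def expL2 (k : ℂ) : EdgeL2 e :=
  if hk : orientation e * k.re < 0 then (memLp_exp k hk).toLp else 0

lemma coeFn_expL2 {k : ℂ} (hk : orientation e * k.re < 0) :
    expL2 e k =ᵐ[volume.restrict (halfLine e)] fun t : ℝ => Complex.exp (k * t) := by
  rw [expL2, dif_pos hk]
  exact MemLp.coeFn_toLp _

lemma hasWeakDeriv_expL2 {k : ℂ} (hk : orientation e * k.re < 0) :
    HasWeakDeriv (halfLine e) (expL2 e k) (k • expL2 e k : EdgeL2 e) := by
  have h1 : ContDiff ℝ 1 fun t : ℝ => Complex.exp (k * t) :=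
    (contDiff_const.mul Complex.ofRealCLM.contDiff).cexp
  have h2 : deriv (fun t : ℝ => Complex.exp (k * t)) = fun t : ℝ => k * Complex.exp (k * t) := by
    funext t
    have h3 : HasDerivAt (fun t : ℝ => k * (t : ℂ)) k t := by
      simpa using (Complex.ofRealCLM.hasDerivAt (x := t)).const_mul k
    rw [h3.cexp.deriv, mul_comm]
  refine (IsPrimitive.of_contDiff h1).hasWeakDeriv.congr (coeFn_expL2 hk) ?_
  filter_upwards [coeFn_expL2 hk, Lp.coeFn_smul k (expL2 e k)] with t h3 h4
  rw [h4, Pi.smul_apply, h3, h2, smul_eq_mul]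

lemma hasTrace_expL2 {k : ℂ} (hk : orientation e * k.re < 0) :
    HasTrace (halfLine e) (expL2 e k) 1 := by
  have h1 : Continuous fun t : ℝ => Complex.exp (k * t) := by fun_prop
  simpa using HasTrace.of_continuous h1 (coeFn_expL2 hk)

/-- Since `(exp(kt))' = k exp(kt)`, Green's formula computes the squared norm: `orientation * Re k *
‖·‖² = -1/2`. -/
lemma norm_expL2_le {k : ℂ} (hk : orientation e * k.re ≤ -1 / 2) : ‖expL2 e k‖ ≤ 1 := by
  have hk' : orientation e * k.re < 0 := by linarith
  have h := (hasWeakDeriv_expL2 hk').re_inner_self (hasTrace_expL2 hk')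
  have h0 : ⟪expL2 e k, expL2 e k⟫_ℂ = ((‖expL2 e k‖ ^ 2 : ℝ) : ℂ) := by
    rw [inner_self_eq_norm_sq_to_K]; simp
  rw [inner_smul_right, h0, Complex.re_mul_ofReal] at h
  have h2 : orientation e * orientation e = 1 := by
    rw [← abs_mul_abs_self, abs_orientation, one_mul]
  have h3 : orientation e * k.re * ‖expL2 e k‖ ^ 2 = -1 / 2 := by
    calc _ = orientation e * (k.re * ‖expL2 e k‖ ^ 2) := by ring
      _ = -(orientation e * orientation e) / 2 := by rw [h]; simp; ring
      _ = -1 / 2 := by rw [h2]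
  have h4 : ‖expL2 e k‖ ^ 2 ≤ 1 := by nlinarith [sq_nonneg ‖expL2 e k‖]
  exact (sq_le_one_iff₀ (norm_nonneg _)).1 h4

end HalfLine

/-! ### Solving linear equations by duality -/

section Duality

variable {X : Type*} [NormedAddCommGroup X] [InnerProductSpace ℂ X] [CompleteSpace X]

/-- If a linear relation `S` is bounded below, then its adjoint is onto. -/
lemma exists_inner_eq_of_bounded_below (S : Submodule ℂ (X × X)) {c : ℝ} (hc : 0 < c)
    (h : ∀ p ∈ S, c * ‖p.1‖ ≤ ‖p.2‖) (f : X) :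
    ∃ u, c * ‖u‖ ≤ ‖f‖ ∧ ∀ p ∈ S, ⟪u, p.2⟫_ℂ = ⟪f, p.1⟫_ℂ := by
  let g : S →ₗ[ℂ] X := (LinearMap.snd ℂ X X).comp S.subtype
  have hg : Function.Injective g := by
    rw [← LinearMap.ker_eq_bot, LinearMap.ker_eq_bot']
    rintro ⟨p, hp⟩ (h0 : p.2 = 0)
    have h1 := h p hp
    rw [h0, norm_zero] at h1
    have h2 : ‖p.1‖ = 0 := by nlinarith [norm_nonneg p.1]
    exact Subtype.ext (Prod.ext (norm_eq_zero.1 h2) h0)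
  let eq := LinearEquiv.ofInjective g hg
  -- Boundedness from below makes `p.2 ↦ ⟪f, p.1⟫` a well-defined bounded functional on the second
  -- components; Hahn–Banach and Riesz represent it by `u`.
  let ψ : LinearMap.range g →ₗ[ℂ] ℂ :=
    (innerₛₗ ℂ f).comp ((LinearMap.fst ℂ X X).comp (S.subtype.comp eq.symm.toLinearMap))
  have hψ : ∀ w, ‖ψ w‖ ≤ ‖f‖ / c * ‖w‖ := by
    intro w
    obtain ⟨p, rfl⟩ := eq.surjective w
    have e1 : ψ (eq p) = ⟪f, (p : X × X).1⟫_ℂ := by simp [ψ]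
    have e2 : ‖eq p‖ = ‖(p : X × X).2‖ := rfl
    rw [e1, e2, div_mul_eq_mul_div, le_div_iff₀ hc]
    calc ‖⟪f, (p : X × X).1⟫_ℂ‖ * c ≤ ‖f‖ * ‖(p : X × X).1‖ * c := by
          gcongr; exact norm_inner_le_norm _ _
      _ = ‖f‖ * (c * ‖(p : X × X).1‖) := by ring
      _ ≤ ‖f‖ * ‖(p : X × X).2‖ := by gcongr; exact h _ p.2
  obtain ⟨F, hF, hFn⟩ := exists_extension_norm_eq (LinearMap.range g) (ψ.mkContinuous _ hψ)
  refine ⟨(InnerProductSpace.toDual ℂ X).symm F, ?_, fun p hp => ?_⟩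
  · rw [LinearIsometryEquiv.norm_map, hFn, ← le_div_iff₀' hc]
    exact LinearMap.mkContinuous_norm_le _ (by positivity) _
  · rw [InnerProductSpace.toDual_symm_apply]
    have := hF (eq ⟨p, hp⟩)
    change F p.2 = _ at this
    rw [this]
    simp [ψ]

/-- A bounded coercive operator is onto. -/
lemma exists_apply_eq_of_coercive (T : X →L[ℂ] X) {c : ℝ} (hc : 0 < c)
    (h : ∀ v, c * ‖v‖ ^ 2 ≤ (⟪v, T v⟫_ℂ).re) (f : X) : ∃ u, T u = f := by
  -- Coercivity is inherited by the adjoint, which is therefore bounded below; the duality lemma for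
  -- its graph then solves `T u = f`.
  let S : Submodule ℂ (X × X) := (ContinuousLinearMap.adjoint T).toLinearMap.graph
  obtain ⟨u, -, hu⟩ := exists_inner_eq_of_bounded_below S hc (fun p hp => by
    rw [LinearMap.mem_graph_iff] at hp
    rw [hp]
    change c * ‖p.1‖ ≤ ‖ContinuousLinearMap.adjoint T p.1‖
    rcases eq_or_ne p.1 0 with h0 | h0
    · simp [h0]
    have h1 := h p.1
    rw [← ContinuousLinearMap.adjoint_inner_left] at h1
    have h2 := h1.trans ((Complex.re_le_norm _).trans (norm_inner_le_norm _ _))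
    have h3 : 0 < ‖p.1‖ := norm_pos_iff.2 h0
    nlinarith) f
  refine ⟨u, ext_inner_right ℂ fun v => ?_⟩
  rw [← hu (v, ContinuousLinearMap.adjoint T v) rfl, ContinuousLinearMap.adjoint_inner_right]

variable {Em Ep : Type*} {e : Em ⊕ Ep}

/-- The first order equation `u' = k u + f` has a solution in `L²` of the half-line if
`Re k ≠ 0`. -/
lemma exists_hasWeakDeriv_smul_add {k : ℂ} (hk : k.re ≠ 0) (f : EdgeL2 e) :
    ∃ u : EdgeL2 e, HasWeakDeriv (halfLine e) u (k • u + f : EdgeL2 e) ∧ |k.re| * ‖u‖ ≤ ‖f‖ := by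
  let k' := (starRingEnd ℂ) k
  have hzero : HasWeakDeriv (halfLine e) (0 : EdgeL2 e) (0 : EdgeL2 e) := by
    have h0 : HasWeakDeriv (halfLine e) (fun _ => 0) (fun _ => 0) := by
      intro φ _ _ _
      simp
    exact h0.congr (Lp.coeFn_zero _ _ _) (Lp.coeFn_zero _ _ _)
  -- The relation `φ ↦ φ' + conj k φ` with zero boundary value, minus the formal adjoint of `u ↦ u'
  -- - k u`; hence the datum `-f` below. The boundary term vanishes, so `Re ⟪p.1, p.2⟫ = Re k
  -- ‖p.1‖²`: the bound from below holds for either sign of `Re k` on either half-line.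
  let S : Submodule ℂ (EdgeL2 e × EdgeL2 e) :=
    { carrier := {p | HasWeakDeriv (halfLine e) p.1 (p.2 - k' • p.1 : EdgeL2 e) ∧
        HasTrace (halfLine e) p.1 0}
      zero_mem' := by
        refine ⟨?_, ?_⟩
        · simpa using hzero
        · exact ⟨fun _ => 0, continuousOn_const, Lp.coeFn_zero _ _ _, tendsto_const_nhds⟩
      add_mem' := by
        rintro p q ⟨h1, h2⟩ ⟨h3, h4⟩
        refine ⟨?_, by simpa using h2.add h4⟩
        have e : (p + q).2 - k' • (p + q).1 = (p.2 - k' • p.1) + (q.2 - k' • q.1) := by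
          rw [Prod.fst_add, Prod.snd_add]; module
        rw [e]
        exact h1.add h3
      smul_mem' := by
        rintro c p ⟨h1, h2⟩
        refine ⟨?_, by simpa using h2.smul c⟩
        have e : (c • p).2 - k' • (c • p).1 = c • (p.2 - k' • p.1) := by
          rw [Prod.smul_fst, Prod.smul_snd]; module
        rw [e]
        exact h1.smul c }
  obtain ⟨u, hu1, hu2⟩ := exists_inner_eq_of_bounded_below S (abs_pos.2 hk) (fun p hp => by
    obtain ⟨h1, h2⟩ := hp
    have h3 := h1.re_inner_self h2
    rw [inner_sub_right, inner_smul_right, inner_self_eq_norm_sq_to_K] at h3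
    have h4 : (⟪p.1, p.2⟫_ℂ).re = k.re * ‖p.1‖ ^ 2 := by
      have e : (k' * ((‖p.1‖ : ℂ)) ^ 2).re = k.re * ‖p.1‖ ^ 2 := by
        rw [← Complex.ofReal_pow, Complex.re_mul_ofReal, Complex.conj_re]
      simp only [norm_zero] at h3
      rw [Complex.sub_re] at h3
      change _ - (k' * ((‖p.1‖ : ℂ)) ^ 2).re = _ at h3
      rw [e] at h3
      linarith
    rcases eq_or_ne p.1 0 with h0 | h0
    · simp [h0]
    have h5 := (Complex.abs_re_le_norm _).trans (norm_inner_le_norm (𝕜 := ℂ) p.1 p.2)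
    rw [h4, abs_mul, abs_of_nonneg (sq_nonneg ‖p.1‖)] at h5
    have h6 : 0 < ‖p.1‖ := norm_pos_iff.2 h0
    nlinarith) (-f)
  rw [norm_neg] at hu1
  refine ⟨u, fun φ h1 h2 h3 => ?_, hu1⟩
  have hd : Continuous (deriv φ) := h1.continuous_deriv (by simp)
  have hφ : ContDiff ℝ ∞ fun x => (φ x : ℂ) := Complex.ofRealCLM.contDiff.comp h1
  have hφd : deriv (fun x => (φ x : ℂ)) = fun x => ((deriv φ x : ℝ) : ℂ) := funext fun x =>
    (((h1.differentiable (by simp)) x).hasDerivAt.ofReal_comp).deriv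
  have m1 : MemLp (fun x => (φ x : ℂ)) 2 (volume.restrict (halfLine e)) :=
    hφ.continuous.memLp_of_hasCompactSupport (h2.comp_left Complex.ofReal_zero)
  have m2 : MemLp (fun x => ((deriv φ x : ℝ) : ℂ)) 2 (volume.restrict (halfLine e)) :=
    (Complex.continuous_ofReal.comp hd).memLp_of_hasCompactSupport
      (h2.deriv.comp_left Complex.ofReal_zero)
  have hS : (m1.toLp, m2.toLp + k' • m1.toLp) ∈ S := by
    refine ⟨?_, ?_⟩
    · simp only [add_sub_cancel_right]
      have := (IsPrimitive.of_contDiff (hφ.of_le (by norm_cast))).hasWeakDeriv (I := halfLine e)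
      rw [hφd] at this
      exact this.congr m1.coeFn_toLp m2.coeFn_toLp
    · have h0 : φ 0 = 0 := image_eq_zero_of_notMem_tsupport fun h => by
        have := h3 h
        cases e <;> simp [halfLine] at this
      simpa [h0] using HasTrace.of_continuous hφ.continuous m1.coeFn_toLp
  have key := congrArg (starRingEnd ℂ) (hu2 _ hS)
  simp only [inner_conj_symm, inner_add_left, inner_smul_left, inner_neg_right] at key
  have hinner : ∀ (ψ : ℝ → ℝ) (m : MemLp (fun x => (ψ x : ℂ)) 2 (volume.restrict (halfLine e)))
      (g : EdgeL2 e), ⟪m.toLp, g⟫_ℂ = ∫ x in halfLine e, ψ x • g x := by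
    intro ψ m g
    rw [L2.inner_def]
    refine integral_congr_ae ?_
    filter_upwards [m.coeFn_toLp] with x hx
    rw [hx, RCLike.inner_apply, Complex.conj_ofReal, mul_comm, Complex.real_smul]
  have e1 := hinner φ m1 u
  have e2 := hinner φ m1 f
  have e3 := hinner (deriv φ) m2 u
  have e4 := hinner φ m1 (k • u + f)
  rw [← e3, ← e4, inner_add_right, inner_smul_right]
  simp only [k', Complex.conj_conj] at key
  linear_combination key

end Duality

/-! ### Square summable families -/

section SquareSummable

variable {ι : Type*} {F G : ι → Type*} [∀ i, NormedAddCommGroup (F i)]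
  [∀ i, NormedAddCommGroup (G i)]

lemma hasSum_norm_sq (f : lp F 2) : HasSum (fun i => ‖f i‖ ^ 2) (‖f‖ ^ 2) := by
  have h := lp.hasSum_norm (p := 2) (by norm_num) f
  have e : (2 : ℝ≥0∞).toReal = ((2 : ℕ) : ℝ) := by norm_num
  simpa only [e, Real.rpow_natCast] using h

lemma memℓp_two_of_summable {f : ∀ i, F i} (h : Summable fun i => ‖f i‖ ^ 2) : Memℓp f 2 := by
  refine memℓp_gen ?_
  have e : (2 : ℝ≥0∞).toReal = ((2 : ℕ) : ℝ) := by norm_num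
  simpa only [e, Real.rpow_natCast] using h

lemma memℓp_two_of_norm_le {f : ∀ i, F i} {g : lp G 2} {C : ℝ} (h : ∀ i, ‖f i‖ ≤ C * ‖g i‖) :
    Memℓp f 2 := by
  refine memℓp_two_of_summable (Summable.of_nonneg_of_le (fun i => sq_nonneg _) (fun i => ?_)
    ((hasSum_norm_sq g).summable.mul_left (C ^ 2)))
  rw [← mul_pow]
  exact pow_le_pow_left₀ (norm_nonneg _) (h i) 2

lemma lp_norm_le_of_norm_le {f : lp F 2} {g : lp G 2} {C : ℝ} (hC : 0 ≤ C)
    (h : ∀ i, ‖f i‖ ≤ C * ‖g i‖) : ‖f‖ ≤ C * ‖g‖ := by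
  refine (sq_le_sq₀ (norm_nonneg _) (by positivity)).1 ?_
  rw [mul_pow]
  refine hasSum_le (fun i => ?_) (hasSum_norm_sq f) ((hasSum_norm_sq g).mul_left (C ^ 2))
  rw [← mul_pow]
  exact pow_le_pow_left₀ (norm_nonneg _) (h i) 2

variable [∀ i, NormedSpace ℂ (F i)] [∀ i, NormedSpace ℂ (G i)]

/-- The map of Hilbert sums induced by a uniformly bounded family of linear maps. -/
def lpMap (L : ∀ i, F i →ₗ[ℂ] G i) (C : ℝ) (hC : 0 ≤ C) (h : ∀ i x, ‖L i x‖ ≤ C * ‖x‖) :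
    lp F 2 →L[ℂ] lp G 2 :=
  LinearMap.mkContinuous
    { toFun := fun f => ⟨fun i => L i (f i), memℓp_two_of_norm_le fun i => h i (f i)⟩
      map_add' := fun f g => by ext i; exact map_add (L i) _ _
      map_smul' := fun c f => by ext i; exact map_smul (L i) _ _ } C fun f =>
    lp_norm_le_of_norm_le hC fun i => h i (f i)

end SquareSummable

/-! ### Multiplication operators on `ℓ²` -/

section Diagonal

variable {E : Type*}

/-- Multiplication by a bounded family on `ℓ²`. -/
def diagEll2 (m : E → ℝ) (C : ℝ) (hC : 0 ≤ C) (hm : ∀ e, |m e| ≤ C) : Ell2 E →L[ℂ] Ell2 E :=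
  lpMap (fun e => (m e : ℂ) • LinearMap.id) C hC fun e x => by
    rw [LinearMap.smul_apply, norm_smul, Complex.norm_real, LinearMap.id_apply]
    exact mul_le_mul_of_nonneg_right (hm e) (norm_nonneg _)

end Diagonal

/-! ### Weighted `ℓ²` spaces -/

section Weighted

variable {E : Type*} {w : E → ℝ}

/-- Every point has positive mass, so classes in the weighted space may be handled as honest
functions. -/
lemma ae_weightMeasure_iff (hw : ∀ e, 0 < w e) {P : E → Prop} :
    (∀ᵐ e ∂(weightMeasure w), P e) ↔ ∀ e, P e := by
  let _ : MeasurableSpace E := ⊤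
  refine ⟨fun h e => ?_, fun h => Eventually.of_forall h⟩
  by_contra hP
  have h1 : weightMeasure w {e} = 0 := measure_mono_null (by simpa using hP) h
  rw [weightMeasure, withDensity_apply _ (MeasurableSpace.measurableSet_top), lintegral_singleton,
    Measure.count_singleton, mul_one, ENNReal.ofReal_eq_zero] at h1
  exact not_le.2 (hw e) h1

lemma WEll2.coe_eq (hw : ∀ e, 0 < w e) {f g : E → ℂ} (h : f =ᵐ[weightMeasure w] g) : f = g :=
  funext ((ae_weightMeasure_iff hw).1 h)

lemma WEll2.coe_add (hw : ∀ e, 0 < w e) (x y : WEll2 w) (e : E) : (x + y) e = x e + y e :=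
  congrFun (WEll2.coe_eq hw (Lp.coeFn_add x y)) e

lemma WEll2.coe_smul (hw : ∀ e, 0 < w e) (c : ℂ) (x : WEll2 w) (e : E) : (c • x) e = c * x e :=
  congrFun (WEll2.coe_eq hw (Lp.coeFn_smul c x)) e

lemma WEll2.ext {x y : WEll2 w} (h : ∀ e, x e = y e) : x = y :=
  Lp.ext (Eventually.of_forall h)

lemma eLpNorm_weightMeasure_sq (hw : ∀ e, 0 ≤ w e) (f : E → ℂ) :
    eLpNorm f 2 (weightMeasure w) ^ 2 = ∑' e, ENNReal.ofReal (w e * ‖f e‖ ^ 2) := by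
  let _ : MeasurableSpace E := ⊤
  have h := eLpNorm_nnreal_pow_eq_lintegral (f := f) (μ := weightMeasure w) (p := 2) (by norm_num)
  have e1 : (((2 : ℝ≥0) : ℝ≥0∞)) = 2 := by norm_num
  rw [e1] at h
  have e2 : ((2 : ℝ≥0) : ℝ) = ((2 : ℕ) : ℝ) := by norm_num
  rw [e2] at h
  simp only [ENNReal.rpow_natCast] at h
  rw [h, weightMeasure, lintegral_withDensity_eq_lintegral_mul _ (measurable_from_top)
    measurable_from_top, lintegral_count]
  refine tsum_congr fun e => ?_
  rw [Pi.mul_apply, ENNReal.ofReal_mul (hw e), ENNReal.ofReal_pow (norm_nonneg _), ofReal_norm]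

lemma WEll2.hasSum_norm_sq (hw : ∀ e, 0 ≤ w e) (x : WEll2 w) :
    HasSum (fun e => w e * ‖x e‖ ^ 2) (‖x‖ ^ 2) := by
  have h := eLpNorm_weightMeasure_sq hw x
  have hfin : ∑' e, ENNReal.ofReal (w e * ‖x e‖ ^ 2) ≠ ⊤ := by
    rw [← h]
    exact ENNReal.pow_ne_top (Lp.eLpNorm_ne_top x)
  have h1 := ENNReal.hasSum_toReal hfin
  rw [← ENNReal.tsum_toReal_eq fun e => ENNReal.ofReal_ne_top, ← h, ENNReal.toReal_pow,
    ← Lp.norm_def] at h1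
  have h2 : ∀ e, (ENNReal.ofReal (w e * ‖x e‖ ^ 2)).toReal = w e * ‖x e‖ ^ 2 := fun e =>
    ENNReal.toReal_ofReal (mul_nonneg (hw e) (sq_nonneg _))
  simpa only [h2] using h1

lemma memLp_weightMeasure (hw : ∀ e, 0 ≤ w e) {f : E → ℂ}
    (hf : Summable fun e => w e * ‖f e‖ ^ 2) : MemLp f 2 (weightMeasure w) := by
  let _ : MeasurableSpace E := ⊤
  refine ⟨(measurable_from_top (f := f)).aestronglyMeasurable, ?_⟩
  have h := eLpNorm_weightMeasure_sq hw f
  rw [← ENNReal.ofReal_tsum_of_nonneg (fun e => mul_nonneg (hw e) (sq_nonneg _)) hf] at h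
  by_contra hn
  rw [not_lt, top_le_iff] at hn
  rw [hn] at h
  simp at h

lemma coeFn_toLp_weightMeasure (hw : ∀ e, 0 < w e) {f : E → ℂ} (hf : MemLp f 2 (weightMeasure w))
    (e : E) : (hf.toLp : WEll2 w) e = f e :=
  congrFun (WEll2.coe_eq hw hf.coeFn_toLp) e

lemma WEll2.norm_sq_le (hw : ∀ e, 0 < w e) {C : ℝ} (hC : ∀ e, 1 / w e ≤ C) (x : WEll2 w) (e : E) :
    ‖x e‖ ^ 2 ≤ |C| * (w e * ‖x e‖ ^ 2) := by
  have h1 : 1 ≤ |C| * w e := (div_le_iff₀ (hw e)).1 ((hC e).trans (le_abs_self C))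
  nlinarith [sq_nonneg ‖x e‖]

lemma WEll2.memℓp (hw : ∀ e, 0 < w e) {C : ℝ} (hC : ∀ e, 1 / w e ≤ C) (x : WEll2 w) :
    Memℓp (fun e => x e) 2 :=
  memℓp_two_of_summable (Summable.of_nonneg_of_le (fun _ => sq_nonneg _) (WEll2.norm_sq_le hw hC x)
    ((WEll2.hasSum_norm_sq (fun e => (hw e).le) x).summable.mul_left |C|))

/-- The inclusion of a weighted `ℓ²` space into `ℓ²` as a linear map. -/
def WEll2.toEll2Linear (hw : ∀ e, 0 < w e) (C : ℝ) (hC : ∀ e, 1 / w e ≤ C) :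
    WEll2 w →ₗ[ℂ] Ell2 E where
  toFun x := ⟨fun e => x e, WEll2.memℓp hw hC x⟩
  map_add' x y := Subtype.ext (funext fun e => WEll2.coe_add hw x y e)
  map_smul' c x := Subtype.ext (funext fun e => WEll2.coe_smul hw c x e)

lemma WEll2.norm_toEll2Linear_le (hw : ∀ e, 0 < w e) (C : ℝ) (hC : ∀ e, 1 / w e ≤ C)
    (x : WEll2 w) : ‖WEll2.toEll2Linear hw C hC x‖ ≤ √|C| * ‖x‖ := by
  refine (sq_le_sq₀ (norm_nonneg _) (by positivity)).1 ?_
  rw [mul_pow, Real.sq_sqrt (abs_nonneg C)]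
  exact hasSum_le (WEll2.norm_sq_le hw hC x)
    (StarGraph.hasSum_norm_sq (WEll2.toEll2Linear hw C hC x))
    ((WEll2.hasSum_norm_sq (fun e => (hw e).le) x).mul_left |C|)

/-- The inclusion of a weighted `ℓ²` space, with weights bounded from below, into `ℓ²`. -/
def WEll2.toEll2 (hw : ∀ e, 0 < w e) (C : ℝ) (hC : ∀ e, 1 / w e ≤ C) : WEll2 w →L[ℂ] Ell2 E :=
  (WEll2.toEll2Linear hw C hC).mkContinuous _ (WEll2.norm_toEll2Linear_le hw C hC)

lemma memLp_weightMeasure_of_ell2 (hw : ∀ e, 0 < w e) {C : ℝ} (hC : ∀ e, w e ≤ C) (x : Ell2 E) :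
    MemLp (fun e => x e) 2 (weightMeasure w) :=
  memLp_weightMeasure (fun e => (hw e).le) (Summable.of_nonneg_of_le
    (fun e => mul_nonneg (hw e).le (sq_nonneg _))
    (fun e => mul_le_mul_of_nonneg_right (hC e) (sq_nonneg _))
    ((hasSum_norm_sq x).summable.mul_left C))

/-- The inclusion of `ℓ²` into a weighted `ℓ²` space with bounded weights. -/
def Ell2.toWEll2 (hw : ∀ e, 0 < w e) (C : ℝ) (hC : ∀ e, w e ≤ C) : Ell2 E →L[ℂ] WEll2 w :=
  LinearMap.mkContinuous
    { toFun := fun x => (memLp_weightMeasure_of_ell2 hw hC x).toLp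
      map_add' := fun x y => WEll2.ext fun e => by
        rw [WEll2.coe_add hw]; simp only [coeFn_toLp_weightMeasure hw]; rfl
      map_smul' := fun c x => WEll2.ext fun e => by
        rw [WEll2.coe_smul hw]; simp only [coeFn_toLp_weightMeasure hw]; rfl } (√|C|) fun x => by
    refine (sq_le_sq₀ (norm_nonneg _) (by positivity)).1 ?_
    rw [mul_pow, Real.sq_sqrt (abs_nonneg C)]
    refine hasSum_le (fun e => ?_) (WEll2.hasSum_norm_sq (fun e => (hw e).le) _)
      ((StarGraph.hasSum_norm_sq x).mul_left |C|)
    change w e * ‖((memLp_weightMeasure_of_ell2 hw hC x).toLp : WEll2 w) e‖ ^ 2 ≤ _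
    rw [coeFn_toLp_weightMeasure hw]
    exact mul_le_mul_of_nonneg_right ((hC e).trans (le_abs_self C)) (sq_nonneg _)

lemma Ell2.toWEll2_apply (hw : ∀ e, 0 < w e) (C : ℝ) (hC : ∀ e, w e ≤ C) (x : Ell2 E) (e : E) :
    Ell2.toWEll2 hw C hC x e = x e :=
  coeFn_toLp_weightMeasure hw (memLp_weightMeasure_of_ell2 hw hC x) e

end Weighted

/-! ### The vertex space -/

section Vertex

variable {Em Ep : Type*}

/-- The coordinates of an element of the vertex space. -/
def VertexSpace.coord (b : VertexSpace Em Ep) : Em ⊕ Ep → ℂ :=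
  Sum.elim (fun e => b.fst e) fun e => b.snd e

namespace VertexSpace

lemma coord_add (b c : VertexSpace Em Ep) (e : Em ⊕ Ep) :
    (b + c).coord e = b.coord e + c.coord e := by
  cases e <;> rfl

lemma coord_sub (b c : VertexSpace Em Ep) (e : Em ⊕ Ep) :
    (b - c).coord e = b.coord e - c.coord e := by
  cases e <;> rfl

lemma coord_smul (a : ℂ) (b : VertexSpace Em Ep) (e : Em ⊕ Ep) :
    (a • b).coord e = a * b.coord e := by
  cases e <;> rfl

lemma hasSum_inner (b c : VertexSpace Em Ep) :
    HasSum (fun e => ⟪b.coord e, c.coord e⟫_ℂ) ⟪b, c⟫_ℂ := by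
  rw [WithLp.prod_inner_apply]
  exact HasSum.sum (f := fun e => ⟪b.coord e, c.coord e⟫_ℂ) (lp.hasSum_inner b.fst c.fst)
    (lp.hasSum_inner b.snd c.snd)

lemma hasSum_norm_sq (b : VertexSpace Em Ep) :
    HasSum (fun e => ‖b.coord e‖ ^ 2) (‖b‖ ^ 2) := by
  rw [WithLp.prod_norm_sq_eq_of_L2]
  exact HasSum.sum (f := fun e => ‖b.coord e‖ ^ 2) (StarGraph.hasSum_norm_sq b.fst)
    (StarGraph.hasSum_norm_sq b.snd)

lemma exists_of_summable {b : Em ⊕ Ep → ℂ} (h : Summable fun e => ‖b e‖ ^ 2) :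
    ∃ c : VertexSpace Em Ep, ∀ e, c.coord e = b e := by
  have h1 : Memℓp (fun e => b (.inl e)) 2 :=
    memℓp_two_of_summable (h.comp_injective Sum.inl_injective)
  have h2 : Memℓp (fun e => b (.inr e)) 2 :=
    memℓp_two_of_summable (h.comp_injective Sum.inr_injective)
  exact ⟨WithLp.toLp 2 (⟨_, h1⟩, ⟨_, h2⟩), fun e => by cases e <;> rfl⟩

lemma norm_coord_smul_sq_le {G : ∀ e : Em ⊕ Ep, EdgeL2 e} {C : ℝ} (hG : ∀ e, ‖G e‖ ≤ C)
    (b : VertexSpace Em Ep) (e : Em ⊕ Ep) : ‖b.coord e • G e‖ ^ 2 ≤ C ^ 2 * ‖b.coord e‖ ^ 2 := by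
  rw [norm_smul, mul_pow, mul_comm]
  gcongr
  exact hG e

lemma memℓp_coord_smul {G : ∀ e : Em ⊕ Ep, EdgeL2 e} {C : ℝ} (hG : ∀ e, ‖G e‖ ≤ C)
    (b : VertexSpace Em Ep) : Memℓp (fun e => b.coord e • G e) 2 :=
  memℓp_two_of_summable (Summable.of_nonneg_of_le (fun _ => sq_nonneg _)
    (norm_coord_smul_sq_le hG b) ((hasSum_norm_sq b).summable.mul_left (C ^ 2)))

/-- The linear map underlying `spread`. -/
def spreadLinear (G : ∀ e : Em ⊕ Ep, EdgeL2 e) (C : ℝ) (hG : ∀ e, ‖G e‖ ≤ C) :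
    VertexSpace Em Ep →ₗ[ℂ] L2G Em Ep where
  toFun b := ⟨fun e => b.coord e • G e, memℓp_coord_smul hG b⟩
  map_add' b c := Subtype.ext (funext fun e =>
    (congrArg (· • G e) (coord_add b c e)).trans (add_smul _ _ _))
  map_smul' a b := Subtype.ext (funext fun e =>
    (congrArg (· • G e) (coord_smul a b e)).trans (mul_smul _ _ _))

lemma norm_spreadLinear_le {G : ∀ e : Em ⊕ Ep, EdgeL2 e} {C : ℝ} (hC : 0 ≤ C)
    (hG : ∀ e, ‖G e‖ ≤ C) (b : VertexSpace Em Ep) : ‖spreadLinear G C hG b‖ ≤ C * ‖b‖ := by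
  refine (sq_le_sq₀ (norm_nonneg _) (by positivity)).1 ?_
  rw [mul_pow]
  exact hasSum_le (norm_coord_smul_sq_le hG b) (StarGraph.hasSum_norm_sq (spreadLinear G C hG b))
    ((hasSum_norm_sq b).mul_left (C ^ 2))

/-- The function on the graph that is a multiple of a given function on each edge. -/
def spread (G : ∀ e : Em ⊕ Ep, EdgeL2 e) (C : ℝ) (hC : 0 ≤ C) (hG : ∀ e, ‖G e‖ ≤ C) :
    VertexSpace Em Ep →L[ℂ] L2G Em Ep :=
  (spreadLinear G C hG).mkContinuous C (norm_spreadLinear_le hC hG)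

end VertexSpace

/-- On each edge the squared boundary value is at most `2 ‖u e‖ ‖u' e‖ ≤ ‖u e‖² + ‖u' e‖²`, which is
summable. -/
lemma HasDerivG.exists_boundaryValues {u u' : L2G Em Ep} (h : HasDerivG u u') :
    ∃ b : VertexSpace Em Ep, HasBoundaryValues u b.coord := by
  choose b hb using fun e => (h e).exists_hasTrace
  obtain ⟨c, hc⟩ := VertexSpace.exists_of_summable (b := b) (by
    refine Summable.of_nonneg_of_le (fun i => sq_nonneg _) (fun e => ?_)
      ((hasSum_norm_sq u).summable.add (hasSum_norm_sq u').summable)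
    have h1 := (h e).norm_trace_sq_le (hb e)
    nlinarith [sq_nonneg (‖u e‖ - ‖u' e‖)])
  refine ⟨c, fun e => ?_⟩
  rw [hc]
  exact hb e

lemma HasBoundaryValues.unique {u : L2G Em Ep} {b c : Em ⊕ Ep → ℂ} (hb : HasBoundaryValues u b)
    (hc : HasBoundaryValues u c) : b = c :=
  funext fun e => (hb e).unique (hc e)

lemma HasDerivG.unique {u v w : L2G Em Ep} (hv : HasDerivG u v) (hw : HasDerivG u w) : v = w := by
  have h := hv.add (hw.smul (-1))
  have e1 : u + (-1 : ℂ) • u = 0 := by module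
  rw [e1] at h
  have h2 := h.eq_zero
  rw [neg_one_smul, ← sub_eq_add_neg] at h2
  exact sub_eq_zero.1 h2

end Vertex

/-! ### Exponential sums -/

section ExpSum

variable {Em Ep : Type*}

/-- The `m`-th derivative of the exponential sum `∑ j, c j * exp (k j * t)` on an edge. -/
def expSum (e : Em ⊕ Ep) (c k : Fin 3 → ℂ) (m : ℕ) : EdgeL2 e :=
  (c 0 * k 0 ^ m) • expL2 e (k 0) + (c 1 * k 1 ^ m) • expL2 e (k 1)
    + (c 2 * k 2 ^ m) • expL2 e (k 2)

variable {e : Em ⊕ Ep} {c k : Fin 3 → ℂ}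

lemma hasWeakDeriv_expSum (hk : ∀ j, orientation e * (k j).re < 0) (m : ℕ) :
    HasWeakDeriv (halfLine e) (expSum e c k m) (expSum e c k (m + 1)) := by
  have h := (((hasWeakDeriv_expL2 (hk 0)).smul (c 0 * k 0 ^ m)).add
    ((hasWeakDeriv_expL2 (hk 1)).smul (c 1 * k 1 ^ m))).add
      ((hasWeakDeriv_expL2 (hk 2)).smul (c 2 * k 2 ^ m))
  simp only [smul_smul, mul_assoc, ← pow_succ] at h
  exact h

lemma hasTrace_expSum (hk : ∀ j, orientation e * (k j).re < 0) (m : ℕ) :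
    HasTrace (halfLine e) (expSum e c k m)
      (c 0 * k 0 ^ m + c 1 * k 1 ^ m + c 2 * k 2 ^ m) := by
  have h := (((hasTrace_expL2 (hk 0)).smul (c 0 * k 0 ^ m)).add
    ((hasTrace_expL2 (hk 1)).smul (c 1 * k 1 ^ m))).add
      ((hasTrace_expL2 (hk 2)).smul (c 2 * k 2 ^ m))
  simp only [mul_one] at h
  exact h

lemma norm_expSum_le (hk : ∀ j, orientation e * (k j).re ≤ -1 / 2) {C D : ℝ}
    (hc : ∀ j, ‖c j‖ ≤ C) (hD : ∀ j, ‖k j‖ ≤ D) (m : ℕ) : ‖expSum e c k m‖ ≤ 3 * D ^ m * C := by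
  have hC : 0 ≤ C := (norm_nonneg _).trans (hc 0)
  have hD0 : 0 ≤ D := (norm_nonneg _).trans (hD 0)
  have h : ∀ j, ‖(c j * k j ^ m) • expL2 e (k j)‖ ≤ C * D ^ m * 1 := fun j => by
    rw [norm_smul, norm_mul, norm_pow]
    gcongr
    · exact hc j
    · exact hD j
    · exact norm_expL2_le (hk j)
  refine (norm_add₃_le.trans (add_le_add_three (h 0) (h 1) (h 2))).trans (le_of_eq ?_)
  ring

end ExpSum

/-! ### The Airy operator with separated boundary conditions is dissipative -/

section Airy

variable {Em Ep : Type*} {α β : Em ⊕ Ep → ℝ}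

/-- Green's formula moves one derivative off `u'''`, leaving `Re ⟪u', u''⟫`, which is itself the
boundary term in `b₁`. Similarly `Re ⟪u, u'⟫` is a boundary term in `b₀`; it is the source of `b /
2`. -/
lemma re_inner_airy_edge {e : Em ⊕ Ep} {u u₁ u₂ u₃ w : EdgeL2 e} {b₀ b₁ b₂ : ℂ} {a b : ℝ}
    (h1 : HasWeakDeriv (halfLine e) u u₁) (h2 : HasWeakDeriv (halfLine e) u₁ u₂)
    (h3 : HasWeakDeriv (halfLine e) u₂ u₃) (hw : w = (a : ℂ) • u₃ + (b : ℂ) • u₁)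
    (t0 : HasTrace (halfLine e) u b₀) (t1 : HasTrace (halfLine e) u₁ b₁)
    (t2 : HasTrace (halfLine e) u₂ b₂) :
    (⟪u, w⟫_ℂ).re = -(⟪b₀, (orientation e : ℂ) * (a * b₂ + b / 2 * b₀)⟫_ℂ).re
      + orientation e * (a * ‖b₁‖ ^ 2) / 2 := by
  have g1 := congrArg Complex.re (h1.inner_add_inner h3 t0 t2)
  have g2 := h2.re_inner_self t1
  have g3 := h1.re_inner_self t0
  rw [Complex.add_re, neg_mul, Complex.neg_re, Complex.re_ofReal_mul] at g1
  have e1 : (⟪b₀, (orientation e : ℂ) * (a * b₂ + b / 2 * b₀)⟫_ℂ).re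
      = orientation e * (a * ((starRingEnd ℂ) b₀ * b₂).re + b / 2 * ‖b₀‖ ^ 2) := by
    have : ⟪b₀, (orientation e : ℂ) * (a * b₂ + b / 2 * b₀)⟫_ℂ
        = (orientation e : ℂ) * ((a : ℂ) * ((starRingEnd ℂ) b₀ * b₂)
          + ((b / 2 * ‖b₀‖ ^ 2 : ℝ) : ℂ)) := by
      rw [← Complex.normSq_eq_norm_sq]
      push_cast
      rw [Complex.normSq_eq_conj_mul_self, RCLike.inner_apply]
      ring
    rw [this, Complex.re_ofReal_mul, Complex.add_re, Complex.re_ofReal_mul, Complex.ofReal_re]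
  rw [e1, hw, inner_add_right, inner_smul_right, inner_smul_right, Complex.add_re,
    Complex.re_ofReal_mul, Complex.re_ofReal_mul, g3]
  linear_combination a * g1 - a * g2

variable {Y : Submodule ℂ (VertexSpace Em Ep)}
  {U : WEll2 (fun e : Em => α (.inl e)) →ₗ.[ℂ] WEll2 (fun e : Ep => α (.inr e))}

lemma mem_graph_separatedAiry {p : L2G Em Ep × L2G Em Ep} :
    p ∈ (separatedAiry α β Y U).graph ↔
      p ∈ maximalGraph α β ∧ p.1 ∈ separatedConditions α β Y U := by
  rw [← maximalAiry_graph, LinearPMap.mem_graph_iff, LinearPMap.mem_graph_iff]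
  constructor
  · rintro ⟨y, hy1, hy2⟩
    have hy := y.2
    refine ⟨⟨⟨y, hy.2⟩, hy1, ?_⟩, hy1 ▸ hy.1⟩
    rw [← hy2]
    exact (LinearPMap.domRestrict_apply rfl).symm
  · rintro ⟨⟨y, hy1, hy2⟩, hp⟩
    refine ⟨⟨y, ⟨hy1 ▸ hp, y.2⟩⟩, hy1, ?_⟩
    rw [← hy2]
    exact LinearPMap.domRestrict_apply rfl

/-- Sum the identity on the edges. The terms in `b₀` and `b₂` add up to `-Re ⟪y, z⟫` with `y ∈ Y`,
`z ∈ Yᗮ`, hence to zero; the terms in `b₁`, with their signs, give the two weighted norms. -/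
lemma re_inner_separatedAiry (hα : ∀ e, 0 < α e) {p : L2G Em Ep × L2G Em Ep} {u₁ : L2G Em Ep}
    {b₁ : Em ⊕ Ep → ℂ} (hp : p ∈ (separatedAiry α β Y U).graph) (hu : HasDerivG p.1 u₁)
    (hb : HasBoundaryValues u₁ b₁) :
    ∃ x : U.domain, (∀ e, (x : WEll2 fun e : Em => α (.inl e)) e = b₁ (.inl e)) ∧
      (∀ e, U x e = b₁ (.inr e)) ∧
      (⟪p.1, p.2⟫_ℂ).re = (‖U x‖ ^ 2 - ‖(x : WEll2 fun e : Em => α (.inl e))‖ ^ 2) / 2 := by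
  obtain ⟨⟨v₁, v₂, v₃, h1, h2, h3, hw⟩, w₁, w₂, k1, k2, b₀, c₁, b₂, t0, t1, t2, ⟨y, hy, ya, yb⟩,
    ⟨z, hz, za, zb⟩, x, xa, xb⟩ := mem_graph_separatedAiry.1 hp
  obtain rfl := hu.unique h1
  obtain rfl := hu.unique k1
  obtain rfl := h2.unique k2
  obtain rfl := hb.unique t1
  have xa' := fun e => congrFun (WEll2.coe_eq (fun e => hα _) xa) e
  have xb' := fun e => congrFun (WEll2.coe_eq (fun e => hα _) xb) e
  refine ⟨x, xa', xb', ?_⟩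
  have hyz : ⟪y, z⟫_ℂ = 0 := hz y hy
  have s1 : HasSum (fun e => -(⟪y.coord e, z.coord e⟫_ℂ).re) 0 := by
    have := (Complex.hasSum_re (VertexSpace.hasSum_inner y z)).neg
    rwa [hyz, Complex.zero_re, neg_zero] at this
  have s2 : HasSum (fun e => orientation e * (α e * ‖b₁ e‖ ^ 2))
      (-‖(x : WEll2 fun e : Em => α (.inl e))‖ ^ 2 + ‖U x‖ ^ 2) := by
    refine HasSum.sum (f := fun e => orientation e * (α e * ‖b₁ e‖ ^ 2)) ?_ ?_
    · have := (WEll2.hasSum_norm_sq (fun e => (hα _).le)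
        (x : WEll2 fun e : Em => α (.inl e))).neg
      refine this.congr_fun fun e => ?_
      simp [orientation, xa']
    · refine (WEll2.hasSum_norm_sq (fun e => (hα _).le) (U x)).congr_fun fun e => ?_
      simp [orientation, xb']
  have s3 := s1.add (s2.div_const 2)
  have s4 := Complex.hasSum_re (lp.hasSum_inner (𝕜 := ℂ) p.1 p.2)
  refine (s4.unique (s3.congr_fun fun e => ?_)).trans (by ring)
  rw [re_inner_airy_edge (h1 e) (h2 e) (h3 e) (hw e) (t0 e) (t1 e) (t2 e)]
  congr 4
  · cases e
    · exact (ya _).symm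
    · exact (yb _).symm
  · cases e with
    | inl e => exact (by simp [orientation]; ring : _ = _).trans (za e).symm
    | inr e => exact (by simp [orientation] : _ = _).trans (zb e).symm

lemma dissipative_separatedAiry (hα : ∀ e, 0 < α e) (hU : IsContraction U)
    {p : L2G Em Ep × L2G Em Ep} (hp : p ∈ (separatedAiry α β Y U).graph) :
    (⟪p.1, p.2⟫_ℂ).re ≤ 0 := by
  obtain ⟨-, w₁, w₂, k1, k2, b₀, c₁, b₂, t0, t1, t2, -⟩ := mem_graph_separatedAiry.1 hp
  obtain ⟨x, -, -, h⟩ := re_inner_separatedAiry hα hp k1 t1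
  rw [h]
  have := pow_le_pow_left₀ (norm_nonneg _) (hU x) 2
  linarith

/-! ### Generation implies that `U` is a closed contraction -/

/-- The exponents of the exponential sum used to lift boundary values of the first derivative. -/
def liftExponent (e : Em ⊕ Ep) : Fin 3 → ℂ :=
  ![((-orientation e : ℝ) : ℂ), ((-2 * orientation e : ℝ) : ℂ), ((-3 * orientation e : ℝ) : ℂ)]

/-- The coefficients of the exponential sum used to lift boundary values of the first
derivative. -/
def liftCoeff (e : Em ⊕ Ep) : Fin 3 → ℂ :=
  -- Solution of the Vandermonde system `∑ c = 0`, `∑ c k = 1`, `∑ c k² = 0` for the exponents in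
  -- `liftExponent`.
  ![((5 / 2 * orientation e : ℝ) : ℂ), ((-4 * orientation e : ℝ) : ℂ),
    ((3 / 2 * orientation e : ℝ) : ℂ)]

lemma orientation_mul_self (e : Em ⊕ Ep) : orientation e * orientation e = 1 := by
  rw [← abs_mul_abs_self, abs_orientation, one_mul]

lemma orientation_mul_liftExponent_le (e : Em ⊕ Ep) (j : Fin 3) :
    orientation e * (liftExponent e j).re ≤ -1 / 2 := by
  have := orientation_mul_self e
  fin_cases j <;> simp [liftExponent] <;> linarith

lemma norm_liftExponent_le (e : Em ⊕ Ep) (j : Fin 3) : ‖liftExponent e j‖ ≤ 3 := by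
  have := abs_orientation e
  fin_cases j <;> simp [liftExponent, this]
  norm_num

lemma norm_liftCoeff_le (e : Em ⊕ Ep) (j : Fin 3) : ‖liftCoeff e j‖ ≤ 4 := by
  have := abs_orientation e
  fin_cases j <;> simp [liftCoeff, this] <;> norm_num

/-- An exponential sum on an edge whose derivative is one at the vertex, and which vanishes there
together with its second derivative; the argument `m` is the order of the derivative. -/
def liftProfile (m : ℕ) (e : Em ⊕ Ep) : EdgeL2 e := expSum e (liftCoeff e) (liftExponent e) m

lemma norm_liftProfile_le (m : ℕ) (e : Em ⊕ Ep) : ‖liftProfile m e‖ ≤ 3 * 3 ^ m * 4 :=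
  norm_expSum_le (orientation_mul_liftExponent_le e) (norm_liftCoeff_le e) (norm_liftExponent_le e) m

lemma orientation_mul_liftExponent_neg (e : Em ⊕ Ep) (j : Fin 3) :
    orientation e * (liftExponent e j).re < 0 := by
  linarith [orientation_mul_liftExponent_le e j]

lemma hasTrace_liftProfile {m : ℕ} {a : ℂ} (e : Em ⊕ Ep)
    (h : liftCoeff e 0 * liftExponent e 0 ^ m + liftCoeff e 1 * liftExponent e 1 ^ m
      + liftCoeff e 2 * liftExponent e 2 ^ m = a) :
    HasTrace (halfLine e) (liftProfile m e) a :=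
  h ▸ hasTrace_expSum (orientation_mul_liftExponent_neg e) m

lemma hasTrace_liftProfile_zero (e : Em ⊕ Ep) : HasTrace (halfLine e) (liftProfile 0 e) 0 :=
  hasTrace_liftProfile e (by simp [liftCoeff]; ring)

lemma hasTrace_liftProfile_one (e : Em ⊕ Ep) : HasTrace (halfLine e) (liftProfile 1 e) 1 := by
  have h : (orientation e : ℂ) * orientation e = 1 := by
    exact_mod_cast orientation_mul_self e
  refine hasTrace_liftProfile e ?_
  simp [liftCoeff, liftExponent]
  linear_combination h

lemma hasTrace_liftProfile_two (e : Em ⊕ Ep) : HasTrace (halfLine e) (liftProfile 2 e) 0 :=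
  hasTrace_liftProfile e (by simp [liftCoeff, liftExponent]; ring)

variable (α) in
/-- Boundary values of the first derivative, as an element of the vertex space. -/
def toVertexSpace (hα : ∀ e, 0 < α e) (C : ℝ) (hC : ∀ e, 1 / α e ≤ C) :
    (WEll2 (fun e : Em => α (.inl e)) × WEll2 (fun e : Ep => α (.inr e))) →L[ℂ] VertexSpace Em Ep :=
  (WithLp.prodContinuousLinearEquiv 2 ℂ (Ell2 Em) (Ell2 Ep)).symm.toContinuousLinearMap.comp
    (((WEll2.toEll2 (fun _ => hα _) C (fun _ => hC _)).comp (ContinuousLinearMap.fst ℂ _ _)).prod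
      ((WEll2.toEll2 (fun _ => hα _) C (fun _ => hC _)).comp (ContinuousLinearMap.snd ℂ _ _)))

lemma coord_toVertexSpace (hα : ∀ e, 0 < α e) (C : ℝ) (hC : ∀ e, 1 / α e ≤ C)
    (q : WEll2 (fun e : Em => α (.inl e)) × WEll2 (fun e : Ep => α (.inr e))) (e : Em ⊕ Ep) :
    (toVertexSpace α hα C hC q).coord e = Sum.elim (fun e => q.1 e) (fun e => q.2 e) e := by
  cases e <;> rfl

/-- The graph of `U` is the preimage of that of the Airy operator under a bounded linear map. -/
lemma exists_lift (hα : ∀ e, 0 < α e) {A C B : ℝ} (hA : ∀ e, α e ≤ A) (hC : ∀ e, 1 / α e ≤ C)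
    (hB : ∀ e, |β e| ≤ B) :
    ∃ L : (WEll2 (fun e : Em => α (.inl e)) × WEll2 (fun e : Ep => α (.inr e))) →L[ℂ]
        (L2G Em Ep × L2G Em Ep),
      (∀ q, q ∈ U.graph ↔ L q ∈ (separatedAiry α β Y U).graph) ∧
      ∀ q, ∃ u₁ : L2G Em Ep, HasDerivG (L q).1 u₁ ∧
        HasBoundaryValues u₁ (Sum.elim (fun e => q.1 e) fun e => q.2 e) := by
  let J := toVertexSpace α hα C hC
  let V : ℕ → VertexSpace Em Ep →L[ℂ] L2G Em Ep := fun m =>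
    VertexSpace.spread (liftProfile m) (3 * 3 ^ m * 4) (by positivity) (norm_liftProfile_le m)
  have hG : ∀ e, ‖(α e : ℂ) • liftProfile 3 e + (β e : ℂ) • liftProfile 1 e‖
      ≤ |A| * (3 * 3 ^ 3 * 4) + |B| * (3 * 3 ^ 1 * 4) := fun e => by
    refine norm_add_le_of_le ?_ ?_ <;> rw [norm_smul, Complex.norm_real, Real.norm_eq_abs]
    · rw [abs_of_pos (hα e)]
      exact mul_le_mul ((hA e).trans (le_abs_self A)) (norm_liftProfile_le 3 e) (norm_nonneg _)
        (abs_nonneg A)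
    · exact mul_le_mul ((hB e).trans (le_abs_self B)) (norm_liftProfile_le 1 e) (norm_nonneg _)
        (abs_nonneg B)
  let W := VertexSpace.spread _ _ (by positivity) hG
  have hV : ∀ m b, HasDerivG (V m b) (V (m + 1) b) := fun m b e =>
    (hasWeakDeriv_expSum (orientation_mul_liftExponent_neg e) m).smul (b.coord e)
  have hV0 : ∀ b, HasBoundaryValues (V 0 b) 0 := fun b e => by
    have := (hasTrace_liftProfile_zero e).smul (b.coord e)
    rw [mul_zero] at this
    exact this
  have hV1 : ∀ b, HasBoundaryValues (V 1 b) b.coord := fun b e => by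
    have := (hasTrace_liftProfile_one e).smul (b.coord e)
    rw [mul_one] at this
    exact this
  have hV2 : ∀ b, HasBoundaryValues (V 2 b) 0 := fun b e => by
    have := (hasTrace_liftProfile_two e).smul (b.coord e)
    rw [mul_zero] at this
    exact this
  have hJ : ∀ q, (J q).coord = Sum.elim (fun e => q.1 e) fun e => q.2 e := fun q =>
    funext fun e => coord_toVertexSpace hα C hC q e
  refine ⟨((V 0).prod W).comp J, fun q => ⟨fun hq => ?_, fun hq => ?_⟩,
    fun q => ⟨V 1 (J q), hV 0 (J q), hJ q ▸ hV1 (J q)⟩⟩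
  · obtain ⟨x, hx1, hx2⟩ := (LinearPMap.mem_graph_iff _).1 hq
    -- Value and second derivative of the lift vanish at the vertex, so the conditions on `Y` and
    -- `Yᗮ` hold with zero and only the condition on the slope is left.
    refine mem_graph_separatedAiry.2 ⟨⟨V 1 (J q), V 2 (J q), V 3 (J q), hV 0 _, hV 1 _, hV 2 _,
      fun e => ?_⟩, V 1 (J q), V 2 (J q), hV 0 _, hV 1 _, 0, _, 0, hV0 _, hV1 _, hV2 _,
      ⟨0, Y.zero_mem, by simp, by simp⟩, ⟨0, Submodule.zero_mem _, by simp, by simp⟩, x, ?_, ?_⟩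
    · change (J q).coord e • ((α e : ℂ) • liftProfile 3 e + (β e : ℂ) • liftProfile 1 e)
        = (α e : ℂ) • (J q).coord e • liftProfile 3 e + (β e : ℂ) • (J q).coord e • liftProfile 1 e
      module
    · rw [hJ, hx1]; rfl
    · rw [hJ, hx2]; rfl
  · obtain ⟨-, w₁, w₂, k1, k2, b₀, b₁, b₂, t0, t1, t2, -, -, x, xa, xb⟩ :=
      mem_graph_separatedAiry.1 hq
    obtain rfl := k1.unique (hV 0 (J q))
    obtain rfl := t1.unique (hV1 (J q))
    rw [hJ] at xa xb
    refine (LinearPMap.mem_graph_iff _).2 ⟨x, Lp.ext xa, Lp.ext xb⟩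

lemma isContraction_of_generates (hα : ∀ e, 0 < α e) {A C B : ℝ} (hA : ∀ e, α e ≤ A)
    (hC : ∀ e, 1 / α e ≤ C) (hB : ∀ e, |β e| ≤ B)
    (h : GeneratesContractionSemigroup (separatedAiry α β Y U)) : U.IsClosed ∧ IsContraction U := by
  obtain ⟨L, hL, hLb⟩ := exists_lift (Y := Y) (U := U) hα hA hC hB
  constructor
  · have e : (U.graph : Set _) = L ⁻¹' (separatedAiry α β Y U).graph := Set.ext fun q => hL q
    unfold LinearPMap.IsClosed
    rw [e]
    exact IsClosed.preimage L.continuous h.isClosed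
  · intro x
    have hq := (hL _).1 (U.mem_graph x)
    obtain ⟨u₁, h1, h2⟩ := hLb (x, U x)
    obtain ⟨x', ha, -, hx'⟩ := re_inner_separatedAiry hα hq h1 h2
    have hxx : x' = x := Subtype.ext (WEll2.ext ha)
    rw [hxx] at hx'
    have := h.dissipative hq
    rw [hx'] at this
    exact (sq_le_sq₀ (norm_nonneg _) (norm_nonneg _)).1 (by linarith)

end Airy

/-! ### A coercive boundary system -/

section BoundarySystem

variable {H K : Type*} [NormedAddCommGroup H] [InnerProductSpace ℂ H] [CompleteSpace H]
  [NormedAddCommGroup K] [InnerProductSpace ℂ K] [CompleteSpace K]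

/-- Lax–Milgram on `Y ⊕ K`. Projecting the first equation onto `Y` encodes membership in `Yᗮ`, and
the projection is invisible in the quadratic form because `ξ ∈ Y`. -/
lemma exists_solution_of_coercive {Y : Submodule ℂ H} (hY : IsClosed (Y : Set H))
    (Z : H →L[ℂ] H) (Z' : K →L[ℂ] H) (R : H →L[ℂ] K) {c : ℝ} (hc : 0 < c)
    (h : ∀ ξ y, c * (‖ξ‖ ^ 2 + ‖y‖ ^ 2) ≤ (⟪ξ, Z ξ + Z' y⟫_ℂ).re + (⟪y, y - R ξ⟫_ℂ).re)
    (g : H) (k : K) : ∃ ξ ∈ Y, ∃ y, Z ξ + Z' y - g ∈ Yᗮ ∧ y - R ξ = k := by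
  have : CompleteSpace Y := hY.completeSpace_coe
  let V := WithLp 2 (Y × K)
  let eV : V ≃L[ℂ] (Y × K) := WithLp.prodContinuousLinearEquiv 2 ℂ Y K
  let p₁ : V →L[ℂ] H := Y.subtypeL.comp ((ContinuousLinearMap.fst ℂ Y K).comp eV.toContinuousLinearMap)
  let p₂ : V →L[ℂ] K := (ContinuousLinearMap.snd ℂ Y K).comp eV.toContinuousLinearMap
  let T : V →L[ℂ] V := eV.symm.toContinuousLinearMap.comp
    ((Y.orthogonalProjectionOnto.comp (Z.comp p₁ + Z'.comp p₂)).prod (p₂ - R.comp p₁))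
  have hT1 : ∀ v, (T v).fst = Y.orthogonalProjectionOnto (Z v.fst + Z' v.snd) := fun v => rfl
  have hT2 : ∀ v, (T v).snd = v.snd - R v.fst := fun v => rfl
  obtain ⟨v, hv⟩ := exists_apply_eq_of_coercive T hc (fun v => by
    rw [WithLp.prod_norm_sq_eq_of_L2, WithLp.prod_inner_apply, Complex.add_re]
    change c * (‖v.fst‖ ^ 2 + ‖v.snd‖ ^ 2) ≤ (⟪v.fst, (T v).fst⟫_ℂ).re + (⟪v.snd, (T v).snd⟫_ℂ).re
    rw [hT1, hT2, Submodule.inner_orthogonalProjectionOnto_eq_of_mem_left]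
    exact h v.fst v.snd) (WithLp.toLp 2 (Y.orthogonalProjectionOnto g, k))
  refine ⟨v.fst, v.fst.2, v.snd, ?_, ?_⟩
  · rw [← Submodule.orthogonalProjectionOnto_eq_zero_iff, map_sub, ← hT1, hv]
    exact sub_self _
  · rw [← hT2, hv]
    rfl

end BoundarySystem

/-! ### The characteristic polynomial -/

/-- `p` is the positive root of `a z ^ 3 + b z = l`, and `-p / 2 ± i θ` are the other roots. -/
structure CharacteristicRoots (a b l p θ : ℝ) : Prop where
  one_le : 1 ≤ p
  half_le : 1 / 2 ≤ θ
  root : a * p ^ 3 + b * p = l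
  sq : a * θ ^ 2 = 3 * a * p ^ 2 / 4 + b
  abs_le : |b| ≤ a * p ^ 2 / 4

/-- The threshold `N` and the bound `D` must serve all edges at once, so they depend on the
coefficients only through `A`, `C`, `B`. -/
lemma exists_characteristicRoots (A C B : ℝ) : ∃ N : ℝ, ∀ l ≥ N, ∃ D : ℝ, ∀ a b : ℝ, 0 < a →
    a ≤ A → 1 / a ≤ C → |b| ≤ B → ∃ p θ, CharacteristicRoots a b l p θ ∧ p ≤ D ∧ θ ≤ D := by
  -- For `p ≥ P` one has `p² ≥ 4 |B| |C|`, and `|C| a ≥ 1` turns this into `|b| ≤ a p² / 4`.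
  set P := 1 + 4 * (|B| * |C|) with hP
  have hP1 : 1 ≤ P := by
    have : 0 ≤ |B| * |C| := by positivity
    linarith
  refine ⟨|A| * P ^ 3 + |B| * P, fun l hl => ⟨(l + |B|) * |C|, fun a b ha haA haC hb => ?_⟩⟩
  have hB : |b| ≤ |B| := hb.trans (le_abs_self B)
  have hA : a ≤ |A| := haA.trans (le_abs_self A)
  have hC : 1 / a ≤ |C| := haC.trans (le_abs_self C)
  have hC' : 1 ≤ |C| * a := (div_le_iff₀ ha).1 hC
  obtain ⟨hb1, hb2⟩ := abs_le.1 hB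
  have hl0 : 0 ≤ l := le_trans (by positivity) hl
  -- At `M` the cubic exceeds `l` because `a M ≥ l + |B|` and `M ≥ 1`; at `P` it is at most `N`. The
  -- intermediate value theorem gives the root.
  set M := P + (l + |B|) / a with hM
  have hPM : P ≤ M := le_add_of_nonneg_right (by positivity)
  have hM1 : 1 ≤ M := hP1.trans hPM
  have haM : l + |B| ≤ a * M := by
    rw [hM, mul_add, mul_div_cancel₀ _ ha.ne']
    nlinarith
  have hcont : ContinuousOn (fun z : ℝ => a * z ^ 3 + b * z) (Set.Icc P M) := by fun_prop
  obtain ⟨p, ⟨hpP, -⟩, hp⟩ := intermediate_value_Icc hPM hcont (show l ∈ Set.Icc _ _ from ⟨by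
    refine le_trans (add_le_add ?_ ?_) hl
    · gcongr
    · gcongr, by
    have h1 : l ≤ a * M ^ 2 - |B| := by nlinarith
    have h2 : 0 ≤ M * (a * M ^ 2 - |B| - l) + (M - 1) * l :=
      add_nonneg (mul_nonneg (by linarith) (by linarith)) (mul_nonneg (by linarith) hl0)
    nlinarith⟩)
  simp only at hp
  have hp1 : 1 ≤ p := hP1.trans hpP
  have hbp : |b| ≤ a * p ^ 2 / 4 := by
    have h1 : 4 * (|B| * |C|) ≤ p ^ 2 := by nlinarith
    have h2 : |B| ≤ |B| * (|C| * a) := le_mul_of_one_le_right (abs_nonneg B) hC'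
    nlinarith
  obtain ⟨hb3, hb4⟩ := abs_le.1 hbp
  -- From `a p³ = l - b p ≤ (l + |B|) p²` one gets `a p ≤ l + |B|`.
  have hpD : p ≤ (l + |B|) * |C| := by
    have h1 : a * p ≤ l + |B| := by
      have h2 : (a * p) * p ^ 2 ≤ (l + |B|) * p ^ 2 := by
        have h3 : 0 ≤ (b + |B|) * p := mul_nonneg (by linarith) (by linarith)
        have h4 : 0 ≤ (p ^ 2 - 1) * l := mul_nonneg (by nlinarith) hl0
        have h5 : 0 ≤ |B| * (p * (p - 1)) :=
          mul_nonneg (abs_nonneg B) (mul_nonneg (by linarith) (by linarith))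
        linarith
      exact le_of_mul_le_mul_right h2 (by positivity)
    calc p ≤ p * (|C| * a) := le_mul_of_one_le_right (by linarith) hC'
      _ = (a * p) * |C| := by ring
      _ ≤ _ := by gcongr
  have hq : 0 ≤ 3 * p ^ 2 / 4 + b / a := by
    have : -(p ^ 2 / 4) ≤ b / a := by rw [le_div_iff₀ ha]; linarith
    nlinarith
  have hθ : √(3 * p ^ 2 / 4 + b / a) ^ 2 = 3 * p ^ 2 / 4 + b / a := Real.sq_sqrt hq
  have hθs : a * √(3 * p ^ 2 / 4 + b / a) ^ 2 = 3 * a * p ^ 2 / 4 + b := by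
    rw [hθ]; field_simp
  refine ⟨p, √(3 * p ^ 2 / 4 + b / a), ⟨hp1, ?_, hp, hθs, hbp⟩, hpD, ?_⟩
  · refine Real.le_sqrt_of_sq_le ?_
    have : -(p ^ 2 / 4) ≤ b / a := by rw [le_div_iff₀ ha]; linarith
    nlinarith
  · refine le_trans (Real.sqrt_le_iff.2 ⟨by linarith, ?_⟩) hpD
    have : b / a ≤ p ^ 2 / 4 := by rw [div_le_iff₀ ha]; linarith
    linarith

namespace CharacteristicRoots

variable {a b l p θ : ℝ}

lemma root_complex (h : CharacteristicRoots a b l p θ) : (a : ℂ) * p ^ 3 + b * p = l := by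
  exact_mod_cast h.root

/-- The quotient of `a z³ + b z - l` by `z - p`, evaluated at its roots; `s = ±1` covers both. -/
lemma quadratic (h : CharacteristicRoots a b l p θ) {s : ℂ} (hs : s ^ 2 = 1) :
    (a : ℂ) * (-(p / 2) + s * (θ * Complex.I)) ^ 2 + a * p * (-(p / 2) + s * (θ * Complex.I))
      + (a * p ^ 2 + b) = 0 := by
  have h1 : (a : ℂ) * θ ^ 2 = 3 * a * p ^ 2 / 4 + b := by exact_mod_cast h.sq
  linear_combination (a : ℂ) * θ ^ 2 * Complex.I ^ 2 * hs + (a : ℂ) * θ ^ 2 * Complex.I_sq - h1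

lemma root_of_quadratic (h : CharacteristicRoots a b l p θ) {k : ℂ}
    (hk : (a : ℂ) * k ^ 2 + a * p * k + (a * p ^ 2 + b) = 0) : (a : ℂ) * k ^ 3 + b * k = l := by
  linear_combination (k - p) * hk + h.root_complex

end CharacteristicRoots

/-! ### The resolvent equation on a single edge -/

section Edge

variable {Em Ep : Type*}

variable (Em Ep) in
/-- The resolvent equation on an edge, without boundary conditions. -/
lemma exists_edge_resolvent (D C : ℝ) : ∃ M : ℝ, ∀ (e : Em ⊕ Ep) (a b l p θ : ℝ), 0 < a → 1 / a ≤ C →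
    CharacteristicRoots a b l p θ → p ≤ D → θ ≤ D → ∀ f : EdgeL2 e,
    ∃ v v₁ v₂ v₃ : EdgeL2 e, HasWeakDeriv (halfLine e) v v₁ ∧ HasWeakDeriv (halfLine e) v₁ v₂ ∧
      HasWeakDeriv (halfLine e) v₂ v₃ ∧ (l : ℂ) • v - ((a : ℂ) • v₃ + (b : ℂ) • v₁) = f ∧
      ‖v‖ ≤ M * ‖f‖ ∧ ‖v₁‖ ≤ M * ‖f‖ ∧ ‖v₂‖ ≤ M * ‖f‖ ∧ ‖v₃‖ ≤ M * ‖f‖ := by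
  -- `d` bounds the roots, `m₁, m₂, m₃` bound the solutions of the three successive first order
  -- equations, and `n₁, n₂, n₃` the derivatives of the last one. Each factor 2 comes from `|Re k| =
  -- p/2 ≥ 1/2`.
  set d := 2 * |D| with hd
  set m₁ := |C|
  set m₂ := 2 * m₁
  set m₃ := 2 * m₂
  set n₁ := d * m₃ + m₂
  set n₂ := d * n₁ + (d * m₂ + m₁)
  set n₃ := d * n₂ + (d * (d * m₂ + m₁) + (d * m₁ + m₁))
  have hd0 : 0 ≤ d := by positivity
  have hm₁ : 0 ≤ m₁ := abs_nonneg C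
  have hm₂ : 0 ≤ m₂ := by positivity
  have hm₃ : 0 ≤ m₃ := by positivity
  have hn₁ : 0 ≤ n₁ := by positivity
  have hn₂ : 0 ≤ n₂ := by positivity
  have hn₃ : 0 ≤ n₃ := by positivity
  refine ⟨m₃ + n₁ + n₂ + n₃, fun e a b l p θ ha haC hr hpD hθD f => ?_⟩
  have hp1 := hr.one_le
  have hθ1 := hr.half_le
  have hD : D ≤ |D| := le_abs_self D
  -- The equation reads `(∂ - k₁)(∂ - k₂)(∂ - k₃) v = -f / a` and is solved one factor at a time.
  let k₁ : ℂ := p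
  let k₂ : ℂ := -(p / 2) + 1 * (θ * Complex.I)
  let k₃ : ℂ := -(p / 2) + -1 * (θ * Complex.I)
  have q3 := hr.quadratic (s := -1) (by norm_num)
  have r3 := hr.root_of_quadratic q3
  have re2 : k₂.re = -(p / 2) := by simp [k₂]
  have re3 : k₃.re = -(p / 2) := by simp [k₃]
  have nk1 : ‖k₁‖ ≤ d := by
    simp only [k₁, Complex.norm_real, Real.norm_eq_abs]
    rw [abs_of_pos (by linarith)]; linarith
  have nk2 : ‖k₂‖ ≤ d := by
    refine (Complex.norm_le_abs_re_add_abs_im _).trans ?_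
    have : k₂.im = θ := by simp [k₂]
    rw [re2, this, abs_neg, abs_of_pos (by linarith), abs_of_pos (by linarith)]; linarith
  have nk3 : ‖k₃‖ ≤ d := by
    refine (Complex.norm_le_abs_re_add_abs_im _).trans ?_
    have : k₃.im = -θ := by simp [k₃]
    rw [re3, this, abs_neg, abs_neg, abs_of_pos (by linarith), abs_of_pos (by linarith)]; linarith
  have half : ∀ k : ℂ, k.re = -(p / 2) → 1 / 2 ≤ |k.re| := fun k hk => by
    rw [hk, abs_neg, abs_of_pos (by linarith)]; linarith
  let g : EdgeL2 e := (-(1 / a : ℝ) : ℂ) • f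
  have hg : ‖g‖ ≤ m₁ * ‖f‖ := by
    rw [norm_smul, norm_neg, Complex.norm_real, Real.norm_of_nonneg (by positivity)]
    gcongr
    exact haC.trans (le_abs_self C)
  obtain ⟨w₁, hw₁, bw₁⟩ := exists_hasWeakDeriv_smul_add (e := e) (k := k₁)
    (by simp [k₁]; linarith) g
  obtain ⟨w₂, hw₂, bw₂⟩ := exists_hasWeakDeriv_smul_add (e := e) (k := k₂)
    (by rw [re2]; linarith) w₁
  obtain ⟨v, hv, bv⟩ := exists_hasWeakDeriv_smul_add (e := e) (k := k₃)
    (by rw [re3]; linarith) w₂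
  have hw₁n : ‖w₁‖ ≤ m₁ * ‖f‖ := by
    have : 1 ≤ |k₁.re| := by simp only [k₁, Complex.ofReal_re]; exact hp1.trans (le_abs_self p)
    nlinarith [norm_nonneg w₁]
  have hw₂n : ‖w₂‖ ≤ m₂ * ‖f‖ := by
    have := half k₂ re2
    have e1 : m₂ * ‖f‖ = 2 * (m₁ * ‖f‖) := by simp only [m₂]; ring
    nlinarith [norm_nonneg w₂]
  have hvn : ‖v‖ ≤ m₃ * ‖f‖ := by
    have := half k₃ re3
    have e1 : m₃ * ‖f‖ = 2 * (m₂ * ‖f‖) := by simp only [m₃]; ring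
    nlinarith [norm_nonneg v]
  let v₁ : EdgeL2 e := k₃ • v + w₂
  let x₂ : EdgeL2 e := k₂ • w₂ + w₁
  let v₂ : EdgeL2 e := k₃ • v₁ + x₂
  let v₃ : EdgeL2 e := k₃ • v₂ + (k₂ • x₂ + (k₁ • w₁ + g))
  have hv₂ : HasWeakDeriv (halfLine e) v₁ v₂ := (hv.smul k₃).add hw₂
  have hv₃ : HasWeakDeriv (halfLine e) v₂ v₃ := (hv₂.smul k₃).add ((hw₂.smul k₂).add hw₁)
  have nf := norm_nonneg f
  have step : ∀ (k : ℂ) (x y : EdgeL2 e) (s t : ℝ), ‖k‖ ≤ d → ‖x‖ ≤ s * ‖f‖ → ‖y‖ ≤ t * ‖f‖ →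
      ‖k • x + y‖ ≤ (d * s + t) * ‖f‖ := fun k x y s t hk hx hy => by
    refine (norm_add_le_of_le ((norm_smul_le k x).trans
      (mul_le_mul hk hx (norm_nonneg _) hd0)) hy).trans (le_of_eq ?_)
    ring
  have hv₁n : ‖v₁‖ ≤ n₁ * ‖f‖ := step k₃ v w₂ _ _ nk3 hvn hw₂n
  have hx₂n : ‖x₂‖ ≤ (d * m₂ + m₁) * ‖f‖ := step k₂ w₂ w₁ _ _ nk2 hw₂n hw₁n
  have hv₂n : ‖v₂‖ ≤ n₂ * ‖f‖ := step k₃ v₁ x₂ _ _ nk3 hv₁n hx₂n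
  have hv₃n : ‖v₃‖ ≤ n₃ * ‖f‖ :=
    step k₃ v₂ _ _ _ nk3 hv₂n (step k₂ x₂ _ _ _ nk2 hx₂n (step k₁ w₁ g _ _ nk1 hw₁n hg))
  refine ⟨v, v₁, v₂, v₃, hv, hv₂, hv₃, ?_, ?_, ?_, ?_, ?_⟩
  -- The coefficients of `v`, `w₂`, `w₁` are divided differences of the characteristic polynomial at
  -- its roots, so they vanish.
  · have e1 : (l : ℂ) • v - ((a : ℂ) • v₃ + (b : ℂ) • v₁)
        = (l - (a * k₃ ^ 3 + b * k₃)) • v - (a * (k₃ ^ 2 + k₃ * k₂ + k₂ ^ 2) + b) • w₂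
          - (a * (k₁ + k₂ + k₃)) • w₁ - (a : ℂ) • g := by
      simp only [v₃, v₂, v₁, x₂]; module
    have c1 : (a : ℂ) * (k₃ ^ 2 + k₃ * k₂ + k₂ ^ 2) + b = 0 := by
      have : k₂ = -p - k₃ := by simp only [k₂, k₃]; ring
      rw [this]
      linear_combination q3
    have c2 : (a : ℂ) * (k₁ + k₂ + k₃) = 0 := by simp only [k₁, k₂, k₃]; ring
    have c3 : (a : ℂ) • g = -f := by
      have ha' : (a : ℂ) ≠ 0 := by exact_mod_cast ha.ne'
      simp only [g, smul_smul]
      rw [show (a : ℂ) * -((1 / a : ℝ) : ℂ) = -1 by push_cast; field_simp]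
      simp
    rw [e1, r3, c1, c2, c3]
    simp
  · exact hvn.trans (by gcongr; linarith)
  · exact hv₁n.trans (by gcongr; linarith)
  · exact hv₂n.trans (by gcongr; linarith)
  · exact hv₃n.trans (by gcongr; linarith)

lemma characteristic_expSum {e : Em ⊕ Ep} {a b l : ℝ} {c k : Fin 3 → ℂ}
    (hk : ∀ j, (a : ℂ) * k j ^ 3 + b * k j = l) :
    (l : ℂ) • expSum e c k 0 - ((a : ℂ) • expSum e c k 3 + (b : ℂ) • expSum e c k 1) = 0 := by
  have e1 : (l : ℂ) • expSum e c k 0 - ((a : ℂ) • expSum e c k 3 + (b : ℂ) • expSum e c k 1)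
      = (c 0 * (l - (a * k 0 ^ 3 + b * k 0))) • expL2 e (k 0)
        + (c 1 * (l - (a * k 1 ^ 3 + b * k 1))) • expL2 e (k 1)
        + (c 2 * (l - (a * k 2 ^ 3 + b * k 2))) • expL2 e (k 2) := by
    simp only [expSum]; module
  rw [e1]
  simp [hk]

variable (Em Ep) in
/-- Solutions of the homogeneous resolvent equation with prescribed Dirichlet data on an edge, and
with prescribed first derivative at the vertex if the edge is outgoing. -/
lemma exists_edge_kernel (D : ℝ) : ∃ M : ℝ, ∀ (e : Em ⊕ Ep) (a b l p θ : ℝ),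
    CharacteristicRoots a b l p θ → p ≤ D → θ ≤ D → ∀ x y : ℂ,
    ∃ h h₁ h₂ h₃ : EdgeL2 e, HasWeakDeriv (halfLine e) h h₁ ∧ HasWeakDeriv (halfLine e) h₁ h₂ ∧
      HasWeakDeriv (halfLine e) h₂ h₃ ∧ (l : ℂ) • h - ((a : ℂ) • h₃ + (b : ℂ) • h₁) = 0 ∧
      HasTrace (halfLine e) h x ∧
      HasTrace (halfLine e) h₁ (Sum.elim (fun _ => (p : ℂ) * x) (fun _ => y) e) ∧
      (∃ z, HasTrace (halfLine e) h₂ z ∧ (orientation e : ℂ) * (a * z + b / 2 * x) =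
        -((a * p ^ 2 + b / 2) * x + Sum.elim (fun _ => (0 : ℂ)) (fun _ => (a : ℂ) * p * y) e)) ∧
      (‖h‖ ≤ M * (‖x‖ + ‖y‖) ∧ ‖h₁‖ ≤ M * (‖x‖ + ‖y‖) ∧ ‖h₂‖ ≤ M * (‖x‖ + ‖y‖) ∧
        ‖h₃‖ ≤ M * (‖x‖ + ‖y‖)) := by
  set d := 2 * |D| + 1 with hd
  have hd1 : 1 ≤ d := by
    have : 0 ≤ |D| := abs_nonneg D
    linarith
  refine ⟨3 * d ^ 3 * d, fun e a b l p θ hr hpD hθD x y => ?_⟩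
  have hp1 := hr.one_le
  have hθ1 := hr.half_le
  have hD : D ≤ |D| := le_abs_self D
  suffices H : ∃ c k : Fin 3 → ℂ, (∀ j, orientation e * (k j).re ≤ -1 / 2) ∧
      (∀ j, ‖c j‖ ≤ d * (‖x‖ + ‖y‖)) ∧ (∀ j, ‖k j‖ ≤ d) ∧
      (∀ j, (a : ℂ) * k j ^ 3 + b * k j = l) ∧
      c 0 * k 0 ^ 0 + c 1 * k 1 ^ 0 + c 2 * k 2 ^ 0 = x ∧
      c 0 * k 0 ^ 1 + c 1 * k 1 ^ 1 + c 2 * k 2 ^ 1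
        = Sum.elim (fun _ => (p : ℂ) * x) (fun _ => y) e ∧
      (orientation e : ℂ) * (a * (c 0 * k 0 ^ 2 + c 1 * k 1 ^ 2 + c 2 * k 2 ^ 2) + b / 2 * x) =
        -((a * p ^ 2 + b / 2) * x + Sum.elim (fun _ => (0 : ℂ)) (fun _ => (a : ℂ) * p * y) e) by
    obtain ⟨c, k, hk, hc, hkd, hl, t0, t1, t2⟩ := H
    have hk' : ∀ j, orientation e * (k j).re < 0 := fun j => by linarith [hk j]
    have hn : ∀ m ≤ 3, ‖expSum e c k m‖ ≤ 3 * d ^ 3 * d * (‖x‖ + ‖y‖) := fun m hm => by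
      refine (norm_expSum_le hk hc hkd m).trans ?_
      rw [mul_assoc _ d]
      gcongr
    exact ⟨expSum e c k 0, expSum e c k 1, expSum e c k 2, expSum e c k 3,
      hasWeakDeriv_expSum hk' 0, hasWeakDeriv_expSum hk' 1, hasWeakDeriv_expSum hk' 2,
      characteristic_expSum hl, t0 ▸ hasTrace_expSum hk' 0, t1 ▸ hasTrace_expSum hk' 1,
      ⟨_, hasTrace_expSum hk' 2, t2⟩, hn 0 (by norm_num), hn 1 (by norm_num), hn 2 (by norm_num),
      hn 3 le_rfl⟩
  have nx := norm_nonneg x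
  have ny := norm_nonneg y
  cases e with
  | inl e =>
    -- On an incoming edge only `exp(p t)` decays, so the value fixes the slope `p x`. The two idle
    -- exponentials get coefficient zero and an admissible exponent.
    refine ⟨![x, 0, 0], fun _ => p, fun j => ?_, fun j => ?_, fun j => ?_, fun j => ?_, ?_, ?_, ?_⟩
    · simp [orientation]; linarith
    · have h1 : 0 ≤ d * (‖x‖ + ‖y‖) := by positivity
      have h2 : ‖x‖ ≤ d * (‖x‖ + ‖y‖) := by nlinarith
      fin_cases j <;> simp [h1, h2]
    · rw [Complex.norm_real, Real.norm_of_nonneg (by linarith)]; linarith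
    · exact hr.root_complex
    · simp
    · simp [mul_comm]
    · simp [orientation]; ring
  | inr e =>
    let k₂ : ℂ := -(p / 2) + 1 * (θ * Complex.I)
    let k₃ : ℂ := -(p / 2) + -1 * (θ * Complex.I)
    have q2 := hr.quadratic (s := 1) (by norm_num)
    have q3 := hr.quadratic (s := -1) (by norm_num)
    have re2 : k₂.re = -(p / 2) := by simp [k₂]
    have re3 : k₃.re = -(p / 2) := by simp [k₃]
    have nk2 : ‖k₂‖ ≤ 2 * |D| := by
      refine (Complex.norm_le_abs_re_add_abs_im _).trans ?_
      have : k₂.im = θ := by simp [k₂]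
      rw [re2, this, abs_neg, abs_of_pos (by linarith), abs_of_pos (by linarith)]; linarith
    have nk3 : ‖k₃‖ ≤ 2 * |D| := by
      refine (Complex.norm_le_abs_re_add_abs_im _).trans ?_
      have : k₃.im = -θ := by simp [k₃]
      rw [re3, this, abs_neg, abs_neg, abs_of_pos (by linarith), abs_of_pos (by linarith)]
      linarith
    have hθ' : (θ : ℂ) ≠ 0 := by
      have : θ ≠ 0 := by linarith
      exact_mod_cast this
    have hdiff : k₂ - k₃ = 2 * θ * Complex.I := by simp only [k₂, k₃]; ring
    have hdiff0 : k₂ - k₃ ≠ 0 := by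
      rw [hdiff]
      exact mul_ne_zero (mul_ne_zero two_ne_zero hθ') Complex.I_ne_zero
    have hsum : k₂ + k₃ = -p := by simp only [k₂, k₃]; ring
    have ndiff : 1 ≤ ‖k₂ - k₃‖ := by
      rw [hdiff, norm_mul, norm_mul, Complex.norm_I, Complex.norm_real,
        Real.norm_of_nonneg (by linarith), Complex.norm_ofNat]
      linarith
    have hc : ∀ k : ℂ, ‖k‖ ≤ 2 * |D| → ‖(y - k * x) / (k₂ - k₃)‖ ≤ d * (‖x‖ + ‖y‖) := fun k hk => by
      rw [norm_div]
      refine (div_le_self (norm_nonneg _) ndiff).trans ((norm_sub_le _ _).trans ?_)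
      rw [norm_mul]
      have h1 : ‖k‖ * ‖x‖ ≤ 2 * |D| * ‖x‖ := by gcongr
      have h2 : 0 ≤ 2 * |D| * ‖y‖ := by positivity
      rw [hd]
      nlinarith
    -- Both `k₂` and `k₃` decay on an outgoing edge, so value and slope are free; these coefficients
    -- interpolate them. The lower bound on `θ` keeps the denominator at least 1 in norm.
    refine ⟨![(y - k₃ * x) / (k₂ - k₃), -((y - k₂ * x) / (k₂ - k₃)), 0], ![k₂, k₃, k₂],
      fun j => ?_, fun j => ?_, fun j => ?_, fun j => ?_, ?_, ?_, ?_⟩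
    · fin_cases j
      · change (1 : ℝ) * k₂.re ≤ _; rw [re2]; linarith
      · change (1 : ℝ) * k₃.re ≤ _; rw [re3]; linarith
      · change (1 : ℝ) * k₂.re ≤ _; rw [re2]; linarith
    · fin_cases j
      · exact hc k₃ nk3
      · exact (norm_neg _).trans_le (hc k₂ nk2)
      · change ‖(0 : ℂ)‖ ≤ _
        rw [norm_zero]; positivity
    · fin_cases j
      · exact nk2.trans (by linarith)
      · exact nk3.trans (by linarith)
      · exact nk2.trans (by linarith)
    · fin_cases j
      · exact hr.root_of_quadratic q2
      · exact hr.root_of_quadratic q3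
      · exact hr.root_of_quadratic q2
    · change (y - k₃ * x) / (k₂ - k₃) * k₂ ^ 0 + -((y - k₂ * x) / (k₂ - k₃)) * k₃ ^ 0 + 0 * k₂ ^ 0 = x
      field_simp
      ring
    · change (y - k₃ * x) / (k₂ - k₃) * k₂ ^ 1 + -((y - k₂ * x) / (k₂ - k₃)) * k₃ ^ 1 + 0 * k₂ ^ 1 = y
      field_simp
      ring
    · have e1 : (y - k₃ * x) / (k₂ - k₃) * k₂ ^ 2 + -((y - k₂ * x) / (k₂ - k₃)) * k₃ ^ 2
          + 0 * k₂ ^ 2 = y * (k₂ + k₃) - k₂ * k₃ * x := by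
        field_simp
        ring
      change ((1 : ℝ) : ℂ) * (a * ((y - k₃ * x) / (k₂ - k₃) * k₂ ^ 2
        + -((y - k₂ * x) / (k₂ - k₃)) * k₃ ^ 2 + 0 * k₂ ^ 2) + b / 2 * x)
          = -((a * p ^ 2 + b / 2) * x + a * p * y)
      have e2 : (a : ℂ) * (k₂ * k₃) = a * p ^ 2 + b := by
        have : k₃ = -p - k₂ := by rw [← hsum]; ring
        rw [this]
        linear_combination -q2
      rw [e1, hsum, Complex.ofReal_one]
      linear_combination -x * e2

end Edge

/-! ### Densely defined contractions -/

section DenselyDefined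

variable {X Z : Type*} [NormedAddCommGroup X] [InnerProductSpace ℂ X]
  [NormedAddCommGroup Z] [InnerProductSpace ℂ Z]

/-- The bound `|⟪U† y, x⟫| = |⟪y, U x⟫| ≤ ‖y‖ ‖x‖` extends from the dense domain to all `x`; then
put `x = U† y`. -/
lemma IsContraction.adjoint [CompleteSpace X] {U : X →ₗ.[ℂ] Z}
    (hd : Dense (U.domain : Set X)) (hU : IsContraction U) : IsContraction U† := by
  intro y
  have h : ∀ x, ‖⟪U† y, x⟫_ℂ‖ ≤ ‖(y : Z)‖ * ‖x‖ := fun x => by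
    refine hd.induction (P := fun x => ‖⟪U† y, x⟫_ℂ‖ ≤ ‖(y : Z)‖ * ‖x‖) (fun x hx => ?_)
      (isClosed_le (by fun_prop) (by fun_prop)) x
    rw [LinearPMap.adjoint_isFormalAdjoint hd y ⟨x, hx⟩]
    exact (norm_inner_le_norm _ _).trans
      (mul_le_mul_of_nonneg_left (hU ⟨x, hx⟩) (norm_nonneg _))
  have h1 := h (U† y)
  rw [inner_self_eq_norm_sq_to_K, norm_pow, RCLike.norm_ofReal, abs_norm] at h1
  rcases (norm_nonneg (U† y)).eq_or_lt with h0 | h0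
  · rw [← h0]; exact norm_nonneg _
  · exact le_of_mul_le_mul_right ((sq _).symm.trans_le h1) h0

/-- For the continuous extension `L`, the `x` with `(x, L x)` in the closed graph form a closed set
containing the dense domain, so `U` is everywhere defined. -/
lemma IsContraction.exists_continuousLinearMap [CompleteSpace Z] {U : X →ₗ.[ℂ] Z}
    (hd : Dense (U.domain : Set X)) (hc : U.IsClosed) (hU : IsContraction U) :
    ∃ L : X →L[ℂ] Z, (∀ x, ‖L x‖ ≤ ‖x‖) ∧ ∀ x, ∃ h : x ∈ U.domain, U ⟨x, h⟩ = L x := by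
  let L₀ : U.domain →L[ℂ] Z := U.toFun.mkContinuous 1 fun x => by simpa using hU x
  let L : X →L[ℂ] Z := L₀.extend U.domain.subtypeL
  have hL : ∀ x : U.domain, L x = U x := fun x =>
    ContinuousLinearMap.extend_eq L₀ (hd.denseRange_val) (isUniformInducing_val _) x
  have hg : ∀ x, (x, L x) ∈ U.graph := fun x =>
    hd.induction (P := fun x => (x, L x) ∈ U.graph)
      (fun x hx => U.mem_graph_iff.2 ⟨⟨x, hx⟩, rfl, (hL ⟨x, hx⟩).symm⟩)
      (hc.preimage (continuous_id.prodMk L.continuous)) x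
  have hx : ∀ x, ∃ h : x ∈ U.domain, U ⟨x, h⟩ = L x := fun x => by
    obtain ⟨x', hx1, hx2⟩ := U.mem_graph_iff.1 (hg x)
    obtain rfl : (x' : X) = x := hx1
    exact ⟨x'.2, hx2⟩
  refine ⟨L, fun x => ?_, hx⟩
  obtain ⟨h, h'⟩ := hx x
  rw [← h']
  exact hU ⟨x, h⟩

end DenselyDefined

/-! ### The resolvent of the Airy operator -/

section Resolvent

variable {Em Ep : Type*} {α β : Em ⊕ Ep → ℝ}

/-- Multiplication by a bounded family on the vertex space. -/
def diagVertex (m : Em ⊕ Ep → ℝ) (C : ℝ) (hC : 0 ≤ C) (hm : ∀ e, |m e| ≤ C) :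
    VertexSpace Em Ep →L[ℂ] VertexSpace Em Ep :=
  let T := WithLp.prodContinuousLinearEquiv 2 ℂ (Ell2 Em) (Ell2 Ep)
  T.symm.toContinuousLinearMap.comp
    ((((diagEll2 (fun e => m (.inl e)) C hC fun _ => hm _).comp (ContinuousLinearMap.fst ℂ _ _)).prod
      ((diagEll2 (fun e => m (.inr e)) C hC fun _ => hm _).comp
        (ContinuousLinearMap.snd ℂ _ _))).comp T.toContinuousLinearMap)

lemma coord_diagVertex (m : Em ⊕ Ep → ℝ) (C : ℝ) (hC : 0 ≤ C) (hm : ∀ e, |m e| ≤ C)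
    (x : VertexSpace Em Ep) (e : Em ⊕ Ep) :
    (diagVertex m C hC hm x).coord e = m e * x.coord e := by
  cases e <;> rfl

lemma exists_coord_inr (hα : ∀ e, 0 < α e) {C : ℝ} (hC : ∀ e, 1 / α e ≤ C) :
    ∃ J : (WEll2 fun e : Ep => α (.inr e)) →L[ℂ] VertexSpace Em Ep, ∀ y e,
      (J y).coord e = Sum.elim (fun _ => 0) (fun e => y e) e := by
  refine ⟨(toVertexSpace α hα C hC).comp (ContinuousLinearMap.inr ℂ _ _), fun y e => ?_⟩
  rw [ContinuousLinearMap.comp_apply, coord_toVertexSpace]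
  cases e with
  | inl e =>
    exact congrFun (WEll2.coe_eq (fun _ => hα _)
      (Lp.coeFn_zero ℂ 2 (weightMeasure fun e : Em => α (.inl e)))) e
  | inr e => rfl

lemma exists_restrict_inl (hα : ∀ e, 0 < α e) {A : ℝ} (hA : ∀ e, α e ≤ A) :
    ∃ W : VertexSpace Em Ep →L[ℂ] WEll2 fun e : Em => α (.inl e), ∀ b e,
      W b e = b.coord (.inl e) :=
  ⟨(Ell2.toWEll2 (w := fun e : Em => α (.inl e)) (fun _ => hα _) A fun _ => hA _).comp
    ((ContinuousLinearMap.fst ℂ (Ell2 Em) (Ell2 Ep)).comp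
      (WithLp.prodContinuousLinearEquiv 2 ℂ (Ell2 Em) (Ell2 Ep)).toContinuousLinearMap),
    fun b e => Ell2.toWEll2_apply (w := fun e : Em => α (.inl e)) (fun _ => hα _) A
      (fun _ => hA _) b.fst e⟩

lemma exists_restrict_inr (hα : ∀ e, 0 < α e) {A : ℝ} (hA : ∀ e, α e ≤ A) :
    ∃ W : VertexSpace Em Ep →L[ℂ] WEll2 fun e : Ep => α (.inr e), ∀ b e,
      W b e = b.coord (.inr e) :=
  ⟨(Ell2.toWEll2 (w := fun e : Ep => α (.inr e)) (fun _ => hα _) A fun _ => hA _).comp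
    ((ContinuousLinearMap.snd ℂ (Ell2 Em) (Ell2 Ep)).comp
      (WithLp.prodContinuousLinearEquiv 2 ℂ (Ell2 Em) (Ell2 Ep)).toContinuousLinearMap),
    fun b e => Ell2.toWEll2_apply (w := fun e : Ep => α (.inr e)) (fun _ => hα _) A
      (fun _ => hA _) b.snd e⟩

lemma re_inner_ofReal_mul (x y : ℂ) (k : ℝ) : (⟪x, (k : ℂ) * y⟫_ℂ).re = k * (⟪x, y⟫_ℂ).re := by
  rw [← smul_eq_mul, inner_smul_right, Complex.re_ofReal_mul]

/-- The coercivity estimate for the boundary system. -/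
lemma boundary_coercive (hα : ∀ e, 0 < α e) {C l : ℝ} (hC : ∀ e, 1 / α e ≤ C) {p θ : Em ⊕ Ep → ℝ}
    (hr : ∀ e, CharacteristicRoots (α e) (β e) l (p e) (θ e)) {ξ ζ : VertexSpace Em Ep}
    {q : WEll2 fun e : Em => α (.inl e)} {y r : WEll2 fun e : Ep => α (.inr e)}
    (hζ : ∀ e, ζ.coord e = ((α e * p e ^ 2 + β e / 2 : ℝ) : ℂ) * ξ.coord e
      + Sum.elim (fun _ => 0) (fun e => ((α (.inr e) * p (.inr e) : ℝ) : ℂ) * y e) e)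
    (hq : ∀ e, q e = p (.inl e) * ξ.coord (.inl e)) (hrq : ‖r‖ ≤ ‖q‖) :
    1 / (8 * (|C| + 1)) * (‖ξ‖ ^ 2 + ‖y‖ ^ 2) ≤ (⟪ξ, ζ⟫_ℂ).re + (⟪y, y - r⟫_ℂ).re := by
  set c := 1 / (8 * (|C| + 1)) with hc
  have hC0 := abs_nonneg C
  have hc0 : 0 < c := by positivity
  have hcα : ∀ e, c ≤ α e / 8 := fun e => by
    have h1 : 1 ≤ |C| * α e := (div_le_iff₀ (hα e)).1 ((hC e).trans (le_abs_self C))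
    rw [hc, div_le_iff₀ (by positivity)]
    nlinarith [hα e]
  have hc8 : c ≤ 1 / 8 := by
    rw [hc]
    exact one_div_le_one_div_of_le (by norm_num) (by linarith)
  -- The only place where `‖r‖ ≤ ‖q‖` enters, that is, where `U` being a contraction matters. The
  -- loss `‖q‖² / 2` is paid for by half of `α p²` on the incoming edges.
  have h1 : (‖y‖ ^ 2 - ‖q‖ ^ 2) / 2 ≤ (⟪y, y - r⟫_ℂ).re := by
    have h2 : (⟪y, r⟫_ℂ).re ≤ ‖y‖ * ‖r‖ := re_inner_le_norm (𝕜 := ℂ) y r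
    have h3 : (⟪y, y⟫_ℂ).re = ‖y‖ ^ 2 := by
      rw [inner_self_eq_norm_sq_to_K]
      norm_cast
    rw [inner_sub_right, Complex.sub_re, h3]
    have h4 : ‖y‖ * ‖r‖ ≤ ‖y‖ * ‖q‖ := by gcongr
    nlinarith [sq_nonneg (‖y‖ - ‖q‖)]
  have hy := WEll2.hasSum_norm_sq (fun e => (hα (.inr e)).le) y
  have hqs := WEll2.hasSum_norm_sq (fun e => (hα (.inl e)).le) q
  have s1 : HasSum (fun e => c * ‖ξ.coord e‖ ^ 2
      + Sum.elim (fun _ => 0) (fun e => c * (α (.inr e) * ‖y e‖ ^ 2)) e)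
      (c * ‖ξ‖ ^ 2 + (0 + c * ‖y‖ ^ 2)) :=
    ((VertexSpace.hasSum_norm_sq ξ).mul_left c).add
      (HasSum.sum (f := Sum.elim (fun _ : Em => (0 : ℝ)) fun e : Ep => c * (α (.inr e) * ‖y e‖ ^ 2))
        hasSum_zero (hy.mul_left c))
  have s2 : HasSum (fun e => (⟪ξ.coord e, ζ.coord e⟫_ℂ).re
      + Sum.elim (fun e => -(1 / 2) * (α (.inl e) * ‖q e‖ ^ 2))
        (fun e => 1 / 2 * (α (.inr e) * ‖y e‖ ^ 2)) e)
      ((⟪ξ, ζ⟫_ℂ).re + (-(1 / 2) * ‖q‖ ^ 2 + 1 / 2 * ‖y‖ ^ 2)) :=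
    (Complex.hasSum_re (VertexSpace.hasSum_inner ξ ζ)).add
      (HasSum.sum (f := Sum.elim (fun e => -(1 / 2) * (α (.inl e) * ‖q e‖ ^ 2))
        (fun e => 1 / 2 * (α (.inr e) * ‖y e‖ ^ 2))) (hqs.mul_left _) (hy.mul_left _))
  have hself : ∀ x : ℂ, (⟪x, x⟫_ℂ).re = ‖x‖ ^ 2 := fun x => by
    rw [inner_self_eq_norm_sq_to_K]
    norm_cast
  have key := hasSum_le (fun e => ?_) s1 s2
  · linarith
  · have hp1 := (hr e).one_le
    have hb := (abs_le.1 (hr e).abs_le).1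
    have ha := hα e
    have hca := hcα e
    have hap : α e ≤ α e * p e ^ 2 := le_mul_of_one_le_right ha.le (one_le_pow₀ hp1)
    rw [hζ e, inner_add_right, Complex.add_re, re_inner_ofReal_mul, hself]
    have hX := sq_nonneg ‖ξ.coord e‖
    cases e with
    | inl e =>
      simp only [Sum.elim_inl, inner_zero_right, Complex.zero_re, add_zero]
      have e1 : ‖q e‖ ^ 2 = p (.inl e) ^ 2 * ‖ξ.coord (.inl e)‖ ^ 2 := by
        rw [hq, norm_mul, mul_pow, Complex.norm_real, Real.norm_eq_abs, sq_abs]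
      rw [e1]
      have : 0 ≤ (α (.inl e) * p (.inl e) ^ 2 / 2 + β (.inl e) / 2 - c)
          * ‖ξ.coord (.inl e)‖ ^ 2 := mul_nonneg (by linarith) hX
      linarith
    | inr e =>
      simp only [Sum.elim_inr]
      rw [re_inner_ofReal_mul]
      set s := ‖ξ.coord (.inr e)‖
      set t := ‖y e‖
      have h2 : -(s * t) ≤ (⟪ξ.coord (.inr e), y e⟫_ℂ).re :=
        (abs_le.1 ((Complex.abs_re_le_norm _).trans (norm_inner_le_norm _ _))).1
      have h3 : 0 ≤ α (.inr e) * p (.inr e) * ((⟪ξ.coord (.inr e), y e⟫_ℂ).re + s * t) :=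
        mul_nonneg (mul_nonneg ha.le (by linarith)) (by linarith)
      have h4 : 0 ≤ (α (.inr e) * p (.inr e) ^ 2 / 8 + β (.inr e) / 2) * s ^ 2 :=
        mul_nonneg (by linarith) hX
      have h5 : 0 ≤ (α (.inr e) * p (.inr e) ^ 2 / 8 - c) * s ^ 2 := mul_nonneg (by linarith) hX
      have h6 : 0 ≤ α (.inr e) * (1 / 6 - c) * t ^ 2 :=
        mul_nonneg (mul_nonneg ha.le (by linarith)) (sq_nonneg t)
      -- A third of this square produces the cross term `-α p s t` at the cost of `α t² / 3` and
      -- `3/4 α p² s²`; the remainders `1/6` and `1/4` are what `h4`, `h5`, `h6` use.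
      have h7 : 0 ≤ α (.inr e) * (t - 3 / 2 * p (.inr e) * s) ^ 2 := mul_nonneg ha.le (sq_nonneg _)
      linarith

variable {Y : Submodule ℂ (VertexSpace Em Ep)}
  {U : WEll2 (fun e : Em => α (.inl e)) →ₗ.[ℂ] WEll2 (fun e : Ep => α (.inr e))}

/-- Solvability of the boundary system to which the resolvent equation reduces. -/
lemma exists_boundary_solution (hα : ∀ e, 0 < α e) {A B C D l : ℝ} (hA : ∀ e, α e ≤ A)
    (hC : ∀ e, 1 / α e ≤ C) (hB : ∀ e, |β e| ≤ B) {p θ : Em ⊕ Ep → ℝ}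
    (hr : ∀ e, CharacteristicRoots (α e) (β e) l (p e) (θ e)) (hD : ∀ e, p e ≤ D)
    (hY : IsClosed (Y : Set (VertexSpace Em Ep)))
    (hd : Dense (U.domain : Set (WEll2 fun e : Em => α (.inl e)))) (hc : U.IsClosed)
    (hU : IsContraction U) (d₀ d₁ d₂ : VertexSpace Em Ep) :
    ∃ x w : VertexSpace Em Ep, d₀ + x ∈ Y ∧
      (∃ z ∈ Yᗮ, ∀ e, z.coord e = orientation e * (α e * d₂.coord e + β e / 2 * d₀.coord e)
        - ((α e * p e ^ 2 + β e / 2) * x.coord e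
          + Sum.elim (fun _ => (0 : ℂ)) (fun _ => (α e : ℂ) * p e * w.coord e) e)) ∧
      ∃ X : U.domain, (∀ e, (X : WEll2 fun e : Em => α (.inl e)) e
          = d₁.coord (.inl e) + p (.inl e) * x.coord (.inl e)) ∧
        ∀ e, U X e = d₁.coord (.inr e) + w.coord (.inr e) := by
  obtain ⟨L, hL, hUL⟩ := hU.exists_continuousLinearMap hd hc
  have hp1 : ∀ e, 1 ≤ p e := fun e => (hr e).one_le
  have hpabs : ∀ e, |p e| ≤ |D| := fun e => by
    rw [abs_of_pos (by linarith [hp1 e])]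
    exact (hD e).trans (le_abs_self D)
  have hαabs : ∀ e, |α e| ≤ |A| := fun e => by
    rw [abs_of_pos (hα e)]
    exact (hA e).trans (le_abs_self A)
  have hβabs : ∀ e, |β e / 2| ≤ |B| := fun e => by
    rw [abs_div, abs_two]
    linarith [hB e, le_abs_self B, abs_nonneg (β e)]
  have hm₁ : ∀ e, |α e * p e ^ 2 + β e / 2| ≤ |A| * |D| ^ 2 + |B| := fun e => by
    refine (abs_add_le _ _).trans (add_le_add ?_ (hβabs e))
    rw [abs_mul, abs_pow]
    exact mul_le_mul (hαabs e) (pow_le_pow_left₀ (abs_nonneg _) (hpabs e) 2) (by positivity)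
      (abs_nonneg A)
  have hm₂ : ∀ e, |α e * p e| ≤ |A| * |D| := fun e => by
    rw [abs_mul]
    exact mul_le_mul (hαabs e) (hpabs e) (abs_nonneg _) (abs_nonneg A)
  obtain ⟨S, hS⟩ : ∃ S : VertexSpace Em Ep →L[ℂ] VertexSpace Em Ep, ∀ b e,
      (S b).coord e = ((α e * p e ^ 2 + β e / 2 : ℝ) : ℂ) * b.coord e :=
    ⟨diagVertex _ _ (by positivity) hm₁, fun b e => coord_diagVertex _ _ _ _ _ _⟩
  obtain ⟨J, hJ⟩ := exists_coord_inr hα hC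
  obtain ⟨S', hS'⟩ : ∃ S' : (WEll2 fun e : Ep => α (.inr e)) →L[ℂ] VertexSpace Em Ep, ∀ y e,
      (S' y).coord e =
        Sum.elim (fun _ => 0) (fun e => ((α (.inr e) * p (.inr e) : ℝ) : ℂ) * y e) e := by
    refine ⟨(diagVertex _ _ (by positivity) hm₂).comp J, fun y e => ?_⟩
    rw [ContinuousLinearMap.comp_apply, coord_diagVertex, hJ]
    cases e with
    | inl e => exact mul_zero _
    | inr e => rfl
  obtain ⟨W, hW⟩ := exists_restrict_inl hα hA
  obtain ⟨W', hW'⟩ := exists_restrict_inr hα hA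
  obtain ⟨Q, hQ⟩ : ∃ Q : VertexSpace Em Ep →L[ℂ] WEll2 fun e : Em => α (.inl e), ∀ b e,
      Q b e = p (.inl e) * b.coord (.inl e) := by
    refine ⟨W.comp (diagVertex p _ (abs_nonneg D) hpabs), fun b e => ?_⟩
    rw [ContinuousLinearMap.comp_apply, hW, coord_diagVertex]
  obtain ⟨g₀, hg₀⟩ : ∃ g₀ : VertexSpace Em Ep, ∀ e, g₀.coord e =
      orientation e * (α e * d₂.coord e + β e / 2 * d₀.coord e) := by
    have ho : ∀ e : Em ⊕ Ep, |orientation e| ≤ 1 := fun e => (abs_orientation e).le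
    refine ⟨diagVertex orientation 1 zero_le_one ho (diagVertex α _ (abs_nonneg A) hαabs d₂
      + diagVertex (fun e => β e / 2) _ (abs_nonneg B) hβabs d₀), fun e => ?_⟩
    rw [coord_diagVertex, VertexSpace.coord_add, coord_diagVertex, coord_diagVertex]
    push_cast
    rfl
  have : CompleteSpace Y := hY.completeSpace_coe
  -- The substitution `x = ξ - η` turns the affine condition `d₀ + x ∈ Y` into the linear condition
  -- `ξ ∈ Y`.
  let η := d₀ - Y.starProjection d₀
  obtain ⟨ξ, hξ, y, hz, hy⟩ := exists_solution_of_coercive hY S S' (L.comp Q)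
    (c := 1 / (8 * (|C| + 1))) (by positivity) (fun ξ y => boundary_coercive hα hC hr
      (fun e => by rw [VertexSpace.coord_add, hS, hS']) (hQ ξ) (hL (Q ξ)))
    (g₀ + S η) (L (W d₁ - Q η) - W' d₁)
  refine ⟨ξ - η, J y, ?_, ⟨-(S ξ + S' y - (g₀ + S η)), Submodule.neg_mem _ hz, fun e => ?_⟩,
    ⟨W d₁ + Q (ξ - η), (hUL _).1⟩, fun e => ?_, fun e => ?_⟩
  · have e1 : d₀ + (ξ - η) = ξ + Y.starProjection d₀ := by simp only [η]; abel
    rw [e1]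
    exact Y.add_mem hξ (Submodule.starProjection_apply_mem Y d₀)
  · have e1 : -(S ξ + S' y - (g₀ + S η)) = g₀ - (S (ξ - η) + S' y) := by
      rw [map_sub S ξ η]; abel
    rw [e1, VertexSpace.coord_sub, VertexSpace.coord_add, hS, hS', hg₀, hJ]
    push_cast
    cases e <;> rfl
  · rw [WEll2.coe_add (fun _ => hα _), hW, hQ]
  · have e1 : L (W d₁ + Q (ξ - η)) = W' d₁ + y := by
      have h1 : y = L (Q ξ) + (L (W d₁ - Q η) - W' d₁) := by
        rw [← hy]; simp
      rw [h1]
      simp only [map_sub, map_add]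
      abel
    rw [(hUL (W d₁ + Q (ξ - η))).2, e1, WEll2.coe_add (fun _ => hα _), hW', hJ]
    rfl

lemma memℓp_two_of_norm_le_coord {h : ∀ e : Em ⊕ Ep, EdgeL2 e} {x w : VertexSpace Em Ep} {M : ℝ}
    (hh : ∀ e, ‖h e‖ ≤ M * (‖x.coord e‖ + ‖w.coord e‖)) : Memℓp h 2 := by
  refine memℓp_two_of_summable (Summable.of_nonneg_of_le (fun _ => sq_nonneg _) (fun e => ?_)
    (((VertexSpace.hasSum_norm_sq x).summable.add
      (VertexSpace.hasSum_norm_sq w).summable).mul_left (2 * M ^ 2)))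
  refine (pow_le_pow_left₀ (norm_nonneg _) (hh e) 2).trans ?_
  have h1 : 0 ≤ M ^ 2 * (‖x.coord e‖ - ‖w.coord e‖) ^ 2 := by positivity
  linarith

/-- The solution is an edgewise particular solution, whose boundary values are arbitrary, plus a
homogeneous one chosen by `exists_boundary_solution` to correct them. Edge-uniform estimates put
both in the Hilbert sum. -/
lemma exists_mem_graph_sub_eq (hα : ∀ e, 0 < α e) {A B C : ℝ} (hA : ∀ e, α e ≤ A)
    (hC : ∀ e, 1 / α e ≤ C) (hB : ∀ e, |β e| ≤ B) (hY : IsClosed (Y : Set (VertexSpace Em Ep)))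
    (hd : Dense (U.domain : Set (WEll2 fun e : Em => α (.inl e)))) (hc : U.IsClosed)
    (hU : IsContraction U) : ∃ N : ℝ, ∀ l : ℝ, N ≤ l → ∀ f,
      ∃ q ∈ (separatedAiry α β Y U).graph, (l : ℂ) • q.1 - q.2 = f := by
  obtain ⟨N, hN⟩ := exists_characteristicRoots A C B
  refine ⟨N, fun l hl f => ?_⟩
  obtain ⟨D, hD⟩ := hN l hl
  choose p θ hr hpD hθD using fun e => hD (α e) (β e) (hα e) (hA e) (hC e) (hB e)
  obtain ⟨M, hM⟩ := exists_edge_resolvent Em Ep D C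
  obtain ⟨M', hM'⟩ := exists_edge_kernel Em Ep D
  choose v v₁ v₂ v₃ hv hv₁ hv₂ hvf n0 n1 n2 n3 using fun e =>
    hM e (α e) (β e) l (p e) (θ e) (hα e) (hC e) (hr e) (hpD e) (hθD e) (f e)
  let V : L2G Em Ep := ⟨v, memℓp_two_of_norm_le n0⟩
  let V₁ : L2G Em Ep := ⟨v₁, memℓp_two_of_norm_le n1⟩
  let V₂ : L2G Em Ep := ⟨v₂, memℓp_two_of_norm_le n2⟩
  let V₃ : L2G Em Ep := ⟨v₃, memℓp_two_of_norm_le n3⟩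
  have hV : HasDerivG V V₁ := hv
  have hV₁ : HasDerivG V₁ V₂ := hv₁
  have hV₂ : HasDerivG V₂ V₃ := hv₂
  obtain ⟨d₀, hd₀⟩ := hV.exists_boundaryValues
  obtain ⟨d₁, hd₁⟩ := hV₁.exists_boundaryValues
  obtain ⟨d₂, hd₂⟩ := hV₂.exists_boundaryValues
  obtain ⟨x, w, hx, ⟨z, hz, hzc⟩, X, hX, hUX⟩ :=
    exists_boundary_solution hα hA hC hB hr hpD hY hd hc hU d₀ d₁ d₂
  choose h h₁ h₂ h₃ kh kh₁ kh₂ khl t0 t1 ht2 m0 m1 m2 m3 using fun e =>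
    hM' e (α e) (β e) l (p e) (θ e) (hr e) (hpD e) (hθD e) (x.coord e) (w.coord e)
  choose b t2 hb using ht2
  let H : L2G Em Ep := ⟨h, memℓp_two_of_norm_le_coord m0⟩
  let H₁ : L2G Em Ep := ⟨h₁, memℓp_two_of_norm_le_coord m1⟩
  let H₂ : L2G Em Ep := ⟨h₂, memℓp_two_of_norm_le_coord m2⟩
  let H₃ : L2G Em Ep := ⟨h₃, memℓp_two_of_norm_le_coord m3⟩
  have hH : HasDerivG H H₁ := kh
  have hH₁ : HasDerivG H₁ H₂ := kh₁
  have hH₂ : HasDerivG H₂ H₃ := kh₂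
  have b0 : HasBoundaryValues H x.coord := t0
  have b1 : HasBoundaryValues H₁ fun e => Sum.elim (fun _ => (p e : ℂ) * x.coord e)
    (fun _ => w.coord e) e := t1
  have b2 : HasBoundaryValues H₂ b := t2
  refine ⟨(V + H, (l : ℂ) • (V + H) - f), mem_graph_separatedAiry.2
    ⟨⟨V₁ + H₁, V₂ + H₂, V₃ + H₃, hV.add hH, hV₁.add hH₁, hV₂.add hH₂, fun e => ?_⟩,
      V₁ + H₁, V₂ + H₂, hV.add hH, hV₁.add hH₁, _, _, _, hd₀.add b0, hd₁.add b1, hd₂.add b2,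
      ⟨_, hx, fun e => rfl, fun e => rfl⟩, ⟨z, hz, fun e => ?_, fun e => ?_⟩, X,
      Eventually.of_forall hX, Eventually.of_forall hUX⟩, sub_sub_cancel _ _⟩
  · change (l : ℂ) • (v e + h e) - f e
      = (α e : ℂ) • (v₃ e + h₃ e) + (β e : ℂ) • (v₁ e + h₁ e)
    have e1 := khl e
    rw [sub_eq_zero] at e1
    rw [← hvf e, smul_add, e1]
    module
  · refine (hzc (.inl e)).trans ?_
    have h1 := hb (.inl e)
    simp only [orientation, Sum.elim_inl, Pi.add_apply] at h1 ⊢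
    push_cast at h1 ⊢
    linear_combination -h1
  · refine (hzc (.inr e)).trans ?_
    have h1 := hb (.inr e)
    simp only [orientation, Sum.elim_inr, Pi.add_apply] at h1 ⊢
    push_cast at h1 ⊢
    linear_combination -h1

end Resolvent

end StarGraph

end

theorem theorem3p17 {Em Ep : Type*} [Countable Em] [Countable Ep] (α β : Em ⊕ Ep → ℝ)
    (hα : ∀ e, 0 < α e) (hα_bdd : ∃ C : ℝ, ∀ e, α e ≤ C) (hα_inv : ∃ C : ℝ, ∀ e, 1 / α e ≤ C)
    (hβ_bdd : ∃ C : ℝ, ∀ e, |β e| ≤ C)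
    (Y : Submodule ℂ (StarGraph.VertexSpace Em Ep))
    (hY : IsClosed (Y : Set (StarGraph.VertexSpace Em Ep)))
    (U : StarGraph.WEll2 (fun e : Em => α (.inl e)) →ₗ.[ℂ]
      StarGraph.WEll2 (fun e : Ep => α (.inr e)))
    (hU : Dense (U.domain : Set (StarGraph.WEll2 fun e : Em => α (.inl e)))) :
    (StarGraph.GeneratesContractionSemigroup (StarGraph.separatedAiry α β Y U) ↔
      U.IsClosed ∧ StarGraph.IsContraction U ∧ StarGraph.IsContraction U†) ∧
    (StarGraph.IsContraction U ∧ StarGraph.IsContraction U† ↔ StarGraph.IsContraction U) := by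
  obtain ⟨A, hA⟩ := hα_bdd
  obtain ⟨C, hC⟩ := hα_inv
  obtain ⟨B, hB⟩ := hβ_bdd
  refine ⟨⟨fun h => ?_, fun ⟨hc, hUc, _⟩ => ?_⟩, And.left, fun h => ⟨h, h.adjoint hU⟩⟩
  · obtain ⟨hc, hUc⟩ := StarGraph.isContraction_of_generates hα hA hC hB h
    exact ⟨hc, hUc, hUc.adjoint hU⟩
  · obtain ⟨N, hN⟩ := StarGraph.exists_mem_graph_sub_eq hα hA hC hB hY hU hc hUc
    exact StarGraph.generatesContractionSemigroup_of_dissipative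
      (fun q hq => StarGraph.dissipative_separatedAiry hα hUc hq) hN
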